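/- Let $\rho^* := 1+\frac{1}{1+4\ln(5/4)}$. Then $\rho^*<1.5284$, and the following hold. Let $(V,c)$ be a finite metric space, $s,t\in V$ with $s\neq t$, and $E=\binom V2$. An \emph{$s$-$t$-tour} is a Hamiltonian path from $s$ to $t$ in the complete graph on $V$; its cost is the sum of the costs of its edges. For $U\subseteq V$ let $\delta(U)$ be the set of edges with exactly one endpoint in $U$; write $x(F)=\sum_{e\in F}x(e)$, $c(F)=\sum_{e\in F}c(e)$ and $c(x)=\sum_{e\in E}c(e)x(e)$. Consider the LP: minimize $c(x)$ over all $x\in\mathbb R^E_{\ge 0}$ with $x(\delta(U))\ge 2$ for $\emptyset\ne U\subseteq V\setminus\{s,t\}$, $x(\delta(U))\ge 1$ for $\{s\}\subseteq U\subseteq V\setminus\{t\}$, $x(\delta(v))=2$ for $v\in V\setminus\{s,t\}$, and $x(\delta(s))=x(\delta(t))=1$. For an optimum LP solution $x^*$ let $\mathcal N=\{\delta(U): s\in U\subseteq V\setminus\{t\},\ x^*(\delta(U))<2\}$. A \emph{Gottschalk–Vygen decomposition} of $x^*$ consists of spanning trees $(V,S_1),\dots,(V,S_k)$ and $p_1,\dots,p_k\ge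 0$ with $\sum_j p_j=1$ and $x^*=\sum_j p_j\chi^{S_j}$, such that for every $C\in\mathcal N$ there is an $r\in\{1,\dots,k\}$ with $\sum_{j=1}^r p_j=2-x^*(C)$ and $|C\cap S_j|=1$ for all $j\le r$. An edge $e$ and a cut $C\in\mathcal N$ are \emph{lonely} in $S_j$ if $C\cap S_j=\{e\}$ and $\sum_{i=1}^j p_i\le 2-x^*(C)$. Let $\mathcal L(S_j)$ be the set of lonely cuts of $S_j$, let $F_j$ be $S_j$ without its lonely edges, let $T_j=\{v: |F_j\cap\delta(v)|\text{ odd}\}\,\triangle\,\{s,t\}$, and let $$c^j(e)=c(e)+\sum_{C\in\mathcal L(S_j),\,e\in C}2c(C\cap S_j)-\max\Bigl\{0,\max_{C\in\mathcal L(S_j),\,e\in C}2c(C\cap S_j)\Bigr\}.$$ The \emph{best-of-many Christofides algorithm with lonely edge deletion} takes an optimum LP solution $x^*$ and a Gottschalk–Vygen decomposition of it. For each $j=1,\dots,k$ it takes a $T_j$-join $J_j\subseteq E$ (an edge set whose set of odd-degree vertices is $T_j$) of minimum $c^j$-cost, then a minimum-$c$-cost set $R_j\subseteq S_j\setminus F_j$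 such that $(V,F_j\cup J_j\cup R_j)$ is connected, then an Eulerian $s$-$t$-walk in the multigraph with edge multiset $F_j\mathbin{\dot\cup}J_j\mathbin{\dot\cup}R_j\mathbin{\dot\cup}R_j$, which it shortcuts to an $s$-$t$-tour by skipping repeated visits of vertices. It returns a cheapest of these $k$ tours. Then an optimum LP solution exists; every optimum LP solution $x^*$ has a Gottschalk–Vygen decomposition; for every such $x^*$ and every such decomposition all steps can be carried out; and, however the choices in the individual steps are made, the algorithm returns an $s$-$t$-tour of cost at most $\rho^*\,c(x^*)$. Consequently, the integrality ratio of this LP, that is, the supremum over all finite metric spaces $(V,c)$ and all distinct $s,t\in V$ of the minimum cost of an $s$-$t$-tour divided by the LP value, is at most $\rho^*$. -/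

import Mathlib

universe u

noncomputable section

namespace STPathTSP

/-- The edges of the complete graph on `V`: the two-element subsets of `V`. -/
abbrev Edge (V : Type u) : Type u := {e : Sym2 V // ¬ e.IsDiag}

instance instFintypeEdge (V : Type u) [Fintype V] : Fintype (Edge V) := Fintype.ofFinite _

instance instDecidableEqEdge (V : Type u) : DecidableEq (Edge V) := Classical.decEq _

/-- The constant `ρ* = 1 + 1 / (1 + 4 ln (5/4))`. -/
def rhoStar : ℝ := 1 + 1 / (1 + 4 * Real.log (5 / 4))

section Graph

variable {V : Type u} [Fintype V]

/-- The cut `δ(U)`: all edges with exactly one endpoint in `U`. -/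
def cut (U : Set V) : Finset (Edge V) :=
  open Classical in
  Finset.univ.filter fun e => ∃ v ∈ U, ∃ w ∉ U, e.1 = s(v, w)

/-- The graph `(V, F)`. -/
def graph (F : Finset (Edge V)) : SimpleGraph V :=
  SimpleGraph.fromEdgeSet {e | ∃ f ∈ F, f.1 = e}

/-- `(V, S)` is a spanning tree. -/
def IsSpanningTree (S : Finset (Edge V)) : Prop := (graph S).IsTree

/-- The set of odd-degree vertices of `(V, F)`. -/
def oddVertices (F : Finset (Edge V)) : Set V := {v | Odd (F ∩ cut {v}).card}

/-- `J` is a `T`-join: `T` is the set of odd-degree vertices of `(V, J)`. -/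
def IsTJoin (T : Set V) (J : Finset (Edge V)) : Prop := oddVertices J = T

/-- The incidence vector `χ^F`. -/
def incidence (F : Finset (Edge V)) (e : Edge V) : ℝ := if e ∈ F then 1 else 0

/-- The feasible region of the standard LP relaxation of the `s`-`t`-path TSP. -/
structure LPFeasible (s t : V) (x : Edge V → ℝ) : Prop where
  two_le : ∀ U : Set V, U.Nonempty → s ∉ U → t ∉ U → 2 ≤ ∑ e ∈ cut U, x e
  one_le : ∀ U : Set V, s ∈ U → t ∉ U → 1 ≤ ∑ e ∈ cut U, x e
  degree_inner : ∀ v : V, v ≠ s → v ≠ t → ∑ e ∈ cut {v}, x e = 2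
  degree_source : ∑ e ∈ cut {s}, x e = 1
  degree_target : ∑ e ∈ cut {t}, x e = 1
  nonneg : ∀ e, 0 ≤ x e

/-- The set `𝒩` of narrow cuts with respect to `x`. -/
def narrowCuts (s t : V) (x : Edge V → ℝ) : Finset (Finset (Edge V)) :=
  open Classical in
  Finset.univ.filter fun C => (∃ U : Set V, s ∈ U ∧ t ∉ U ∧ C = cut U) ∧ ∑ e ∈ C, x e < 2

/-- A Gottschalk–Vygen decomposition of `x`: a convex combination
`x = ∑ j, p j • χ^{S j}` of spanning trees, in a fixed order, such that for every narrow cut `C`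
some initial segment of the trees has total weight exactly `2 - x(C)` and all trees in this
segment contain exactly one edge of `C`. -/
structure GVDecomposition (s t : V) (x : Edge V → ℝ) where
  /-- the number of trees -/
  k : ℕ
  /-- the trees -/
  S : Fin k → Finset (Edge V)
  /-- the coefficients -/
  p : Fin k → ℝ
  isSpanningTree : ∀ j, IsSpanningTree (S j)
  p_nonneg : ∀ j, 0 ≤ p j
  p_sum : ∑ j, p j = 1
  eq_sum : ∀ e, x e = ∑ j, p j * incidence (S j) e
  narrow : ∀ C ∈ narrowCuts s t x, ∃ r : Fin k,
    ∑ j ∈ Finset.Iic r, p j = 2 - ∑ e ∈ C, x e ∧ ∀ j ≤ r, (C ∩ S j).card = 1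

namespace GVDecomposition

variable {s t : V} {x : Edge V → ℝ} (D : GVDecomposition s t x)

/-- Edge `e` is lonely at the cut `C` in the tree `S j`. -/
def IsLonelyAt (j : Fin D.k) (e : Edge V) (C : Finset (Edge V)) : Prop :=
  C ∈ narrowCuts s t x ∧ C ∩ D.S j = {e} ∧ ∑ i ∈ Finset.Iic j, D.p i ≤ 2 - ∑ f ∈ C, x f

/-- The set `ℒ(S j)` of lonely cuts of the tree `S j`. -/
def lonelyCuts (j : Fin D.k) : Finset (Finset (Edge V)) :=
  open Classical in
  Finset.univ.filter fun C => ∃ e, D.IsLonelyAt j e C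

/-- The lonely edges of the tree `S j`. -/
def lonelyEdges (j : Fin D.k) : Finset (Edge V) :=
  open Classical in
  Finset.univ.filter fun e => ∃ C, D.IsLonelyAt j e C

/-- The forest `F j` that results from the tree `S j` by deleting its lonely edges. -/
def forest (j : Fin D.k) : Finset (Edge V) := D.S j \ D.lonelyEdges j

/-- The set `T j` of vertices whose degree in `F j` has the wrong parity. -/
def wrongParity (j : Fin D.k) : Set V := symmDiff (oddVertices (D.forest j)) {s, t}

end GVDecomposition

end Graph

section Metric

variable {V : Type u} [Fintype V] [MetricSpace V]

/-- The cost `c(v, w)` of the pair `{v, w}`. -/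
def pairCost : Sym2 V → ℝ := Sym2.lift ⟨fun v w => dist v w, dist_comm⟩

/-- The cost `c(F)` of an edge set. -/
def cost (F : Finset (Edge V)) : ℝ := ∑ e ∈ F, pairCost e.1

/-- The LP objective `c(x)`. -/
def lpCost (x : Edge V → ℝ) : ℝ := ∑ e, pairCost e.1 * x e

/-- `x` is an optimum solution to the LP. -/
def IsLPOptimum (s t : V) (x : Edge V → ℝ) : Prop :=
  LPFeasible s t x ∧ ∀ y, LPFeasible s t y → lpCost x ≤ lpCost y

/-- The length of a walk. -/
def walkCost {s t : V} (P : (⊤ : SimpleGraph V).Walk s t) : ℝ := (P.edges.map pairCost).sum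

/-- An `s`-`t`-tour: a Hamiltonian path from `s` to `t` in the complete graph on `V`. -/
def IsTour {s t : V} (P : (⊤ : SimpleGraph V).Walk s t) : Prop :=
  open Classical in P.IsHamiltonian

namespace GVDecomposition

variable {s t : V} {x : Edge V → ℝ} (D : GVDecomposition s t x)

/-- The modified cost `c^j`, accounting for the reconnection cost. The last term is
`max {0, max_{C ∈ ℒ(S j), e ∈ C} 2 c(C ∩ S j)}`. -/
def modCost (j : Fin D.k) (e : Edge V) : ℝ :=
  pairCost e.1 + ∑ C ∈ (D.lonelyCuts j).filter (e ∈ ·), 2 * cost (C ∩ D.S j)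
    - ((D.lonelyCuts j).filter (e ∈ ·)).fold max 0 fun C => 2 * cost (C ∩ D.S j)

/-- `J` is a `T j`-join of minimum `c^j`-cost. -/
def IsMinJoin (j : Fin D.k) (J : Finset (Edge V)) : Prop :=
  IsTJoin (D.wrongParity j) J ∧ ∀ J', IsTJoin (D.wrongParity j) J' →
    ∑ e ∈ J, D.modCost j e ≤ ∑ e ∈ J', D.modCost j e

/-- `R` is a set of deleted edges that reconnects `F j ∪ J`. -/
def Reconnects (j : Fin D.k) (J R : Finset (Edge V)) : Prop :=
  R ⊆ D.S j \ D.forest j ∧ (graph (D.forest j ∪ J ∪ R)).Connected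

/-- `R` is a minimum-cost set of deleted edges that reconnects `F j ∪ J`. -/
def IsMinReconnection (j : Fin D.k) (J R : Finset (Edge V)) : Prop :=
  D.Reconnects j J R ∧ ∀ R', D.Reconnects j J R' → cost R ≤ cost R'

/-- The multiset `H j`, the disjoint union of `F j`, `J` and two copies of `R`. -/
def tourEdges (j : Fin D.k) (J R : Finset (Edge V)) : Multiset (Edge V) :=
  (D.forest j).val + J.val + R.val + R.val

/-- `P` is a possible result of the iteration for the tree `S j`: for some minimum `c^j`-cost
`T j`-join `J`, some minimum-cost reconnection `R` and some Eulerian `s`-`t`-walk `W` in `H j`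
(a walk that uses each edge exactly as often as it occurs in `H j`), the Hamiltonian path `P` arises
from `W` by skipping repeated visits of vertices. -/
def IsTourOfTree (j : Fin D.k) (P : (⊤ : SimpleGraph V).Walk s t) : Prop :=
  ∃ J R : Finset (Edge V), D.IsMinJoin j J ∧ D.IsMinReconnection j J R ∧
    ∃ W : (⊤ : SimpleGraph V).Walk s t,
      (W.edges : Multiset (Sym2 V)) = (D.tourEdges j J R).map Subtype.val ∧
      IsTour P ∧ P.support.Sublist W.support

/-- `P` is a possible output of the best-of-many Christofides algorithm with lonely edge deletion
when it works with the decomposition `D`: a cheapest among tours computed from the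
individual trees. -/
def IsOutput (P : (⊤ : SimpleGraph V).Walk s t) : Prop :=
  ∃ Q : Fin D.k → (⊤ : SimpleGraph V).Walk s t, (∀ j, D.IsTourOfTree j (Q j)) ∧
    ∃ i, P = Q i ∧ ∀ j, walkCost (Q i) ≤ walkCost (Q j)

end GVDecomposition

/-- The minimum length of an `s`-`t`-tour. -/
def optValue (s t : V) : ENNReal :=
  ⨅ (P : (⊤ : SimpleGraph V).Walk s t) (_ : IsTour P), ENNReal.ofReal (walkCost P)

/-- The value of the LP. -/
def lpValue (s t : V) : ENNReal :=
  ⨅ (x : Edge V → ℝ) (_ : LPFeasible s t x), ENNReal.ofReal (lpCost x)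

end Metric

/-- The integrality ratio of the LP: the supremum, over all instances of the `s`-`t`-path TSP,
of the ratio of the minimum length of an `s`-`t`-tour and the LP value. -/
def integralityRatio : ENNReal :=
  ⨆ (V : Type u) (_ : Fintype V) (_ : MetricSpace V) (s : V) (t : V) (_ : s ≠ t),
    optValue s t / lpValue s t

end STPathTSP

end

set_option linter.unusedSectionVars false

/-! ### Edge sets and cuts of the complete graph -/

noncomputable section

namespace STPathTSP

variable {V : Type u} [Fintype V]

/-! Write τ = 2 - x(C) for the slack of a narrow cut C. The tour computed from S_j costs at most
c(F_j) plus the c^j-cost of any T_j-join. A join meets every lonely cut, and a join edge f makes up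
for one deleted edge, a most expensive one among the lonely cuts containing f; the lonely edges of
the other lonely cuts through f are doubled, which is what c^j charges (`exists_reconnects`).

By the T-join polyhedron theorem (`exists_join_cost_le`), some join is no more expensive than any
nonnegative vector with weight at least 1 on every T_j-cut. For 0 ≤ α ≤ 1, `joinVector` is (1-α)/2 x
+ α χ^{S_j} plus corrections at narrow cuts. A lonely cut contains one tree edge and lacks (1-α)τ/2,
which is added on that edge. A narrow T_j-cut that is not lonely contains at least two tree edges
(`one_le_sum_joinVector`) and lacks at most max(0, (τ - α(τ+2))/2), which is put on lonely edges of
C from earlier trees; there c^j equals c. Moreover c^j(x) is at most c(x) plus the sum of 2(1-τ) c(C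
∩ S_j) over the lonely cuts, because any family of distinct narrow cuts has a union of x-weight at
least its size (`LPFeasible.card_le_sum_biUnion`, `sum_le_sum_mul_fold_max`). Altogether each lonely
cut yields a gain and each other narrow cut causes a loss (`exists_join_sum_modCost_le`).

The interval [0,1] is divided into consecutive pieces of lengths p_j, and at the point σ the bound
is used with α = σ/(8+σ) and multiplied by (8+σ)/(2(4+σ)) = 1/2 + 2/(4+σ). This makes the
coefficient of c(S_j) equal to 1, so that the trees average to c(x). A cut of slack τ gains
(4τ+σ)/(2(4+σ)) for σ < τ and loses max(0, (4τ-σ)/(2(4+σ))) for σ > τ; the total loss is at most the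
total gain (`integral_loss_le_integral_gain`). Integration leaves M (1/2 + 2 ln(5/4)) ≤ (1 + 2
ln(5/4)) c(x) for the cheapest tour cost M, which is the ratio ρ*.

Decompositions exist because narrow cuts form a chain (`LPFeasible.narrow_chain`) and trees can be
peeled off greedily: at each stage the support contains a spanning tree that is tight on all tight
sets of the spanning tree polytope and crosses each remaining narrow cut once
(`SparseChain.exists_tree`). An optimum exists by compactness and an explicit feasible point; a
maximal trail gives the Eulerian walk, and shortcutting does not increase its cost. -/

lemma Edge.exists_rep (e : Edge V) : ∃ a b : V, a ≠ b ∧ e.1 = s(a, b) := by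
  obtain ⟨e, he⟩ := e
  induction e using Sym2.ind with
  | _ a b => exact ⟨a, b, by simpa using he, rfl⟩

/-- The edge joining two distinct vertices. -/
def mkEdge (a b : V) (h : a ≠ b) : Edge V := ⟨s(a, b), by simpa using h⟩

lemma Edge.exists_mkEdge (e : Edge V) : ∃ (a b : V) (h : a ≠ b), e = mkEdge a b h := by
  obtain ⟨a, b, h, he⟩ := e.exists_rep
  exact ⟨a, b, h, Subtype.ext he⟩

@[simp] lemma mkEdge_mem_cut {a b : V} (h : a ≠ b) (U : Set V) :
    mkEdge a b h ∈ cut U ↔ (a ∈ U ∧ b ∉ U) ∨ (b ∈ U ∧ a ∉ U) := by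
  simp only [cut, mkEdge, Finset.mem_filter, Finset.mem_univ, true_and, Sym2.eq_iff]
  constructor
  · rintro ⟨v, hv, w, hw, ⟨rfl, rfl⟩ | ⟨rfl, rfl⟩⟩ <;> tauto
  · rintro (⟨h1, h2⟩ | ⟨h1, h2⟩)
    · exact ⟨a, h1, b, h2, Or.inl ⟨rfl, rfl⟩⟩
    · exact ⟨b, h1, a, h2, Or.inr ⟨rfl, rfl⟩⟩

lemma mem_cut_iff {e : Edge V} {U : Set V} :
    e ∈ cut U ↔ ∃ a ∈ U, ∃ b ∉ U, e.1 = s(a, b) := by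
  simp [cut]

lemma cut_compl (U : Set V) : cut Uᶜ = cut U := by
  ext e
  obtain ⟨a, b, h, rfl⟩ := e.exists_mkEdge
  simp only [mkEdge_mem_cut, Set.mem_compl_iff]
  tauto

@[simp] lemma cut_univ : cut (Set.univ : Set V) = ∅ := by
  ext e; simp [cut]

/-- The edges with both endpoints in `X`. -/
def inside (X : Set V) : Finset (Edge V) :=
  open Classical in Finset.univ.filter fun e => ∀ v ∈ e.1, v ∈ X

@[simp] lemma mkEdge_mem_inside {a b : V} (h : a ≠ b) (X : Set V) :
    mkEdge a b h ∈ inside X ↔ a ∈ X ∧ b ∈ X := by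
  simp [inside, mkEdge]

/-- The edges with one endpoint in `A` and one in `B`. -/
def between (A B : Set V) : Finset (Edge V) :=
  open Classical in Finset.univ.filter fun e => ∃ a ∈ A, ∃ b ∈ B, e.1 = s(a, b)

@[simp] lemma mkEdge_mem_between {a b : V} (h : a ≠ b) (A B : Set V) :
    mkEdge a b h ∈ between A B ↔ (a ∈ A ∧ b ∈ B) ∨ (b ∈ A ∧ a ∈ B) := by
  simp only [between, mkEdge, Finset.mem_filter, Finset.mem_univ, true_and, Sym2.eq_iff]
  constructor
  · rintro ⟨v, hv, w, hw, ⟨rfl, rfl⟩ | ⟨rfl, rfl⟩⟩ <;> tauto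
  · rintro (⟨h1, h2⟩ | ⟨h1, h2⟩)
    · exact ⟨a, h1, b, h2, Or.inl ⟨rfl, rfl⟩⟩
    · exact ⟨b, h1, a, h2, Or.inr ⟨rfl, rfl⟩⟩

@[simp] lemma inside_univ : inside (Set.univ : Set V) = Finset.univ := by
  ext e; simp [inside]

open Classical in
lemma sum_finset_eq_ite {M : Type*} [AddCommMonoid M] (f : Edge V → M) (A : Finset (Edge V)) :
    ∑ e ∈ A, f e = ∑ e, if e ∈ A then f e else 0 := by
  simp

-- Handshake identity: an edge inside X is counted at both ends, a cut edge once. The values lie in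
-- a general monoid since the identity is needed both for LP weights in ℝ and for parities in `ZMod
-- 2`.
open Classical in
lemma sum_cut_singleton {M : Type*} [AddCommMonoid M] (f : Edge V → M) (X : Set V) :
    ∑ v with v ∈ X, ∑ e ∈ cut {v}, f e = 2 • ∑ e ∈ inside X, f e + ∑ e ∈ cut X, f e := by
  simp only [sum_finset_eq_ite f, Finset.smul_sum]
  rw [Finset.sum_comm, ← Finset.sum_add_distrib]
  refine Finset.sum_congr rfl fun e _ => ?_
  obtain ⟨a, b, h, rfl⟩ := e.exists_mkEdge
  simp only [mkEdge_mem_cut, mkEdge_mem_inside, Set.mem_singleton_iff]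
  have h1 : ∀ v : V, (if (a = v ∧ ¬ b = v) ∨ (b = v ∧ ¬ a = v) then f (mkEdge a b h) else 0) =
      (if v = a then f (mkEdge a b h) else 0) + (if v = b then f (mkEdge a b h) else 0) := by
    intro v
    by_cases ha : v = a
    · subst ha; simp [h, Ne.symm h]
    · by_cases hb : v = b
      · subst hb; simp [h, Ne.symm h]
      · simp [ha, hb, Ne.symm ha, Ne.symm hb]
  simp only [h1, Finset.sum_add_distrib, Finset.sum_ite_eq', Finset.mem_filter, Finset.mem_univ,
    true_and]
  by_cases ha : a ∈ X <;> by_cases hb : b ∈ X <;> simp [ha, hb, two_nsmul]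

-- Supermodularity with its exact defect. The `between` term is what forces edges to vanish when
-- tight sets are uncrossed.
open Classical in
lemma sum_inside_add_sum_inside (x : Edge V → ℝ) (X Y : Set V) :
    ∑ e ∈ inside X, x e + ∑ e ∈ inside Y, x e + ∑ e ∈ between (X \ Y) (Y \ X), x e =
      ∑ e ∈ inside (X ∪ Y), x e + ∑ e ∈ inside (X ∩ Y), x e := by
  simp only [sum_finset_eq_ite x]
  simp only [← Finset.sum_add_distrib]
  refine Finset.sum_congr rfl fun e _ => ?_
  obtain ⟨a, b, h, rfl⟩ := e.exists_mkEdge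
  simp only [mkEdge_mem_between, mkEdge_mem_inside, Set.mem_union, Set.mem_inter_iff, Set.mem_sdiff]
  by_cases ha : a ∈ X <;> by_cases hb : b ∈ X <;> by_cases ha' : a ∈ Y <;>
    by_cases hb' : b ∈ Y <;> simp [ha, hb, ha', hb']

open Classical in
lemma sum_inside_compl (x : Edge V → ℝ) (U : Set V) :
    ∑ e ∈ inside U, x e + ∑ e ∈ inside Uᶜ, x e + ∑ e ∈ cut U, x e = ∑ e, x e := by
  simp only [sum_finset_eq_ite x]
  simp only [← Finset.sum_add_distrib]
  refine Finset.sum_congr rfl fun e _ => ?_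
  obtain ⟨a, b, h, rfl⟩ := e.exists_mkEdge
  simp only [mkEdge_mem_cut, mkEdge_mem_inside, Set.mem_compl_iff]
  by_cases ha : a ∈ U <;> by_cases hb : b ∈ U <;> simp [ha, hb]

lemma cut_eq_between (U : Set V) : cut U = between U Uᶜ := by
  ext e
  obtain ⟨a, b, h, rfl⟩ := e.exists_mkEdge
  simp

/-! ### Parities -/

/-- The parity of the number of edges of `F` in `δ(U)`. -/
def par (F : Finset (Edge V)) (U : Set V) : ZMod 2 := ((F ∩ cut U).card : ZMod 2)

/-- The parity vector of the degrees of `F`. -/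
def bd (F : Finset (Edge V)) (v : V) : ZMod 2 := par F {v}

lemma zmod_two_cases (a : ZMod 2) : a = 0 ∨ a = 1 := by
  revert a; decide

lemma zmod_two_add_self (a : ZMod 2) : a + a = 0 := CharTwo.add_self_eq_zero a

lemma odd_iff_cast {n : ℕ} : Odd n ↔ (n : ZMod 2) = 1 := ZMod.natCast_eq_one_iff_odd.symm

lemma even_iff_cast {n : ℕ} : Even n ↔ (n : ZMod 2) = 0 := ZMod.natCast_eq_zero_iff_even.symm

lemma mem_oddVertices {F : Finset (Edge V)} {v : V} : v ∈ oddVertices F ↔ bd F v = 1 := by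
  simp only [oddVertices, Set.mem_ofPred_eq, odd_iff_cast]; rfl

lemma oddVertices_eq_iff {F G : Finset (Edge V)} : oddVertices F = oddVertices G ↔ bd F = bd G := by
  constructor
  · intro h
    funext v
    have := Set.ext_iff.1 h v
    rw [mem_oddVertices, mem_oddVertices] at this
    rcases zmod_two_cases (bd F v) with h1 | h1 <;> rcases zmod_two_cases (bd G v) with h2 | h2 <;>
      simp_all
  · intro h
    ext v
    rw [mem_oddVertices, mem_oddVertices, h]

lemma par_symmDiff (A B : Finset (Edge V)) (U : Set V) :
    par (symmDiff A B) U = par A U + par B U := by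
  unfold par
  have h1 : (symmDiff A B ∩ cut U) = symmDiff (A ∩ cut U) (B ∩ cut U) := by
    ext e; simp only [Finset.mem_inter, Finset.mem_symmDiff]; tauto
  rw [h1]
  generalize A ∩ cut U = A'
  generalize B ∩ cut U = B'
  have h2 : (symmDiff A' B').card + 2 * (A' ∩ B').card = A'.card + B'.card := by
    have e1 := Finset.card_sdiff_add_card_inter A' B'
    have e2 := Finset.card_sdiff_add_card_inter B' A'
    rw [Finset.inter_comm B' A'] at e2
    have e3 : (symmDiff A' B').card = (A' \ B').card + (B' \ A').card := by
      rw [symmDiff_def, Finset.sup_eq_union, Finset.card_union_of_disjoint]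
      exact disjoint_sdiff_sdiff
    omega
  have h3 := congrArg (Nat.cast : ℕ → ZMod 2) h2
  push_cast at h3
  rw [← h3, show (2 : ZMod 2) = 0 from rfl]
  ring

lemma bd_symmDiff (A B : Finset (Edge V)) : bd (symmDiff A B) = bd A + bd B := by
  funext v; exact par_symmDiff A B {v}

open Classical in
lemma par_eq_sum (F : Finset (Edge V)) (U : Set V) : par F U = ∑ v with v ∈ U, bd F v := by
  have := sum_cut_singleton (fun e : Edge V => if e ∈ F then (1 : ZMod 2) else 0) U
  have h1 : ∀ W : Set V, ∑ e ∈ cut W, (if e ∈ F then (1 : ZMod 2) else 0) = par F W := by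
    intro W
    rw [Finset.sum_ite_mem, par, Finset.inter_comm]; simp
  simp only [h1] at this
  rw [show (∑ v with v ∈ U, bd F v) = ∑ v with v ∈ U, par F {v} from rfl, this, two_nsmul,
    zmod_two_add_self, zero_add]

/-- The parity vector with a single one. -/
def sing (v : V) : V → ZMod 2 := open Classical in Pi.single v 1

lemma sing_add_self (v : V) : sing v + sing v = 0 := by
  funext w; exact zmod_two_add_self _

open Classical in
lemma sum_sing (v : V) (U : Set V) : ∑ w with w ∈ U, sing v w = if v ∈ U then 1 else 0 := by
  simp [sing]

lemma bd_singleton {a b : V} (h : a ≠ b) : bd {mkEdge a b h} = sing a + sing b := by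
  classical
  funext v
  simp only [bd, par, sing, Pi.add_apply, Pi.single_apply]
  by_cases ha : v = a
  · subst ha
    rw [Finset.inter_eq_left.2 (by simp [h.symm])]; simp [h]
  · by_cases hb : v = b
    · subst hb
      rw [Finset.inter_eq_left.2 (by simp [h])]; simp [h.symm]
    · have : ({mkEdge a b h} : Finset (Edge V)) ∩ cut {v} = ∅ := by
        rw [Finset.singleton_inter_of_notMem]
        simp [Ne.symm ha, Ne.symm hb]
      simp [this, ha, hb]

lemma bd_empty : bd (∅ : Finset (Edge V)) = 0 := by
  funext v; simp [bd, par]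

/-! ### Connectivity in terms of joins and cuts -/

lemma graph_adj {F : Finset (Edge V)} {a b : V} :
    (graph F).Adj a b ↔ ∃ h : a ≠ b, mkEdge a b h ∈ F := by
  simp only [graph, SimpleGraph.fromEdgeSet_adj, Set.mem_ofPred_eq]
  constructor
  · rintro ⟨⟨f, hf, hfe⟩, hab⟩
    refine ⟨hab, ?_⟩
    have : f = mkEdge a b hab := Subtype.ext hfe
    rwa [← this]
  · rintro ⟨h, he⟩
    exact ⟨⟨_, he, rfl⟩, h⟩

/-- Taking symmetric differences along a walk cancels repeated edges, so no simple path is needed: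
throughout, a path matters only through its boundary modulo two. -/
lemma exists_join_of_reachable {S : Finset (Edge V)} {u v : V} (h : (graph S).Reachable u v) :
    ∃ P ⊆ S, bd P = sing u + sing v := by
  obtain ⟨w⟩ := h
  induction w with
  | nil => exact ⟨∅, by simp, by rw [bd_empty, sing_add_self]⟩
  | @cons a b c hab _ ih =>
    obtain ⟨P, hP, hbd⟩ := ih
    obtain ⟨hne, he⟩ := graph_adj.1 hab
    refine ⟨symmDiff P {mkEdge a b hne}, ?_, ?_⟩
    · intro e
      simp only [Finset.mem_symmDiff, Finset.mem_singleton]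
      rintro (⟨h1, -⟩ | ⟨rfl, -⟩)
      · exact hP h1
      · exact he
    · rw [bd_symmDiff, hbd, bd_singleton]
      calc sing b + sing c + (sing a + sing b) = sing a + sing c + (sing b + sing b) := by abel
        _ = _ := by rw [sing_add_self, add_zero]

/-- Every nontrivial cut of a connected graph contains an edge. -/
lemma exists_mem_cut_of_connected {S : Finset (Edge V)} (hS : (graph S).Connected) {U : Set V}
    {a b : V} (ha : a ∈ U) (hb : b ∉ U) : ∃ e ∈ S, e ∈ cut U := by
  obtain ⟨w⟩ := hS.preconnected a b
  obtain ⟨d, -, h1, h2⟩ := w.exists_boundary_dart U ha hb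
  obtain ⟨hne, he⟩ := graph_adj.1 d.adj
  exact ⟨_, he, by simp [h1, h2]⟩

lemma reachable_of_forall_cut {S : Finset (Edge V)} {a b : V}
    (h : ∀ U : Set V, a ∈ U → b ∉ U → ∃ e ∈ S, e ∈ cut U) : (graph S).Reachable a b := by
  by_contra hab
  obtain ⟨e, he, hc⟩ := h {w | (graph S).Reachable a w} (SimpleGraph.Reachable.refl _) hab
  obtain ⟨p, q, hpq, rfl⟩ := e.exists_mkEdge
  have hadj : (graph S).Adj p q := graph_adj.2 ⟨hpq, he⟩
  simp only [mkEdge_mem_cut, Set.mem_ofPred_eq] at hc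
  rcases hc with ⟨h1, h2⟩ | ⟨h1, h2⟩
  · exact h2 (h1.trans hadj.reachable)
  · exact h2 (h1.trans hadj.symm.reachable)

end STPathTSP

end

noncomputable section

namespace STPathTSP

variable {V : Type u} [Fintype V]

/-! ### The `T`-join polyhedron -/

lemma sum_symmDiff_add {M : Type*} [AddCommMonoid M] (c : Edge V → M) (A B : Finset (Edge V)) :
    ∑ e ∈ symmDiff A B, c e + ∑ e ∈ B ∩ A, c e = ∑ e ∈ A, c e + ∑ e ∈ B \ A, c e := by
  have h1 : ∑ e ∈ symmDiff A B, c e = ∑ e ∈ A \ B, c e + ∑ e ∈ B \ A, c e := by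
    rw [symmDiff_def, Finset.sup_eq_union, Finset.sum_union disjoint_sdiff_sdiff]
  have h2 : ∑ e ∈ A \ B, c e + ∑ e ∈ A ∩ B, c e = ∑ e ∈ A, c e := by
    rw [add_comm]; exact Finset.sum_inter_add_sum_sdiff _ _ _
  rw [h1, ← h2, Finset.inter_comm]
  abel

lemma sum_symmDiff_of_zero {c : Edge V → ℕ} (A : Finset (Edge V)) {Z : Finset (Edge V)}
    (hZ : ∀ e ∈ Z, c e = 0) : ∑ e ∈ symmDiff A Z, c e = ∑ e ∈ A, c e := by
  have := sum_symmDiff_add c A Z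
  rw [Finset.sum_eq_zero (s := Z ∩ A) (fun e he => hZ e (Finset.mem_inter.1 he).1),
    Finset.sum_eq_zero (s := Z \ A) (fun e he => hZ e (Finset.mem_sdiff.1 he).1)] at this
  simpa using this

/-- `c` is congruent modulo two to the coboundary of `p`. -/
def ParityPotential (c : Edge V → ℕ) (p : V → ZMod 2) : Prop :=
  ∀ (a b : V) (h : a ≠ b), (c (mkEdge a b h) : ZMod 2) = p a + p b

-- Modulo two the cost of an edge set depends only on its boundary. Hence a strict improvement
-- between two joins with the same boundary is an improvement by at least two.
open Classical in
lemma ParityPotential.cast_sum {c : Edge V → ℕ} {p : V → ZMod 2} (hp : ParityPotential c p)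
    (K : Finset (Edge V)) : ((∑ e ∈ K, c e : ℕ) : ZMod 2) = ∑ v, bd K v * p v := by
  induction K using Finset.induction_on with
  | empty => simp [bd_empty]
  | insert e K he ih =>
    rw [Finset.sum_insert he]
    have hK : insert e K = symmDiff K {e} := by
      ext f
      simp only [Finset.mem_insert, Finset.mem_symmDiff, Finset.mem_singleton]
      by_cases hf : f = e
      · subst hf; simp [he]
      · simp [hf]
    rw [hK, bd_symmDiff]
    obtain ⟨a, b, h, rfl⟩ := e.exists_mkEdge
    rw [bd_singleton]
    push_cast
    rw [hp a b h, ← Nat.cast_sum, ih]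
    simp only [Pi.add_apply, add_mul, Finset.sum_add_distrib, sing, Pi.single_apply, ite_mul,
      one_mul, zero_mul, Finset.sum_ite_eq', Finset.mem_univ, if_true]
    ring

/-- The edges of cost zero. -/
def zeroEdges (c : Edge V → ℕ) : Finset (Edge V) := Finset.univ.filter fun e => c e = 0

/-- The vertices that can be reached from `v` at cost zero. -/
def zeroClass (c : Edge V → ℕ) (v : V) : Set V := {w | (graph (zeroEdges c)).Reachable v w}

lemma one_le_of_mem_cut_zeroClass {c : Edge V → ℕ} {v : V} {e : Edge V}
    (he : e ∈ cut (zeroClass c v)) : 1 ≤ c e := by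
  by_contra h
  have h0 : c e = 0 := by omega
  obtain ⟨a, b, hab, rfl⟩ := e.exists_mkEdge
  have hadj : (graph (zeroEdges c)).Adj a b := graph_adj.2 ⟨hab, by simp [zeroEdges, h0]⟩
  rw [mkEdge_mem_cut] at he
  rcases he with ⟨h1, h2⟩ | ⟨h1, h2⟩
  · exact h2 (SimpleGraph.Reachable.trans h1 hadj.reachable)
  · exact h2 (SimpleGraph.Reachable.trans h1 hadj.symm.reachable)

lemma exists_zero_join {c : Edge V → ℕ} {v z : V} (hz : z ∈ zeroClass c v) :
    ∃ Z : Finset (Edge V), (∀ e ∈ Z, c e = 0) ∧ bd Z = sing v + sing z := by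
  obtain ⟨Z, hZ, hb⟩ := exists_join_of_reachable (show (graph (zeroEdges c)).Reachable v z from hz)
  exact ⟨Z, fun e he => by simpa [zeroEdges] using hZ he, hb⟩

lemma notMem_cut_zeroClass {c : Edge V → ℕ} {v : V} {e : Edge V} (he : c e = 0) :
    e ∉ cut (zeroClass c v) := fun h => by
  have := one_le_of_mem_cut_zeroClass h; omega

lemma pi_add_self (f : V → ZMod 2) : f + f = 0 := by
  funext w; exact zmod_two_add_self _

/-- `Q` has minimum cost among all edge sets whose parity vector differs from `t` in exactly
two vertices, `u` and `v` being these vertices for `Q`, and it is cheaper than all edge sets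
with parity vector `t`. -/
structure IsBestNeighbour (c : Edge V → ℕ) (t : V → ZMod 2) (u v : V)
    (Q : Finset (Edge V)) : Prop where
  bd_eq : bd Q = t + sing u + sing v
  le : ∀ a K, bd K = t + sing u + sing a → ∑ e ∈ Q, c e ≤ ∑ e ∈ K, c e
  lt : ∀ K, bd K = t → ∑ e ∈ Q, c e < ∑ e ∈ K, c e

/-- Deleting an edge of positive cost from a minimum join gives a neighbour that is strictly
cheaper, so the cheapest neighbour beats all joins. -/
lemma exists_isBestNeighbour {c : Edge V → ℕ} {J : Finset (Edge V)}
    (hJ : ∀ K, bd K = bd J → ∑ e ∈ J, c e ≤ ∑ e ∈ K, c e) (hpos : 0 < ∑ e ∈ J, c e) :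
    ∃ u v Q, IsBestNeighbour c (bd J) u v Q := by
  classical
  obtain ⟨e, heJ, he⟩ : ∃ e ∈ J, 0 < c e := by
    by_contra! h
    have : ∑ e ∈ J, c e = 0 := Finset.sum_eq_zero fun e he => by have := h e he; omega
    omega
  let 𝒬 : Finset (Finset (Edge V)) :=
    Finset.univ.filter fun K => ∃ u v, u ≠ v ∧ bd K = bd J + sing u + sing v
  obtain ⟨a, b, hab, rfl⟩ := e.exists_mkEdge
  have hmem : symmDiff J {mkEdge a b hab} ∈ 𝒬 := by
    simp only [𝒬, Finset.mem_filter, Finset.mem_univ, true_and]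
    exact ⟨a, b, hab, by rw [bd_symmDiff, bd_singleton, add_assoc]⟩
  obtain ⟨Q, hQ, hmin⟩ := 𝒬.exists_min_image (fun K => ∑ e ∈ K, c e) ⟨_, hmem⟩
  obtain ⟨u, v, huv, hb⟩ := (Finset.mem_filter.1 hQ).2
  have hlt : ∑ e ∈ Q, c e < ∑ e ∈ J, c e := by
    refine (hmin _ hmem).trans_lt ?_
    have := sum_symmDiff_add c J {mkEdge a b hab}
    rw [Finset.inter_eq_left.2 (by simpa using heJ), Finset.sdiff_eq_empty_iff_subset.2
      (by simpa using heJ)] at this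
    simp at this
    omega
  have hlt' : ∀ K, bd K = bd J → ∑ e ∈ Q, c e < ∑ e ∈ K, c e :=
    fun K hK => hlt.trans_le (hJ K hK)
  refine ⟨u, v, Q, hb, fun a K hK => ?_, hlt'⟩
  -- For a = u the boundary of K is that of J itself, which the strict inequality covers.
  by_cases hua : u = a
  · subst hua
    rw [add_assoc, sing_add_self, add_zero] at hK
    exact (hlt' K hK).le
  · exact hmin K (Finset.mem_filter.2 ⟨Finset.mem_univ _, u, a, hua, hK⟩)

section BestNeighbour

variable {c : Edge V → ℕ} {t : V → ZMod 2} {u v : V} {Q : Finset (Edge V)}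

/-- An edge of Q leaving the zero class could be deleted after moving the end v to its inner
endpoint at cost zero; the result is a neighbour with end a that is cheaper by at least one. -/
lemma IsBestNeighbour.disjoint_cut (h : IsBestNeighbour c t u v Q) {e : Edge V}
    (heQ : e ∈ Q) : e ∉ cut (zeroClass c v) := by
  intro he
  have hpos := one_le_of_mem_cut_zeroClass he
  obtain ⟨z, hz, a, ha, hea⟩ := mem_cut_iff.1 he
  have hza : z ≠ a := by rintro rfl; exact ha hz
  obtain rfl : e = mkEdge z a hza := Subtype.ext hea
  obtain ⟨Z, hZ0, hZ⟩ := exists_zero_join hz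
  have hK : bd (symmDiff (symmDiff Q {mkEdge z a hza}) Z) = t + sing u + sing a := by
    rw [bd_symmDiff, bd_symmDiff, bd_singleton, hZ, h.bd_eq]
    calc _ = t + sing u + sing a + (sing v + sing v) + (sing z + sing z) := by abel
      _ = _ := by simp only [sing_add_self, add_zero]
  have hle := h.le a _ hK
  rw [sum_symmDiff_of_zero _ hZ0] at hle
  have := sum_symmDiff_add c Q {mkEdge z a hza}
  rw [Finset.inter_eq_left.2 (by simpa using heQ), Finset.sdiff_eq_empty_iff_subset.2
      (by simpa using heQ)] at this
  simp at this
  omega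

lemma IsBestNeighbour.notMem_zeroClass (h : IsBestNeighbour c t u v Q) : u ∉ zeroClass c v := by
  intro hu
  obtain ⟨Z, hZ0, hZ⟩ := exists_zero_join hu
  have hK : bd (symmDiff Q Z) = t := by
    rw [bd_symmDiff, hZ, h.bd_eq]
    calc _ = t + (sing u + sing u) + (sing v + sing v) := by abel
      _ = _ := by simp only [sing_add_self, add_zero]
  have hle := h.lt _ hK
  rw [sum_symmDiff_of_zero _ hZ0] at hle
  exact lt_irrefl _ hle

lemma self_mem_zeroClass (c : Edge V → ℕ) (v : V) : v ∈ zeroClass c v :=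
  SimpleGraph.Reachable.refl _

/-- Q misses this cut, and of the two vertices where its boundary differs from t only v lies in the
class. So the cut of the zero class is a T-cut. -/
lemma IsBestNeighbour.par_eq_one (h : IsBestNeighbour c t u v Q) {J : Finset (Edge V)}
    (hJ : bd J = t) : par J (zeroClass c v) = 1 := by
  classical
  have h0 : par Q (zeroClass c v) = 0 := by
    have : Q ∩ cut (zeroClass c v) = ∅ := by
      ext e; simp only [Finset.mem_inter, Finset.notMem_empty, iff_false, not_and]
      exact fun he => h.disjoint_cut he
    simp [par, this]
  rw [par_eq_sum, h.bd_eq] at h0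
  simp only [Pi.add_apply, Finset.sum_add_distrib, sum_sing, if_neg h.notMem_zeroClass,
    if_pos (self_mem_zeroClass c v), add_zero] at h0
  rw [par_eq_sum, hJ]
  rcases zmod_two_cases (∑ w with w ∈ zeroClass c v, t w) with h1 | h1
  · rw [h1] at h0; simp at h0
  · exact h1

/-- The edges of `D` that do not touch `U`. -/
def outer (D : Finset (Edge V)) (U : Set V) : Finset (Edge V) := D ∩ inside Uᶜ

/-- Two edges of `J ∩ δ(U)` whose outer endpoints are connected in `J ∆ Q` outside of `U`. -/
lemma IsBestNeighbour.exists_connected_pair (h : IsBestNeighbour c t u v Q) {J : Finset (Edge V)}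
    (hJ : bd J = t) (hcard : 2 ≤ (J ∩ cut (zeroClass c v)).card) :
    ∃ z₁ ∈ zeroClass c v, ∃ a₁ ∉ zeroClass c v, ∃ z₂ ∈ zeroClass c v, ∃ a₂ ∉ zeroClass c v,
      ∃ (h₁ : z₁ ≠ a₁) (h₂ : z₂ ≠ a₂), mkEdge z₁ a₁ h₁ ≠ mkEdge z₂ a₂ h₂ ∧
        mkEdge z₁ a₁ h₁ ∈ J ∧ mkEdge z₂ a₂ h₂ ∈ J ∧
        (graph (outer (symmDiff J Q) (zeroClass c v))).Reachable a₁ a₂ := by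
  classical
  set U := zeroClass c v with hU
  set H := graph (outer (symmDiff J Q) U) with hH
  have key : ∀ z ∈ U, ∀ a ∉ U, ∀ hza : z ≠ a, mkEdge z a hza ∈ J → ¬ H.Reachable a u →
      ∃ z₁ ∈ U, ∃ a₁ ∉ U, ∃ z₂ ∈ U, ∃ a₂ ∉ U,
      ∃ (h₁ : z₁ ≠ a₁) (h₂ : z₂ ≠ a₂), mkEdge z₁ a₁ h₁ ≠ mkEdge z₂ a₂ h₂ ∧
        mkEdge z₁ a₁ h₁ ∈ J ∧ mkEdge z₂ a₂ h₂ ∈ J ∧ H.Reachable a₁ a₂ := by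
    intro z hz a ha hza he hau
    let A : Set V := {w | H.Reachable a w}
    have hAU : ∀ w ∈ A, w ∉ U := by
      rintro w ⟨p⟩
      have : ∀ (a b : V), H.Walk a b → a ∉ U → b ∉ U := by
        intro a b p
        induction p with
        | nil => exact id
        | cons hadj _ ih =>
          intro _
          apply ih
          obtain ⟨hne, hm⟩ := graph_adj.1 hadj
          simp only [outer, Finset.mem_inter, mkEdge_mem_inside] at hm
          exact hm.2.2
      exact this _ _ p ha
    have hvA : v ∉ A := fun hv => hAU v hv (self_mem_zeroClass c v)
    -- The boundary of J ∆ Q is {u, v}, and A contains neither. So a second edge leaves A; by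
    -- maximality of A its other end lies in the zero class, and it belongs to J because Q misses
    -- that cut.
    have hpar : par (symmDiff J Q) A = 0 := by
      rw [par_eq_sum, bd_symmDiff, hJ, h.bd_eq]
      have : t + (t + sing u + sing v) = sing u + sing v := by
        calc t + (t + sing u + sing v) = (t + t) + sing u + sing v := by abel
          _ = _ := by rw [pi_add_self, zero_add]
      rw [this]
      simp only [Pi.add_apply, Finset.sum_add_distrib, sum_sing, if_neg hvA, add_zero]
      exact if_neg hau
    have hcut : mkEdge z a hza ∈ cut U := by simp [hz, ha]
    have heD : mkEdge z a hza ∈ symmDiff J Q :=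
      Finset.mem_symmDiff.2 (Or.inl ⟨he, fun hQ => h.disjoint_cut hQ hcut⟩)
    have haA : a ∈ A := SimpleGraph.Reachable.refl _
    have hzA : z ∉ A := fun hz' => hAU z hz' hz
    have heA : mkEdge z a hza ∈ symmDiff J Q ∩ cut A :=
      Finset.mem_inter.2 ⟨heD, by simp [haA, hzA]⟩
    have h2 : 1 < (symmDiff J Q ∩ cut A).card := by
      have hev : Even (symmDiff J Q ∩ cut A).card := even_iff_cast.2 hpar
      have hp : 0 < (symmDiff J Q ∩ cut A).card := Finset.card_pos.2 ⟨_, heA⟩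
      obtain ⟨k, hk⟩ := hev
      omega
    obtain ⟨f, hf, hfne⟩ := Finset.exists_mem_ne h2 (mkEdge z a hza)
    obtain ⟨hfD, hfA⟩ := Finset.mem_inter.1 hf
    obtain ⟨b, hb, w, hw, hfe⟩ := mem_cut_iff.1 hfA
    have hwb : w ≠ b := by rintro rfl; exact hw hb
    obtain rfl : f = mkEdge w b hwb := Subtype.ext (by rw [hfe, Sym2.eq_swap]; rfl)
    have hbU := hAU b hb
    have hwU : w ∈ U := by
      by_contra hwU
      apply hw
      have hadj : H.Adj b w := by
        refine SimpleGraph.Adj.symm (graph_adj.2 ⟨hwb, ?_⟩)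
        simp only [outer, Finset.mem_inter, mkEdge_mem_inside]
        exact ⟨hfD, hwU, hbU⟩
      exact SimpleGraph.Reachable.trans hb hadj.reachable
    have hfU : mkEdge w b hwb ∈ cut U := by simp [hwU, hbU]
    have hfJ : mkEdge w b hwb ∈ J := by
      rcases Finset.mem_symmDiff.1 hfD with h1 | h1
      · exact h1.1
      · exact absurd hfU (h.disjoint_cut h1.1)
    exact ⟨z, hz, a, ha, w, hwU, b, hbU, hza, hwb, hfne.symm, he, hfJ, hb⟩
  obtain ⟨e₁, h₁, e₂, h₂, hne⟩ := Finset.one_lt_card.1 (show 1 < (J ∩ cut U).card by omega)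
  obtain ⟨h₁J, h₁c⟩ := Finset.mem_inter.1 h₁
  obtain ⟨h₂J, h₂c⟩ := Finset.mem_inter.1 h₂
  obtain ⟨z₁, hz₁, a₁, ha₁, he₁⟩ := mem_cut_iff.1 h₁c
  obtain ⟨z₂, hz₂, a₂, ha₂, he₂⟩ := mem_cut_iff.1 h₂c
  have n₁ : z₁ ≠ a₁ := by rintro rfl; exact ha₁ hz₁
  have n₂ : z₂ ≠ a₂ := by rintro rfl; exact ha₂ hz₂
  obtain rfl : e₁ = mkEdge z₁ a₁ n₁ := Subtype.ext he₁
  obtain rfl : e₂ = mkEdge z₂ a₂ n₂ := Subtype.ext he₂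
  -- Two outer endpoints that both reach u reach each other; otherwise the parity argument applies
  -- to the one that does not.
  by_cases r₁ : H.Reachable a₁ u
  · by_cases r₂ : H.Reachable a₂ u
    · exact ⟨z₁, hz₁, a₁, ha₁, z₂, hz₂, a₂, ha₂, n₁, n₂, hne, h₁J, h₂J, r₁.trans r₂.symm⟩
    · exact key z₂ hz₂ a₂ ha₂ n₂ h₂J r₂
  · exact key z₁ hz₁ a₁ ha₁ n₁ h₁J r₁

lemma ParityPotential.eq_of_mem_zeroClass {p : V → ZMod 2} (hp : ParityPotential c p) {z : V}
    (hz : z ∈ zeroClass c v) : p z = p v := by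
  classical
  obtain ⟨Z, hZ0, hZ⟩ := exists_zero_join hz
  have h1 := hp.cast_sum Z
  rw [Finset.sum_eq_zero hZ0, hZ] at h1
  simp only [Pi.add_apply, add_mul, Finset.sum_add_distrib, sing, Pi.single_apply, ite_mul,
      one_mul, zero_mul, Finset.sum_ite_eq', Finset.mem_univ, if_true, Nat.cast_zero] at h1
  have h2 : p v + (p v + p z) = p v := by rw [← h1, add_zero]
  rwa [← add_assoc, zmod_two_add_self, zero_add] at h2

/-- Let K be the two cut edges e₁, e₂ together with a connection P of their outer ends in J ∆ Q, and
K' = K without e₁. Switching Q along K' gives a neighbour up to cost zero, so c(K' \ Q) ≥ c(K' ∩ Q).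
Since K lies in J ∆ Q, switching J along K therefore saves at least c(e₁) ≥ 1, and the saving is
even. Zero-cost joins inside the class repair the boundary. -/
lemma IsBestNeighbour.exchange (h : IsBestNeighbour c t u v Q) {p : V → ZMod 2}
    (hp : ParityPotential c p) {J : Finset (Edge V)}
    (hJ : bd J = t) (hcard : 2 ≤ (J ∩ cut (zeroClass c v)).card) :
    ∃ J', bd J' = t ∧ (J' ∩ cut (zeroClass c v)).card + 2 = (J ∩ cut (zeroClass c v)).card ∧
      ∑ e ∈ J', c e + 2 ≤ ∑ e ∈ J, c e := by
  classical
  obtain ⟨z₁, hz₁, a₁, ha₁, z₂, hz₂, a₂, ha₂, n₁, n₂, hne, hJ₁, hJ₂, hr⟩ :=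
    h.exists_connected_pair hJ hcard
  set U := zeroClass c v with hU
  set e₁ := mkEdge z₁ a₁ n₁ with he₁
  set e₂ := mkEdge z₂ a₂ n₂ with he₂
  have hc₁ : e₁ ∈ cut U := by simp [he₁, hz₁, ha₁]
  have hc₂ : e₂ ∈ cut U := by simp [he₂, hz₂, ha₂]
  have hQ₁ : e₁ ∉ Q := fun hQ => h.disjoint_cut hQ hc₁
  have hQ₂ : e₂ ∉ Q := fun hQ => h.disjoint_cut hQ hc₂
  obtain ⟨P, hPsub, hP⟩ := exists_join_of_reachable hr
  have hPcut : ∀ e ∈ P, e ∉ cut U := by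
    intro e he hcut
    have := (Finset.mem_inter.1 (hPsub he)).2
    obtain ⟨a, b, hab, rfl⟩ := e.exists_mkEdge
    simp only [mkEdge_mem_inside, mkEdge_mem_cut, Set.mem_compl_iff] at this hcut
    tauto
  have hP₁ : e₁ ∉ P := fun h' => hPcut _ h' hc₁
  have hP₂ : e₂ ∉ P := fun h' => hPcut _ h' hc₂
  set K' := insert e₂ P with hK'
  set K := insert e₁ K' with hK
  have he₁K' : e₁ ∉ K' := by simp [hK', hne, hP₁]
  have ins_eq : ∀ (A : Finset (Edge V)) (e : Edge V), e ∉ A → insert e A = symmDiff A {e} := by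
    intro A e he
    ext f
    simp only [Finset.mem_insert, Finset.mem_symmDiff, Finset.mem_singleton]
    by_cases hf : f = e
    · subst hf; simp [he]
    · simp [hf]
  have bdK' : bd K' = sing a₁ + sing z₂ := by
    rw [hK', ins_eq P e₂ hP₂, bd_symmDiff, hP, he₂, bd_singleton]
    calc _ = sing a₁ + sing z₂ + (sing a₂ + sing a₂) := by abel
      _ = _ := by rw [sing_add_self, add_zero]
  have bdK : bd K = sing z₁ + sing z₂ := by
    rw [hK, ins_eq K' e₁ he₁K', bd_symmDiff, bdK', he₁, bd_singleton]
    calc _ = sing z₁ + sing z₂ + (sing a₁ + sing a₁) := by abel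
      _ = _ := by rw [sing_add_self, add_zero]
  have hPD : ∀ e ∈ P, e ∈ symmDiff J Q := fun e he => (Finset.mem_inter.1 (hPsub he)).1
  have hKD : ∀ e ∈ K, e ∈ symmDiff J Q := by
    intro e he
    rcases Finset.mem_insert.1 he with rfl | he
    · exact Finset.mem_symmDiff.2 (Or.inl ⟨hJ₁, hQ₁⟩)
    rcases Finset.mem_insert.1 he with rfl | he
    · exact Finset.mem_symmDiff.2 (Or.inl ⟨hJ₂, hQ₂⟩)
    · exact hPD e he
  obtain ⟨Z₁, hZ₁0, hZ₁⟩ := exists_zero_join hz₁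
  obtain ⟨Z₂, hZ₂0, hZ₂⟩ := exists_zero_join hz₂
  -- comparison with `Q`
  have hle : ∑ e ∈ Q, c e ≤ ∑ e ∈ symmDiff Q K', c e := by
    have := h.le a₁ (symmDiff (symmDiff Q K') Z₂) (by
      rw [bd_symmDiff, bd_symmDiff, bdK', hZ₂, h.bd_eq]
      calc _ = t + sing u + sing a₁ + (sing v + sing v) + (sing z₂ + sing z₂) := by abel
        _ = _ := by simp only [sing_add_self, add_zero])
    rwa [sum_symmDiff_of_zero _ hZ₂0] at this
  have s1 := sum_symmDiff_add c Q K'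
  have s2 := sum_symmDiff_add c J K
  have i1 : K \ J = K' ∩ Q := by
    ext e
    have := hKD e
    simp only [Finset.mem_sdiff, Finset.mem_inter, Finset.mem_symmDiff, hK, Finset.mem_insert]
      at this ⊢
    by_cases h1 : e = e₁
    · subst h1; simp [hJ₁, hQ₁]
    · tauto
  have i2 : K ∩ J = insert e₁ (K' \ Q) := by
    ext e
    have := hKD e
    simp only [Finset.mem_sdiff, Finset.mem_inter, Finset.mem_symmDiff, hK, Finset.mem_insert]
      at this ⊢
    by_cases h1 : e = e₁
    · subst h1; simp [hJ₁]
    · tauto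
  have i3 : ∑ e ∈ K ∩ J, c e = c e₁ + ∑ e ∈ K' \ Q, c e := by
    rw [i2, Finset.sum_insert (by simp [he₁K'])]
  have hpos₁ := one_le_of_mem_cut_zeroClass hc₁
  have hsplit : ∑ e ∈ K, c e = ∑ e ∈ K ∩ J, c e + ∑ e ∈ K \ J, c e :=
    (Finset.sum_inter_add_sum_sdiff _ _ _).symm
  -- The boundary of K consists of two vertices of one zero class, on which the potential is
  -- constant.
  have hevK : Even (∑ e ∈ K, c e) := by
    rw [even_iff_cast, hp.cast_sum, bdK]
    simp only [Pi.add_apply, add_mul, Finset.sum_add_distrib, sing, Pi.single_apply, ite_mul,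
      one_mul, zero_mul, Finset.sum_ite_eq', Finset.mem_univ, if_true]
    rw [hp.eq_of_mem_zeroClass hz₁, hp.eq_of_mem_zeroClass hz₂, zmod_two_add_self]
  refine ⟨symmDiff (symmDiff (symmDiff J K) Z₁) Z₂, ?_, ?_, ?_⟩
  · rw [bd_symmDiff, bd_symmDiff, bd_symmDiff, bdK, hZ₁, hZ₂, hJ]
    calc _ = t + (sing v + sing v) + (sing z₁ + sing z₁) + (sing z₂ + sing z₂) := by abel
      _ = _ := by simp only [sing_add_self, add_zero]
  · have : symmDiff (symmDiff (symmDiff J K) Z₁) Z₂ ∩ cut U = ((J ∩ cut U).erase e₁).erase e₂ := by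
      ext e
      by_cases hcut : e ∈ cut U
      · have hz1 : e ∉ Z₁ := fun h' => notMem_cut_zeroClass (hZ₁0 e h') hcut
        have hz2 : e ∉ Z₂ := fun h' => notMem_cut_zeroClass (hZ₂0 e h') hcut
        have hp' : e ∉ P := fun h' => hPcut e h' hcut
        simp only [Finset.mem_inter, Finset.mem_symmDiff, Finset.mem_erase, hcut, hz1, hz2, hK,
          hK', Finset.mem_insert, hp']
        by_cases h1 : e = e₁
        · subst h1; simp [hJ₁]
        · by_cases h2 : e = e₂
          · subst h2; simp [hJ₂]
          · simp [h1, h2]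
      · simp [hcut]
    rw [this, Finset.card_erase_of_mem, Finset.card_erase_of_mem]
    · omega
    · exact Finset.mem_inter.2 ⟨hJ₁, hc₁⟩
    · exact Finset.mem_erase.2 ⟨hne.symm, Finset.mem_inter.2 ⟨hJ₂, hc₂⟩⟩
  · rw [sum_symmDiff_of_zero _ hZ₂0, sum_symmDiff_of_zero _ hZ₁0]
    rw [i1] at s2 hsplit
    obtain ⟨k, hk⟩ := hevK
    omega

/-- Exchanges remove cut edges in pairs, each pair saving at least two, until at most one cut edge
is left. Thus lowering the cost by one on this cut lowers the minimum join cost by at most one. -/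
lemma IsBestNeighbour.le_add_one (h : IsBestNeighbour c t u v Q) {p : V → ZMod 2}
    (hp : ParityPotential c p) {J₀ : Finset (Edge V)}
    (hJ₀ : ∀ K, bd K = t → ∑ e ∈ J₀, c e ≤ ∑ e ∈ K, c e) :
    ∀ (m : ℕ) (J : Finset (Edge V)), bd J = t → (J ∩ cut (zeroClass c v)).card = m →
      ∑ e ∈ J₀, c e + m ≤ ∑ e ∈ J, c e + 1 := by
  intro m
  induction m using Nat.strong_induction_on with
  | _ m ih =>
    intro J hJ hm
    by_cases h2 : 2 ≤ m
    · obtain ⟨J', hJ', hcard, hcost⟩ := h.exchange hp hJ (by omega)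
      have := ih (m - 2) (by omega) J' hJ' (by omega)
      omega
    · have := hJ₀ J hJ
      omega

end BestNeighbour

/-- Induction on the total cost. One unit is subtracted on the T-cut of a zero class: the minimum
join cost drops by at most one, while the cost of y drops by y(δ(U)) ≥ 1. -/
lemma le_of_mem_joinPolyhedron_nat {y : Edge V → ℝ} (hy : ∀ e, 0 ≤ y e) :
    ∀ (n : ℕ) (c : Edge V → ℕ) (p : V → ZMod 2) (J : Finset (Edge V)), ∑ e, c e = n →
      ParityPotential c p → (∀ U, par J U = 1 → 1 ≤ ∑ e ∈ cut U, y e) →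
      (∀ K, bd K = bd J → ∑ e ∈ J, c e ≤ ∑ e ∈ K, c e) →
      ((∑ e ∈ J, c e : ℕ) : ℝ) ≤ ∑ e, (c e : ℝ) * y e := by
  classical
  intro n
  induction n using Nat.strong_induction_on with
  | _ n ih =>
    intro c p J hn hp hcut hmin
    rcases Nat.eq_zero_or_pos (∑ e ∈ J, c e) with h0 | hpos
    · rw [h0, Nat.cast_zero]
      exact Finset.sum_nonneg fun e _ => mul_nonneg (Nat.cast_nonneg _) (hy e)
    obtain ⟨u, v, Q, hQ⟩ := exists_isBestNeighbour hmin hpos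
    set U := zeroClass c v with hU
    have hparU : par J U = 1 := hQ.par_eq_one rfl
    let c' : Edge V → ℕ := fun e => if e ∈ cut U then c e - 1 else c e
    -- Flipping the potential on U changes its coboundary exactly on δ(U), matching the change of
    -- the costs modulo two.
    let p' : V → ZMod 2 := fun w => if w ∈ U then p w + 1 else p w
    have hcc : ∀ e, c e = c' e + if e ∈ cut U then 1 else 0 := by
      intro e
      by_cases he : e ∈ cut U
      · have := one_le_of_mem_cut_zeroClass he
        simp only [c', he, if_true]; omega
      · simp [c', he]
    have hp' : ParityPotential c' p' := by
      intro a b hab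
      have h1 := hp a b hab
      rw [hcc] at h1
      simp only [p']
      by_cases ha : a ∈ U <;> by_cases hb : b ∈ U <;>
        simp only [mkEdge_mem_cut, ha, hb, not_true, not_false_eq_true, and_true, and_false,
          or_false, or_true, if_true, if_false, Nat.cast_add,
          Nat.cast_one, add_zero] at h1 ⊢
      · rw [h1, show p a + 1 + (p b + 1) = p a + p b + (1 + 1) by ring, zmod_two_add_self,
          add_zero]
      · rw [show p a + 1 + p b = p a + p b + 1 by ring, ← h1, add_assoc, zmod_two_add_self,
          add_zero]
      · rw [show p a + (p b + 1) = p a + p b + 1 by ring, ← h1, add_assoc, zmod_two_add_self,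
          add_zero]
      · exact h1
    have sum_eq : ∀ A : Finset (Edge V), ∑ e ∈ A, c e = ∑ e ∈ A, c' e + (A ∩ cut U).card := by
      intro A
      rw [Finset.sum_congr rfl fun e _ => hcc e, Finset.sum_add_distrib, Finset.sum_ite_mem,
        Finset.sum_const, smul_eq_mul, mul_one]
    have hlt : ∑ e, c' e < n := by
      have h1 := sum_eq Finset.univ
      have h2 : 0 < (Finset.univ ∩ cut U).card := by
        rw [Finset.univ_inter, Finset.card_pos]
        by_contra hne
        rw [Finset.not_nonempty_iff_eq_empty] at hne
        simp [par, hne] at hparU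
      omega
    obtain ⟨J₁, hJ₁, hmin₁⟩ := (Finset.univ.filter fun K : Finset (Edge V) => bd K = bd J).exists_min_image
      (fun K => ∑ e ∈ K, c' e) ⟨J, by simp⟩
    have hbd₁ : bd J₁ = bd J := (Finset.mem_filter.1 hJ₁).2
    have hpar₁ : ∀ W, par J₁ W = par J W := fun W => by rw [par_eq_sum, par_eq_sum, hbd₁]
    have hIH := ih _ hlt c' p' J₁ rfl hp' (fun W hW => hcut W (by rw [← hpar₁, hW]))
      (fun K hK => hmin₁ K (by simp [hK, hbd₁]))
    have hclaim := hQ.le_add_one hp hmin _ J₁ hbd₁ rfl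
    rw [← hU] at hclaim
    have h3 := sum_eq J₁
    have h4 : ∑ e ∈ J, c e ≤ ∑ e ∈ J₁, c' e + 1 := by omega
    have h5 : ∑ e, (c e : ℝ) * y e = ∑ e, (c' e : ℝ) * y e + ∑ e ∈ cut U, y e := by
      rw [sum_finset_eq_ite y, ← Finset.sum_add_distrib]
      refine Finset.sum_congr rfl fun e _ => ?_
      rw [hcc e]
      by_cases he : e ∈ cut U <;> simp [he]; ring
    have h6 : ((∑ e ∈ J, c e : ℕ) : ℝ) ≤ (∑ e ∈ J₁, c' e : ℕ) + 1 := by exact_mod_cast h4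
    have h7 := hcut U hparU
    linarith

/-- A vector in the `T`-join polyhedron costs at least as much as some `T`-join. -/
theorem exists_join_cost_le {y c : Edge V → ℝ} (hy : ∀ e, 0 ≤ y e) (hc : ∀ e, 0 ≤ c e)
    (J₀ : Finset (Edge V)) (hcut : ∀ U, par J₀ U = 1 → 1 ≤ ∑ e ∈ cut U, y e) :
    ∃ J, bd J = bd J₀ ∧ ∑ e ∈ J, c e ≤ ∑ e, c e * y e := by
  classical
  obtain ⟨J, hJ, hmin⟩ := (Finset.univ.filter fun K : Finset (Edge V) => bd K = bd J₀).exists_min_image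
      (fun K => ∑ e ∈ K, c e) ⟨J₀, by simp⟩
  have hbd : bd J = bd J₀ := (Finset.mem_filter.1 hJ).2
  refine ⟨J, hbd, ?_⟩
  have main : ∀ n : ℕ, 0 < n → ∑ e ∈ J, c e ≤ ∑ e, c e * y e + (∑ e, y e) / n := by
    intro n hn
    have hn' : (0 : ℝ) < n := by exact_mod_cast hn
    -- Scaling by n and rounding up makes the costs integral; the factor 2 makes them even, so the
    -- zero potential is admissible. The rounding error vanishes as n tends to infinity.
    let cn : Edge V → ℕ := fun e => 2 * ⌈n * c e⌉₊
    have hpot : ParityPotential cn 0 := by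
      intro a b h
      simp only [cn, Nat.cast_mul, Pi.zero_apply, add_zero]
      exact mul_eq_zero_of_left rfl _
    obtain ⟨K, hK, hKmin⟩ := (Finset.univ.filter fun K : Finset (Edge V) => bd K = bd J₀).exists_min_image
      (fun K => ∑ e ∈ K, cn e) ⟨J₀, by simp⟩
    have hKbd : bd K = bd J₀ := (Finset.mem_filter.1 hK).2
    have hpar : ∀ W, par K W = par J₀ W := fun W => by rw [par_eq_sum, par_eq_sum, hKbd]
    have h1 := le_of_mem_joinPolyhedron_nat hy _ cn 0 K rfl hpot
      (fun W hW => hcut W (by rw [← hpar, hW])) (fun L hL => hKmin L (by simp [hL, hKbd]))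
    have h2 : ∀ e, 2 * (n * c e) ≤ cn e := fun e => by
      simp only [cn]; push_cast
      have := Nat.le_ceil (n * c e)
      linarith
    have h3 : ∀ e, (cn e : ℝ) ≤ 2 * (n * c e + 1) := fun e => by
      simp only [cn]; push_cast
      have := (Nat.ceil_lt_add_one (mul_nonneg hn'.le (hc e))).le
      linarith
    have h4 : 2 * n * ∑ e ∈ K, c e ≤ ((∑ e ∈ K, cn e : ℕ) : ℝ) := by
      push_cast
      rw [Finset.mul_sum]
      exact Finset.sum_le_sum fun e _ => by have := h2 e; linarith
    have h5 : ∑ e, (cn e : ℝ) * y e ≤ 2 * n * ∑ e, c e * y e + 2 * ∑ e, y e := by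
      rw [Finset.mul_sum, Finset.mul_sum, ← Finset.sum_add_distrib]
      refine Finset.sum_le_sum fun e _ => ?_
      have := mul_le_mul_of_nonneg_right (h3 e) (hy e)
      linarith
    have h6 : ∑ e ∈ J, c e ≤ ∑ e ∈ K, c e := hmin K hK
    have h7 : n * ∑ e ∈ J, c e ≤ n * ∑ e, c e * y e + ∑ e, y e := by
      have := mul_le_mul_of_nonneg_left h6 hn'.le
      linarith
    rw [← sub_le_iff_le_add', le_div_iff₀ hn']
    linarith
  have hlim : Filter.Tendsto (fun n : ℕ => ∑ e, c e * y e + (∑ e, y e) / (n : ℝ)) Filter.atTop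
      (nhds (∑ e, c e * y e + 0)) :=
    tendsto_const_nhds.add (tendsto_const_div_atTop_nhds_zero_nat _)
  rw [add_zero] at hlim
  exact ge_of_tendsto hlim (Filter.eventually_atTop.2 ⟨1, fun n hn => main n hn⟩)

end STPathTSP

end

noncomputable section

namespace STPathTSP

variable {V : Type u} [Fintype V]

/-! ### Trees that are connected on a crossing family -/

lemma mem_between_iff {e : Edge V} {A B : Set V} :
    e ∈ between A B ↔ ∃ a ∈ A, ∃ b ∈ B, e.1 = s(a, b) := by
  simp [between]

lemma between_comm (A B : Set V) : between A B = between B A := by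
  ext e
  obtain ⟨a, b, h, rfl⟩ := e.exists_mkEdge
  simp only [mkEdge_mem_between]; tauto

/-- `(X, T[X])` is connected. -/
def ConnOn (T : Finset (Edge V)) (X : Set V) : Prop :=
  ∀ A ⊆ X, A.Nonempty → (X \ A).Nonempty → ∃ e ∈ T, e ∈ between A (X \ A)

/-- `f` is a bridge of `(X, T[X])`, and `B` is one side of it. -/
structure IsBridgeSide (T : Finset (Edge V)) (X B : Set V) (f : Edge V) : Prop where
  subset : B ⊆ X
  mem : f ∈ between B (X \ B)
  unique : ∀ e ∈ T, e ∈ between B (X \ B) → e = f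

lemma IsBridgeSide.symm {T : Finset (Edge V)} {X B : Set V} {f : Edge V}
    (h : IsBridgeSide T X B f) : IsBridgeSide T X (X \ B) f where
  subset := Set.sdiff_subset
  mem := by rw [Set.sdiff_sdiff_cancel_left h.subset, between_comm]; exact h.mem
  unique := by rw [Set.sdiff_sdiff_cancel_left h.subset, between_comm]; exact h.unique

open Classical in
lemma even_countP_cross {G : SimpleGraph V} (A : Set V) {u v : V} (p : G.Walk u v) :
    Even (p.edges.countP fun e => ∃ a ∈ A, ∃ b ∉ A, e = s(a, b)) ↔ (u ∈ A ↔ v ∈ A) := by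
  induction p with
  | nil => simp
  | @cons a b c hab p ih =>
    rw [SimpleGraph.Walk.edges_cons, List.countP_cons]
    have : (∃ x ∈ A, ∃ y ∉ A, s(a, b) = s(x, y)) ↔ ¬ (a ∈ A ↔ b ∈ A) := by
      simp only [Sym2.eq_iff]
      constructor
      · rintro ⟨x, hx, y, hy, ⟨rfl, rfl⟩ | ⟨rfl, rfl⟩⟩ <;> tauto
      · intro h
        by_cases ha : a ∈ A
        · exact ⟨a, ha, b, by tauto, Or.inl ⟨rfl, rfl⟩⟩
        · exact ⟨b, by tauto, a, ha, Or.inr ⟨rfl, rfl⟩⟩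
    by_cases h : a ∈ A ↔ b ∈ A
    · have h' : ¬ (∃ x ∈ A, ∃ y ∉ A, s(a, b) = s(x, y)) := by rw [this]; tauto
      simp only [h', decide_false, Bool.false_eq_true, if_false, add_zero, ih]
      tauto
    · have h' : (∃ x ∈ A, ∃ y ∉ A, s(a, b) = s(x, y)) := by rw [this]; exact h
      simp only [h', decide_true, if_true, Nat.even_add_one, ih]
      tauto

lemma exists_edge_of_mem_edges {T : Finset (Edge V)} {u v : V} (p : (graph T).Walk u v)
    {e : Sym2 V} (he : e ∈ p.edges) : ∃ f ∈ T, f.1 = e := by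
  have h := p.edges_subset_edgeSet he
  revert h
  induction e using Sym2.ind with
  | _ a b =>
    intro h
    obtain ⟨hne, hm⟩ := graph_adj.1 (SimpleGraph.mem_edgeSet _ |>.1 h)
    exact ⟨_, hm, rfl⟩

/-- A family of sets that is closed under unions and intersections of intersecting members, such
that no edge of `G` joins `X \ Y` and `Y \ X` for such members. -/
structure IsCrossingFamily (G : Finset (Edge V)) (𝓕 : Set (Set V)) : Prop where
  univ_mem : Set.univ ∈ 𝓕
  inter_mem : ∀ X ∈ 𝓕, ∀ Y ∈ 𝓕, (X ∩ Y).Nonempty → X ∩ Y ∈ 𝓕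
  union_mem : ∀ X ∈ 𝓕, ∀ Y ∈ 𝓕, (X ∩ Y).Nonempty → X ∪ Y ∈ 𝓕
  notMem_between : ∀ X ∈ 𝓕, ∀ Y ∈ 𝓕, (X ∩ Y).Nonempty → ∀ e ∈ G, e ∉ between (X \ Y) (Y \ X)

lemma connected_of_connOn_univ [Nonempty V] {T : Finset (Edge V)} (h : ConnOn T Set.univ) :
    (graph T).Connected := by
  refine SimpleGraph.Connected.mk fun a b => reachable_of_forall_cut fun U ha hb => ?_
  obtain ⟨e, he, hc⟩ := h U (Set.subset_univ _) ⟨a, ha⟩ ⟨b, Set.mem_univ _, hb⟩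
  refine ⟨e, he, ?_⟩
  rwa [cut_eq_between, Set.compl_eq_univ_sdiff]

/-- T[X ∩ Y] is connected, but the only T-edge between the two sides in Y has its end a' outside X;
so X ∩ Y misses B. A further edge from B into X ∪ Y would join Y \ X to X \ Y, which is excluded. So
the bridge of T[Y] remains a bridge of T[X ∪ Y]. -/
lemma IsBridgeSide.union {G T : Finset (Edge V)} {𝓕 : Set (Set V)} (hF : IsCrossingFamily G 𝓕)
    (hTG : T ⊆ G) (hconn : ∀ X ∈ 𝓕, ConnOn T X) {X Y B : Set V} (hX : X ∈ 𝓕) (hY : Y ∈ 𝓕)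
    {a a' : V} (hne : a ≠ a') (haX : a ∈ X) (ha'X : a' ∉ X) (haY : a ∈ Y) (ha'B : a' ∈ B)
    (haB : a ∉ B)
    (hB : IsBridgeSide T Y B (mkEdge a a' hne)) :
    IsBridgeSide T (X ∪ Y) B (mkEdge a a' hne) := by
  have hXY : (X ∩ Y).Nonempty := ⟨a, haX, haY⟩
  have hdisj : ∀ w ∈ X, w ∈ Y → w ∉ B := by
    intro w hwX hwY hwB
    obtain ⟨g, hg, hgb⟩ := hconn _ (hF.inter_mem X hX Y hY hXY) (X ∩ Y ∩ B)
      Set.inter_subset_left ⟨w, ⟨hwX, hwY⟩, hwB⟩ ⟨a, ⟨haX, haY⟩, fun h => haB h.2⟩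
    have : g = mkEdge a a' hne := by
      refine hB.unique g hg ?_
      obtain ⟨p, q, hpq, rfl⟩ := g.exists_mkEdge
      simp only [mkEdge_mem_between, Set.mem_inter_iff, Set.mem_sdiff] at hgb ⊢
      tauto
    subst this
    simp only [mkEdge_mem_between, Set.mem_inter_iff, Set.mem_sdiff] at hgb
    tauto
  refine ⟨hB.subset.trans Set.subset_union_right, ?_, ?_⟩
  · simp only [mkEdge_mem_between, Set.mem_sdiff, Set.mem_union]
    exact Or.inr ⟨ha'B, Or.inl haX, haB⟩
  · intro g hg hgb
    have hno := hF.notMem_between X hX Y hY hXY g (hTG hg)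
    have huniq := hB.unique g hg
    obtain ⟨p, q, hpq, rfl⟩ := g.exists_mkEdge
    simp only [mkEdge_mem_between, Set.mem_sdiff, Set.mem_union] at hgb hno huniq
    have hs := hB.subset
    rcases hgb with ⟨h1, h2 | h2, h3⟩ | ⟨h1, h2 | h2, h3⟩
    · by_cases hq : q ∈ Y
      · exact huniq (Or.inl ⟨h1, hq, h3⟩)
      · exact absurd (Or.inr ⟨⟨h2, hq⟩, hs h1, fun hp => hdisj p hp (hs h1) h1⟩) hno
    · exact huniq (Or.inl ⟨h1, h2, h3⟩)
    · by_cases hq : p ∈ Y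
      · exact huniq (Or.inr ⟨h1, hq, h3⟩)
      · exact absurd (Or.inl ⟨⟨h2, hq⟩, hs h1, fun hp => hdisj q hp (hs h1) h1⟩) hno
    · exact huniq (Or.inr ⟨h1, h2, h3⟩)

/-- Take T of minimum size that is connected on every member; by minimality each edge is a bridge of
T[Y] for some member Y. On a cycle, choose an edge that is a bridge of T[X] with X as large as
possible. If the cycle stays in X, it crosses the bridge's cut exactly once, against parity. If it
leaves X, a leaving edge is a bridge of T[Y] for some Y, hence of T[X ∪ Y], and X ∪ Y is larger than
X. -/
theorem IsCrossingFamily.exists_tree [Nonempty V] {G : Finset (Edge V)} {𝓕 : Set (Set V)}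
    (hF : IsCrossingFamily G 𝓕) (hconn : ∀ X ∈ 𝓕, ConnOn G X) :
    ∃ T ⊆ G, IsSpanningTree T ∧ ∀ X ∈ 𝓕, ConnOn T X := by
  classical
  obtain ⟨T, hT, hmin⟩ := (Finset.univ.filter fun T : Finset (Edge V) =>
    T ⊆ G ∧ ∀ X ∈ 𝓕, ConnOn T X).exists_min_image Finset.card ⟨G, by simpa using hconn⟩
  obtain ⟨hTG, hTc⟩ := (Finset.mem_filter.1 hT).2
  have hbridge : ∀ f ∈ T, ∃ Y ∈ 𝓕, ∃ B, IsBridgeSide T Y B f := by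
    intro f hf
    by_contra! hno
    have hmem : T.erase f ∈ Finset.univ.filter fun T : Finset (Edge V) =>
        T ⊆ G ∧ ∀ X ∈ 𝓕, ConnOn T X := by
      refine Finset.mem_filter.2 ⟨Finset.mem_univ _, (Finset.erase_subset _ _).trans hTG, ?_⟩
      intro X hX A hAX hA hXA
      by_contra! hnone
      have huniq : ∀ e ∈ T, e ∈ between A (X \ A) → e = f := by
        intro e he hb
        by_contra hef
        exact hnone e (Finset.mem_erase.2 ⟨hef, he⟩) hb
      obtain ⟨e, he, hb⟩ := hTc X hX A hAX hA hXA
      have := huniq e he hb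
      subst this
      exact hno X hX A ⟨hAX, hb, huniq⟩
    have h1 := hmin _ hmem
    have h2 := Finset.card_erase_lt_of_mem hf
    omega
  refine ⟨T, hTG, ⟨connected_of_connOn_univ (hTc _ hF.univ_mem), ?_⟩, hTc⟩
  intro v c hc
  let 𝒳 : Finset (Set V) := Finset.univ.filter fun X =>
    X ∈ 𝓕 ∧ ∃ f ∈ T, f.1 ∈ c.edges ∧ ∃ B, IsBridgeSide T X B f
  have h𝒳 : 𝒳.Nonempty := by
    obtain ⟨e, he⟩ := List.exists_mem_of_ne_nil c.edges (by
      intro h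
      have := hc.three_le_length
      rw [← SimpleGraph.Walk.length_edges, h] at this
      simp at this)
    obtain ⟨f, hf, rfl⟩ := exists_edge_of_mem_edges c he
    obtain ⟨Y, hY, B, hB⟩ := hbridge f hf
    exact ⟨Y, Finset.mem_filter.2 ⟨Finset.mem_univ _, hY, f, hf, he, B, hB⟩⟩
  obtain ⟨X, hX, hmax⟩ := 𝒳.exists_max_image Set.ncard h𝒳
  obtain ⟨hXF, e, heT, hec, A, hA⟩ := (Finset.mem_filter.1 hX).2
  by_cases hsub : ∀ w ∈ c.support, w ∈ X
  · have hev := (even_countP_cross A c).2 Iff.rfl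
    have hcount : (c.edges.countP fun e => ∃ a ∈ A, ∃ b ∉ A, e = s(a, b)) = 1 := by
      have h1 : (c.edges.countP fun e => ∃ a ∈ A, ∃ b ∉ A, e = s(a, b)) =
          c.edges.countP fun f => f = e.1 := by
        apply List.countP_congr
        intro f hf
        simp only [decide_eq_true_eq]
        constructor
        · rintro ⟨a, ha, b, hb, rfl⟩
          obtain ⟨g, hg, hge⟩ := exists_edge_of_mem_edges c hf
          rw [← hge, hA.unique g hg]
          refine mem_between_iff.2 ⟨a, ha, b, ⟨hsub b ?_, hb⟩, hge⟩
          exact SimpleGraph.Walk.snd_mem_support_of_mem_edges _ hf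
        · rintro rfl
          obtain ⟨a, ha, b, hb, hab⟩ := mem_between_iff.1 hA.mem
          exact ⟨a, ha, b, hb.2, hab⟩
      rw [h1]
      have h2 := List.count_eq_one_of_mem hc.isTrail.edges_nodup hec
      rw [← h2, List.count]
      congr 1
    rw [hcount] at hev
    exact absurd hev (by decide)
  · push Not at hsub
    obtain ⟨w, hw, hwX⟩ := hsub
    obtain ⟨b, hb, b', hb', hbb⟩ := mem_between_iff.1 hA.mem
    have hbs : b ∈ c.support := by
      rw [hbb] at hec
      exact SimpleGraph.Walk.fst_mem_support_of_mem_edges _ hec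
    have hw' : w ∈ (c.rotate b hbs).support := by
      rw [SimpleGraph.Walk.mem_support_rotate_iff]; exact hw
    -- The cycle is rotated to start at an end of the bridge in X; on its way to w it has a first
    -- step out of X.
    obtain ⟨d, hd, hd1, hd2⟩ := ((c.rotate b hbs).takeUntil w hw').exists_boundary_dart X
      (hA.subset hb) hwX
    have hd' : d ∈ (c.rotate b hbs).darts := SimpleGraph.Walk.darts_takeUntil_subset_darts _ hw' hd
    have hdc : d ∈ c.darts := (SimpleGraph.Walk.rotate_darts c b hbs).mem_iff.1 hd'
    obtain ⟨hne, hdT⟩ := graph_adj.1 d.adj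
    obtain ⟨Y, hY, B, hB⟩ := hbridge _ hdT
    have hdedge : (mkEdge d.fst d.snd hne).1 ∈ c.edges :=
      List.mem_map.2 ⟨d, hdc, rfl⟩
    have hex : ∃ B, IsBridgeSide T (X ∪ Y) B (mkEdge d.fst d.snd hne) ∧ (X ∩ Y).Nonempty := by
      have hm := hB.mem
      simp only [mkEdge_mem_between, Set.mem_sdiff] at hm
      rcases hm with ⟨h1, h2, h3⟩ | ⟨h1, h2, h3⟩
      · exact ⟨Y \ B, IsBridgeSide.union hF hTG hTc hXF hY hne hd1 hd2 (hB.subset h1) ⟨h2, h3⟩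
          (fun h => h.2 h1) hB.symm, d.fst, hd1, hB.subset h1⟩
      · exact ⟨B, IsBridgeSide.union hF hTG hTc hXF hY hne hd1 hd2 h2 h1 h3 hB, d.fst, hd1, h2⟩
    obtain ⟨B', hB', hXY⟩ := hex
    have hd2Y : d.snd ∈ Y := by
      have hm := hB.mem
      simp only [mkEdge_mem_between, Set.mem_sdiff] at hm
      rcases hm with ⟨h1, h2, h3⟩ | ⟨h1, h2, h3⟩
      · exact h2
      · exact hB.subset h1
    have hle := hmax (X ∪ Y) (Finset.mem_filter.2 ⟨Finset.mem_univ _,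
      hF.union_mem X hXF Y hY hXY, _, hdT, hdedge, B', hB'⟩)
    have hlt : X.ncard < (X ∪ Y).ncard := by
      apply Set.ncard_lt_ncard _ (Set.toFinite _)
      exact ⟨Set.subset_union_left, fun h => hd2 (h (Or.inr hd2Y))⟩
    omega

/-- Adding the vertices of Y \ X one at a time, each along a T-edge, gains at least one inner edge
per vertex. Started at a single vertex it bounds inner edges from below; with Y the whole vertex set
of a tree it bounds them from above on X. -/
lemma card_inter_inside_add_le {T : Finset (Edge V)} {Y : Set V} (hY : ConnOn T Y) :
    ∀ (n : ℕ) (X : Set V), X ⊆ Y → X.Nonempty → (Y \ X).ncard = n →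
      (T ∩ inside X).card + n ≤ (T ∩ inside Y).card := by
  intro n
  induction n with
  | zero =>
    intro X hXY _ h0
    rw [Set.ncard_eq_zero (Set.toFinite _), Set.sdiff_eq_empty] at h0
    rw [hXY.antisymm h0, add_zero]
  | succ n ih =>
    intro X hXY hX hn
    have hne : (Y \ X).Nonempty := by
      rw [← Set.ncard_pos (Set.toFinite _)]; omega
    obtain ⟨e, he, heb⟩ := hY X hXY hX hne
    obtain ⟨a, ha, b, hb, heab⟩ := mem_between_iff.1 heb
    have hab : a ≠ b := by rintro rfl; exact hb.2 ha
    obtain rfl : e = mkEdge a b hab := Subtype.ext heab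
    have h1 := ih (insert b X) (Set.insert_subset hb.1 hXY) (Set.insert_nonempty _ _) (by
      have h2 : insert b (Y \ insert b X) = Y \ X := by
        ext w
        simp only [Set.mem_insert_iff, Set.mem_sdiff]
        by_cases hw : w = b
        · subst hw; simp [hb.1, hb.2]
        · simp [hw]
      have h3 := Set.ncard_insert_of_notMem (a := b) (s := Y \ insert b X) (by simp)
        (Set.toFinite _)
      rw [h2] at h3
      omega)
    have h2 : (T ∩ inside X).card < (T ∩ inside (insert b X)).card := by
      apply Finset.card_lt_card
      refine ⟨fun f hf => ?_, fun hss => ?_⟩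
      · obtain ⟨p, q, hpq, rfl⟩ := f.exists_mkEdge
        simp only [Finset.mem_inter, mkEdge_mem_inside, Set.mem_insert_iff] at hf ⊢
        tauto
      · have := hss (Finset.mem_inter.2 ⟨he, by simp [ha]⟩)
        simp only [Finset.mem_inter, mkEdge_mem_inside] at this
        exact hb.2 this.2.2
    omega

lemma inside_singleton (v : V) : inside ({v} : Set V) = ∅ := by
  ext e
  obtain ⟨a, b, h, rfl⟩ := e.exists_mkEdge
  simp only [mkEdge_mem_inside, Set.mem_singleton_iff, Finset.notMem_empty, iff_false]
  rintro ⟨rfl, rfl⟩; exact h rfl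

lemma ncard_sdiff_add {X Y : Set V} (h : X ⊆ Y) : (Y \ X).ncard + X.ncard = Y.ncard :=
  Set.ncard_sdiff_add_ncard_of_subset h (Set.toFinite _)

lemma ConnOn.ncard_le {T : Finset (Edge V)} {X : Set V} (h : ConnOn T X) (hX : X.Nonempty) :
    X.ncard ≤ (T ∩ inside X).card + 1 := by
  obtain ⟨v, hv⟩ := hX
  have h1 := card_inter_inside_add_le h _ {v} (by simpa using hv) (by simp) rfl
  have h2 := ncard_sdiff_add (show {v} ⊆ X by simpa using hv)
  simp [inside_singleton] at h1 h2
  omega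

lemma IsSpanningTree.connOn_univ {T : Finset (Edge V)} (h : IsSpanningTree T) :
    ConnOn T Set.univ := by
  rintro A - ⟨a, ha⟩ ⟨b, -, hb⟩
  obtain ⟨e, he, hc⟩ := exists_mem_cut_of_connected h.1 ha hb
  exact ⟨e, he, by rwa [← Set.compl_eq_univ_sdiff, ← cut_eq_between]⟩

lemma IsSpanningTree.card_add_one {T : Finset (Edge V)} (h : IsSpanningTree T) :
    T.card + 1 = Fintype.card V := by
  classical
  have h1 := SimpleGraph.IsTree.card_edgeFinset h
  rw [← h1]
  congr 1
  have : (graph T).edgeFinset = T.map (Function.Embedding.subtype _) := by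
    ext e
    induction e using Sym2.ind with
    | _ a b =>
      simp only [SimpleGraph.mem_edgeFinset, SimpleGraph.mem_edgeSet, Finset.mem_map,
        Function.Embedding.subtype_apply]
      rw [graph_adj]
      constructor
      · rintro ⟨h, hm⟩; exact ⟨_, hm, rfl⟩
      · rintro ⟨f, hf, hfe⟩
        have hab : a ≠ b := by
          rintro rfl
          apply f.2; rw [hfe]; simp
        refine ⟨hab, ?_⟩
        have : f = mkEdge a b hab := Subtype.ext hfe
        rwa [← this]
  rw [this, Finset.card_map]

lemma IsSpanningTree.card_inter_inside_le {T : Finset (Edge V)} (h : IsSpanningTree T) {X : Set V}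
    (hX : X.Nonempty) : (T ∩ inside X).card + 1 ≤ X.ncard := by
  have h1 := card_inter_inside_add_le h.connOn_univ _ X (Set.subset_univ _) hX rfl
  have h2 := ncard_sdiff_add (Set.subset_univ X)
  have h3 := h.card_add_one
  rw [Set.ncard_univ, Nat.card_eq_fintype_card] at h2
  rw [inside_univ, Finset.inter_univ] at h1
  omega

end STPathTSP

end

noncomputable section

namespace STPathTSP

variable {V : Type u} [Fintype V]

/-! ### Points of the spanning tree polytope with a chain of sparse cuts -/

/-- The total weight of the edges inside `X`. -/
def xin (x : Edge V → ℝ) (X : Set V) : ℝ := ∑ e ∈ inside X, x e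

/-- The spanning tree polytope. -/
structure InTreePolytope (x : Edge V → ℝ) : Prop where
  nonneg : ∀ e, 0 ≤ x e
  total : xin x Set.univ = (Set.univ : Set V).ncard - 1
  le : ∀ X : Set V, X.Nonempty → xin x X ≤ X.ncard - 1

/-- `X` induces a tight constraint of the spanning tree polytope. -/
def Tight (x : Edge V → ℝ) (X : Set V) : Prop := X.Nonempty ∧ xin x X = X.ncard - 1

/-- A chain of sets for which both sides have nearly the maximum weight. -/
structure SparseChain (x : Edge V → ℝ) (𝒰 : Set (Set V)) : Prop where
  chain : ∀ U ∈ 𝒰, ∀ W ∈ 𝒰, U ⊆ W ∨ W ⊆ U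
  nonempty : ∀ U ∈ 𝒰, U.Nonempty
  compl_nonempty : ∀ U ∈ 𝒰, Uᶜ.Nonempty
  lt_xin : ∀ U ∈ 𝒰, (U.ncard : ℝ) - 3 / 2 < xin x U
  lt_xin_compl : ∀ U ∈ 𝒰, (Uᶜ.ncard : ℝ) - 3 / 2 < xin x Uᶜ

section

variable {x : Edge V → ℝ}

lemma ncard_union_add_inter (X Y : Set V) :
    ((X ∪ Y).ncard : ℝ) + (X ∩ Y).ncard = X.ncard + Y.ncard := by
  exact_mod_cast Set.ncard_union_add_ncard_inter X Y (Set.toFinite _) (Set.toFinite _)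

lemma inside_empty : inside (∅ : Set V) = ∅ := by
  ext e
  obtain ⟨a, b, h, rfl⟩ := e.exists_mkEdge
  simp

lemma xin_union (x : Edge V → ℝ) {A B : Set V} (h : A ∩ B = ∅) :
    xin x (A ∪ B) = xin x A + xin x B + ∑ e ∈ between A B, x e := by
  have := sum_inside_add_sum_inside x A B
  have hd : Disjoint A B := Set.disjoint_iff_inter_eq_empty.2 h
  rw [h, inside_empty, Finset.sum_empty, add_zero, hd.sdiff_eq_left, hd.sdiff_eq_right] at this
  exact this.symm

namespace InTreePolytope

variable (hx : InTreePolytope x)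
include hx

lemma sum_nonneg (A : Finset (Edge V)) : 0 ≤ ∑ e ∈ A, x e :=
  Finset.sum_nonneg fun e _ => hx.nonneg e

lemma tight_univ [Nonempty V] : Tight x Set.univ := ⟨Set.univ_nonempty, hx.total⟩

/-- The rank bounds for X ∩ Y and X ∪ Y leave no room in the supermodular identity, so all its
inequalities are equalities. -/
lemma tight_uncross {X Y : Set V} (hX : Tight x X) (hY : Tight x Y) (h : (X ∩ Y).Nonempty) :
    Tight x (X ∩ Y) ∧ Tight x (X ∪ Y) ∧ ∀ e ∈ between (X \ Y) (Y \ X), x e = 0 := by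
  have h1 := sum_inside_add_sum_inside x X Y
  have h2 := hx.le _ h
  have h3 := hx.le (X ∪ Y) (h.mono (Set.inter_subset_left.trans Set.subset_union_left))
  have h4 := ncard_union_add_inter X Y
  have h5 := hx.sum_nonneg (between (X \ Y) (Y \ X))
  have h6 := hX.2
  have h7 := hY.2
  simp only [xin] at *
  refine ⟨⟨h, by simp only [xin]; linarith⟩,
    ⟨h.mono (Set.inter_subset_left.trans Set.subset_union_left), by simp only [xin]; linarith⟩, ?_⟩
  have h8 : ∑ e ∈ between (X \ Y) (Y \ X), x e = 0 := by linarith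
  exact (Finset.sum_eq_zero_iff_of_nonneg fun e _ => hx.nonneg e).1 h8

/-- A set of weight more than `|W| - 2` is connected in the support. -/
lemma exists_pos_between {W A : Set V} (hW : (W.ncard : ℝ) - 2 < xin x W) (hAW : A ⊆ W)
    (hA : A.Nonempty) (hWA : (W \ A).Nonempty) : ∃ e ∈ between A (W \ A), 0 < x e := by
  by_contra! hno
  have h0 : ∑ e ∈ between A (W \ A), x e = 0 :=
    Finset.sum_eq_zero fun e he => le_antisymm (hno e he) (hx.nonneg e)
  have h1 := xin_union x (A := A) (B := W \ A) (Set.inter_sdiff_self A W)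
  rw [Set.union_sdiff_cancel hAW, h0] at h1
  have h2 := hx.le A hA
  have h3 := hx.le _ hWA
  have h4 : ((W \ A).ncard : ℝ) + A.ncard = W.ncard := by exact_mod_cast ncard_sdiff_add hAW
  linarith

/-- B and the complement of A cover V, and each falls short of its rank by less than 1/2; their
intersection therefore falls short by less than 1, even after paying for the edges that jump from A
over the region. -/
lemma lt_xin_region {A B : Set V} (hB : (B.ncard : ℝ) - 3 / 2 < xin x B)
    (hA : (Aᶜ.ncard : ℝ) - 3 / 2 < xin x Aᶜ) (hAB : A ⊆ B) :
    ((B \ A).ncard : ℝ) - 2 + ∑ e ∈ between A Bᶜ, x e < xin x (B \ A) := by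
  have h1 := sum_inside_add_sum_inside x B Aᶜ
  have e1 : B ∪ Aᶜ = Set.univ := by
    ext w; have := @hAB w; simp only [Set.mem_union, Set.mem_compl_iff, Set.mem_univ]; tauto
  have e2 : B ∩ Aᶜ = B \ A := rfl
  have e3 : B \ Aᶜ = A := by
    ext w; have := @hAB w; simp only [Set.mem_sdiff, Set.mem_compl_iff]; tauto
  have e4 : Aᶜ \ B = Bᶜ := by
    ext w; have := @hAB w; simp only [Set.mem_sdiff, Set.mem_compl_iff]; tauto
  rw [e1, e2, e3, e4] at h1
  have h2 := hx.total
  have h3 := ncard_union_add_inter B Aᶜ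
  rw [e1, e2] at h3
  simp only [xin] at *
  linarith

lemma lt_xin_inter {X L : Set V} (hX : Tight x X) (hL : (L.ncard : ℝ) - 2 < xin x L) :
    ((X ∩ L).ncard : ℝ) - 2 < xin x (X ∩ L) := by
  have h1 := sum_inside_add_sum_inside x X L
  have h2 := hx.le (X ∪ L) (hX.1.mono Set.subset_union_left)
  have h3 := ncard_union_add_inter X L
  have h4 := hx.sum_nonneg (between (X \ L) (L \ X))
  have h5 := hX.2
  simp only [xin] at *
  linarith

lemma lt_xin_univ : ((Set.univ : Set V).ncard : ℝ) - 3 / 2 < xin x Set.univ := by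
  rw [hx.total]; linarith

lemma sum_between_lt_one {A B : Set V} (hB : (B.ncard : ℝ) - 3 / 2 < xin x B)
    (hA : (Aᶜ.ncard : ℝ) - 3 / 2 < xin x Aᶜ) (hAB : A ⊆ B) (hne : (B \ A).Nonempty) :
    ∑ e ∈ between A Bᶜ, x e < 1 := by
  have h1 := hx.lt_xin_region hB hA hAB
  have h2 := hx.le _ hne
  linarith

/-- The two parts of a tight set contain at most |X| - 2 in total, so at least 1 must run between
them. -/
lemma one_le_sum_between {X A : Set V} (hX : Tight x X) (h1 : (X ∩ A).Nonempty)
    (h2 : (X \ A).Nonempty) : 1 ≤ ∑ e ∈ between (X ∩ A) (X \ A), x e := by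
  have h3 := xin_union x (A := X ∩ A) (B := X \ A) (by
    ext w; simp only [Set.mem_inter_iff, Set.mem_sdiff, Set.mem_empty_iff_false, iff_false]; tauto)
  rw [Set.inter_union_sdiff, hX.2] at h3
  have h4 := hx.le _ h1
  have h5 := hx.le _ h2
  have h6 : ((X ∩ A).ncard : ℝ) + (X \ A).ncard = X.ncard := by
    exact_mod_cast Set.ncard_inter_add_ncard_sdiff_eq_ncard X A (Set.toFinite _)
  linarith

lemma sum_cut_lt_two {U : Set V} (h1 : (U.ncard : ℝ) - 3 / 2 < xin x U)
    (h2 : (Uᶜ.ncard : ℝ) - 3 / 2 < xin x Uᶜ) : ∑ e ∈ cut U, x e < 2 := by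
  have h3 := sum_inside_compl x U
  have h4 := hx.total
  have h5 := ncard_union_add_inter U Uᶜ
  rw [Set.union_compl_self, Set.inter_compl_self, Set.ncard_empty] at h5
  simp only [xin, inside_univ] at *
  push_cast at h5
  linarith

/-- Two tight sets that cross a sparse cut have an intersection that crosses it as well. -/
lemma tight_inter_crosses {U X Y : Set V} (hU : ∑ e ∈ cut U, x e < 2)
    (hX : Tight x X) (hX1 : (X ∩ U).Nonempty) (hX2 : (X \ U).Nonempty)
    (hY : Tight x Y) (hY1 : (Y ∩ U).Nonempty) (hY2 : (Y \ U).Nonempty) :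
    ((X ∩ Y) ∩ U).Nonempty ∧ ((X ∩ Y) \ U).Nonempty := by
  by_contra hno
  have h1 := hx.one_le_sum_between hX hX1 hX2
  have h2 := hx.one_le_sum_between hY hY1 hY2
  have hdisj : Disjoint (between (X ∩ U) (X \ U)) (between (Y ∩ U) (Y \ U)) := by
    rw [Finset.disjoint_left]
    intro e he1 he2
    apply hno
    obtain ⟨a, b, hab, rfl⟩ := e.exists_mkEdge
    simp only [mkEdge_mem_between, Set.mem_inter_iff, Set.mem_sdiff] at he1 he2
    rcases he1 with ⟨h1, h2⟩ | ⟨h1, h2⟩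
    · exact ⟨⟨a, ⟨h1.1, by tauto⟩, h1.2⟩, ⟨b, ⟨h2.1, by tauto⟩, h2.2⟩⟩
    · exact ⟨⟨b, ⟨h1.1, by tauto⟩, h1.2⟩, ⟨a, ⟨h2.1, by tauto⟩, h2.2⟩⟩
  have hsub : between (X ∩ U) (X \ U) ∪ between (Y ∩ U) (Y \ U) ⊆ cut U := by
    intro e he
    obtain ⟨a, b, hab, rfl⟩ := e.exists_mkEdge
    simp only [Finset.mem_union, mkEdge_mem_between, mkEdge_mem_cut, Set.mem_inter_iff,
      Set.mem_sdiff] at he ⊢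
    tauto
  have h3 := Finset.sum_le_sum_of_subset_of_nonneg (f := x) hsub fun e _ _ => hx.nonneg e
  rw [Finset.sum_union hdisj] at h3
  linarith

end InTreePolytope

/-- A is the predecessor of U in the chain, with ∅ as a sentinel when there is none; in either case
the complement of A satisfies the weight bound. -/
lemma SparseChain.exists_lower {𝒰 : Set (Set V)} (h : SparseChain x 𝒰) (hx : InTreePolytope x)
    {U : Set V} (hU : U ∈ 𝒰) :
    ∃ A : Set V, A ⊂ U ∧ (Aᶜ.ncard : ℝ) - 3 / 2 < xin x Aᶜ ∧ ∀ W ∈ 𝒰, W ⊂ U → W ⊆ A := by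
  classical
  by_cases hne : (Finset.univ.filter fun W => W ∈ 𝒰 ∧ W ⊂ U).Nonempty
  · obtain ⟨A, hA, hmax⟩ := Finset.exists_max_image _ Set.ncard hne
    obtain ⟨-, hA𝒰, hAU⟩ := Finset.mem_filter.1 hA
    refine ⟨A, hAU, h.lt_xin_compl A hA𝒰, fun W hW hWU => ?_⟩
    rcases h.chain W hW A hA𝒰 with h1 | h1
    · exact h1
    · have := hmax W (by simp [hW, hWU])
      exact (Set.eq_of_subset_of_ncard_le h1 this (Set.toFinite _)).symm.subset
  · refine ⟨∅, Set.empty_ssubset.2 (h.nonempty U hU), ?_, fun W hW hWU => ?_⟩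
    · rw [Set.compl_empty]; exact hx.lt_xin_univ
    · exact absurd ⟨W, by simp [hW, hWU]⟩ hne

lemma SparseChain.exists_upper {𝒰 : Set (Set V)} (h : SparseChain x 𝒰) (hx : InTreePolytope x)
    {U : Set V} (hU : U ∈ 𝒰) :
    ∃ B : Set V, U ⊂ B ∧ (B.ncard : ℝ) - 3 / 2 < xin x B ∧ ∀ W ∈ 𝒰, U ⊂ W → B ⊆ W := by
  classical
  by_cases hne : (Finset.univ.filter fun W => W ∈ 𝒰 ∧ U ⊂ W).Nonempty
  · obtain ⟨B, hB, hmin⟩ := Finset.exists_min_image _ Set.ncard hne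
    obtain ⟨-, hB𝒰, hUB⟩ := Finset.mem_filter.1 hB
    refine ⟨B, hUB, h.lt_xin B hB𝒰, fun W hW hWU => ?_⟩
    rcases h.chain B hB𝒰 W hW with h1 | h1
    · exact h1
    · have := hmin W (by simp [hW, hWU])
      exact (Set.eq_of_subset_of_ncard_le h1 this (Set.toFinite _)).symm.subset
  · refine ⟨Set.univ, ?_, hx.lt_xin_univ, fun W hW hWU => absurd ⟨W, by simp [hW, hWU]⟩ hne⟩
    rw [Set.ssubset_univ_iff]
    rintro rfl
    simpa using h.compl_nonempty _ hU

/-- For every member `U` of the chain there is a support edge that crosses `U` and no other member,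
and that is contained in all tight sets crossing `U`. -/
lemma SparseChain.exists_edge [Nonempty V] {𝒰 : Set (Set V)} (h : SparseChain x 𝒰)
    (hx : InTreePolytope x) {U : Set V} (hU : U ∈ 𝒰) :
    ∃ e : Edge V, 0 < x e ∧ e ∈ cut U ∧ (∀ W ∈ 𝒰, W ≠ U → e ∉ cut W) ∧
      ∀ X, Tight x X → (X ∩ U).Nonempty → (X \ U).Nonempty → e ∈ inside X := by
  classical
  have hU2 := hx.sum_cut_lt_two (h.lt_xin U hU) (h.lt_xin_compl U hU)
  have hne : (Finset.univ.filter fun X : Set V =>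
      Tight x X ∧ (X ∩ U).Nonempty ∧ (X \ U).Nonempty).Nonempty :=
    ⟨Set.univ, by
      simp only [Finset.mem_filter, Finset.mem_univ, true_and, Set.univ_inter]
      refine ⟨hx.tight_univ, h.nonempty U hU, ?_⟩
      rw [← Set.compl_eq_univ_sdiff]; exact h.compl_nonempty U hU⟩
  obtain ⟨X, hX, hmin⟩ := Finset.exists_min_image _ Set.ncard hne
  obtain ⟨-, hXt, hX1, hX2⟩ := Finset.mem_filter.1 hX
  -- Tight sets crossing U are closed under intersection: each carries weight at least 1 across U,
  -- the cut has weight less than 2, so two of them share an edge across U. Hence there is a least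
  -- one.
  have hleast : ∀ Y, Tight x Y → (Y ∩ U).Nonempty → (Y \ U).Nonempty → X ⊆ Y := by
    intro Y hY hY1 hY2
    have hc := hx.tight_inter_crosses hU2 hXt hX1 hX2 hY hY1 hY2
    have ht := (hx.tight_uncross hXt hY (hc.1.mono Set.inter_subset_left)).1
    have := hmin (X ∩ Y) (by simp only [Finset.mem_filter, Finset.mem_univ, true_and]
                             exact ⟨ht, hc⟩)
    have := Set.eq_of_subset_of_ncard_le Set.inter_subset_left this (Set.toFinite _)
    rw [← this]; exact Set.inter_subset_right
  obtain ⟨A, hAU, hA, hAmax⟩ := h.exists_lower hx hU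
  obtain ⟨B, hUB, hB, hBmin⟩ := h.exists_upper hx hU
  have hcross := hx.one_le_sum_between hXt hX1 hX2
  -- Otherwise all X-edges across U would jump over the layer U \ A, and these have weight below 1.
  -- The next step treats B \ U in the same way.
  have hXA : (X ∩ (U \ A)).Nonempty := by
    by_contra hemp
    have hlt := hx.sum_between_lt_one (h.lt_xin U hU) hA hAU.subset
      (Set.nonempty_of_ssubset hAU)
    have hsub : between (X ∩ U) (X \ U) ⊆ between A Uᶜ := by
      have hXU : ∀ w ∈ X, w ∈ U → w ∈ A := by
        intro w hw hwU
        by_contra hwA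
        exact hemp ⟨w, hw, hwU, hwA⟩
      intro e he
      obtain ⟨a, b, hab, rfl⟩ := e.exists_mkEdge
      simp only [mkEdge_mem_between, Set.mem_inter_iff, Set.mem_sdiff, Set.mem_compl_iff] at he ⊢
      rcases he with he | he
      · exact Or.inl ⟨hXU _ he.1.1 he.1.2, he.2.2⟩
      · exact Or.inr ⟨hXU _ he.1.1 he.1.2, he.2.2⟩
    have := Finset.sum_le_sum_of_subset_of_nonneg (f := x) hsub fun e _ _ => hx.nonneg e
    linarith
  have hXB : (X ∩ (B \ U)).Nonempty := by
    by_contra hemp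
    have hlt := hx.sum_between_lt_one hB (h.lt_xin_compl U hU) hUB.subset
      (Set.nonempty_of_ssubset hUB)
    have hsub : between (X ∩ U) (X \ U) ⊆ between U Bᶜ := by
      have hXU : ∀ w ∈ X, w ∉ U → w ∉ B := by
        intro w hw hwU hwB
        exact hemp ⟨w, hw, hwB, hwU⟩
      intro e he
      obtain ⟨a, b, hab, rfl⟩ := e.exists_mkEdge
      simp only [mkEdge_mem_between, Set.mem_inter_iff, Set.mem_sdiff, Set.mem_compl_iff] at he ⊢
      rcases he with he | he
      · exact Or.inl ⟨he.1.2, hXU _ he.2.1 he.2.2⟩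
      · exact Or.inr ⟨he.1.2, hXU _ he.2.1 he.2.2⟩
    have := Finset.sum_le_sum_of_subset_of_nonneg (f := x) hsub fun e _ _ => hx.nonneg e
    linarith
  have hAB : A ⊆ B := hAU.subset.trans hUB.subset
  have hreg : ((B \ A).ncard : ℝ) - 2 < xin x (B \ A) := by
    have := hx.lt_xin_region hB hA hAB
    have := hx.sum_nonneg (between A Bᶜ)
    linarith
  obtain ⟨p, hpX, hpU, hpA⟩ := hXA
  obtain ⟨q, hqX, hqB, hqU⟩ := hXB
  -- X ∩ (B \ A) is connected in the support, so some edge leads from its part in U to its part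
  -- outside U. Staying within two adjacent layers, it crosses no other chain member.
  obtain ⟨e, he, hpos⟩ := hx.exists_pos_between (A := X ∩ (U \ A)) (hx.lt_xin_inter hXt hreg)
    (fun w hw => ⟨hw.1, hUB.subset hw.2.1, hw.2.2⟩) ⟨p, hpX, hpU, hpA⟩
    ⟨q, ⟨hqX, hqB, fun hqA => hqU (hAU.subset hqA)⟩, fun hq => hqU hq.2.1⟩
  obtain ⟨a, ha, b, hb, hab⟩ := mem_between_iff.1 he
  have hbU : b ∉ U := fun hbU => hb.2 ⟨hb.1.1, hbU, hb.1.2.2⟩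
  have hne : a ≠ b := by rintro rfl; exact hbU ha.2.1
  obtain rfl : e = mkEdge a b hne := Subtype.ext hab
  refine ⟨_, hpos, by simp [ha.2.1, hbU], fun W hW hWU => ?_, fun Y hY hY1 hY2 => ?_⟩
  · rw [mkEdge_mem_cut]
    rcases h.chain W hW U hU with h1 | h1
    · have h2 := hAmax W hW (h1.ssubset_of_ne hWU)
      have h3 : a ∉ W := fun h' => ha.2.2 (h2 h')
      have h4 : b ∉ W := fun h' => hbU (h1 h')
      tauto
    · have h2 := hBmin W hW (h1.ssubset_of_ne hWU.symm)
      have h3 : a ∈ W := h1 ha.2.1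
      have h4 : b ∈ W := h2 hb.1.2.1
      tauto
  · have := hleast Y hY hY1 hY2
    simp only [mkEdge_mem_inside]
    exact ⟨this ha.1, this hb.1.1⟩

end

end STPathTSP

end

/-! ### Connectivity of tight sets across the layers of a chain -/

noncomputable section

namespace STPathTSP

variable {V : Type u} [Fintype V] {x : Edge V → ℝ}

lemma SparseChain.exists_layer {𝒰 : Set (Set V)} (h : SparseChain x 𝒰) (hx : InTreePolytope x)
    (a : V) : ∃ L : Set V, (∀ w, w ∈ L ↔ ∀ W ∈ 𝒰, (w ∈ W ↔ a ∈ W)) ∧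
      (L.ncard : ℝ) - 2 < xin x L := by
  classical
  obtain ⟨A, hA, haA, hAmax, hA𝒰⟩ : ∃ A : Set V, (Aᶜ.ncard : ℝ) - 3 / 2 < xin x Aᶜ ∧ a ∉ A ∧
      (∀ W ∈ 𝒰, a ∉ W → W ⊆ A) ∧ (A ∈ 𝒰 ∨ A = ∅) := by
    by_cases hne : (Finset.univ.filter fun W => W ∈ 𝒰 ∧ a ∉ W).Nonempty
    · obtain ⟨A, hA, hmax⟩ := Finset.exists_max_image _ Set.ncard hne
      obtain ⟨-, hA𝒰, haA⟩ := Finset.mem_filter.1 hA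
      refine ⟨A, h.lt_xin_compl A hA𝒰, haA, fun W hW haW => ?_, Or.inl hA𝒰⟩
      rcases h.chain W hW A hA𝒰 with h1 | h1
      · exact h1
      · have := hmax W (by simp [hW, haW])
        exact (Set.eq_of_subset_of_ncard_le h1 this (Set.toFinite _)).symm.subset
    · refine ⟨∅, ?_, by simp, fun W hW haW => absurd ⟨W, by simp [hW, haW]⟩ hne, Or.inr rfl⟩
      rw [Set.compl_empty]; exact hx.lt_xin_univ
  obtain ⟨B, hB, haB, hBmin, hB𝒰⟩ : ∃ B : Set V, (B.ncard : ℝ) - 3 / 2 < xin x B ∧ a ∈ B ∧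
      (∀ W ∈ 𝒰, a ∈ W → B ⊆ W) ∧ (B ∈ 𝒰 ∨ B = Set.univ) := by
    by_cases hne : (Finset.univ.filter fun W => W ∈ 𝒰 ∧ a ∈ W).Nonempty
    · obtain ⟨B, hB, hmin⟩ := Finset.exists_min_image _ Set.ncard hne
      obtain ⟨-, hB𝒰, haB⟩ := Finset.mem_filter.1 hB
      refine ⟨B, h.lt_xin B hB𝒰, haB, fun W hW haW => ?_, Or.inl hB𝒰⟩
      rcases h.chain B hB𝒰 W hW with h1 | h1
      · exact h1
      · have := hmin W (by simp [hW, haW])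
        exact (Set.eq_of_subset_of_ncard_le h1 this (Set.toFinite _)).symm.subset
    · exact ⟨Set.univ, hx.lt_xin_univ, Set.mem_univ _,
        fun W hW haW => absurd ⟨W, by simp [hW, haW]⟩ hne, Or.inr rfl⟩
  have hAB : A ⊆ B := by
    rcases hA𝒰 with hA' | rfl
    · rcases hB𝒰 with hB' | rfl
      · rcases h.chain A hA' B hB' with h1 | h1
        · exact h1
        · exact absurd (h1 haB) haA
      · exact Set.subset_univ _
    · exact Set.empty_subset _
  refine ⟨B \ A, fun w => ⟨fun hw W hW => ?_, fun hw => ⟨?_, ?_⟩⟩, ?_⟩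
  · by_cases haW : a ∈ W
    · exact ⟨fun _ => haW, fun _ => hBmin W hW haW hw.1⟩
    · exact ⟨fun hwW => absurd (hAmax W hW haW hwW) hw.2, fun h' => absurd h' haW⟩
  · rcases hB𝒰 with hB' | rfl
    · exact (hw B hB').2 haB
    · exact Set.mem_univ _
  · rcases hA𝒰 with hA' | rfl
    · exact fun hwA => haA ((hw A hA').1 hwA)
    · simp
  · have := hx.lt_xin_region hB hA hAB
    have := hx.sum_nonneg (between A Bᶜ)
    linarith

/-- The support edges crossing no member of `𝒰`, and one distinguished edge per member. -/
def layerGraph (x : Edge V → ℝ) (𝒰 : Set (Set V)) (E : 𝒰 → Edge V) : Finset (Edge V) :=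
  open Classical in
  Finset.univ.filter fun e => 0 < x e ∧ ((∀ W ∈ 𝒰, e ∉ cut W) ∨ ∃ U, e = E U)

/-- The number of members of the chain `𝒰` that avoid `v`. -/
def depth (𝒰 : Set (Set V)) (v : V) : ℕ := {W ∈ 𝒰 | v ∉ W}.ncard

lemma exists_separating {𝒰 : Set (Set V)} {a b : V}
    (hab : ¬ ∀ W ∈ 𝒰, (b ∈ W ↔ a ∈ W)) : ∃ U ∈ 𝒰, (a ∈ U ∧ b ∉ U) ∨ (b ∈ U ∧ a ∉ U) := by
  push Not at hab
  obtain ⟨U, hU, h1⟩ := hab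
  exact ⟨U, hU, by tauto⟩

/-- Take a in A and b in X \ A and induct on their distance in the chain. Within one layer, X is
connected in the support. Otherwise the distinguished edge of a separating member lies in X; either
it joins A to X \ A, or one of its ends replaces a or b and shortens the distance. -/
lemma SparseChain.connOn_layerGraph [Nonempty V] {𝒰 : Set (Set V)} (h : SparseChain x 𝒰)
    (hx : InTreePolytope x) {E : 𝒰 → Edge V} (hE : ∀ U : 𝒰, 0 < x (E U) ∧ E U ∈ cut U.1 ∧
      (∀ W ∈ 𝒰, W ≠ U.1 → E U ∉ cut W) ∧
      ∀ X, Tight x X → (X ∩ U.1).Nonempty → (X \ U.1).Nonempty → E U ∈ inside X)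
    {X : Set V} (hX : Tight x X) : ConnOn (layerGraph x 𝒰 E) X := by
  classical
  intro A hAX hA hXA
  have main : ∀ n : ℕ, ∀ a ∈ A, ∀ b ∈ X \ A, (depth 𝒰 a - depth 𝒰 b) +
      (depth 𝒰 b - depth 𝒰 a) = n → ∃ e ∈ layerGraph x 𝒰 E, e ∈ between A (X \ A) := by
    intro n
    induction n using Nat.strong_induction_on with
    | _ n ih =>
      intro a ha b hb hn
      by_cases hsame : ∀ W ∈ 𝒰, (b ∈ W ↔ a ∈ W)
      · obtain ⟨L, hL, hlt⟩ := h.exists_layer hx a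
        obtain ⟨e, he, hpos⟩ := hx.exists_pos_between (A := A ∩ L) (hx.lt_xin_inter hX hlt)
          (Set.inter_subset_inter_left _ hAX) ⟨a, ha, (hL a).2 fun _ _ => Iff.rfl⟩
          ⟨b, ⟨hb.1, (hL b).2 hsame⟩, fun h' => hb.2 h'.1⟩
        obtain ⟨p, q, hpq, rfl⟩ := e.exists_mkEdge
        refine ⟨mkEdge p q hpq, ?_, ?_⟩
        rotate_left
        · simp only [mkEdge_mem_between, Set.mem_inter_iff, Set.mem_sdiff] at he ⊢
          tauto
        · simp only [layerGraph, Finset.mem_filter, Finset.mem_univ, true_and]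
          refine ⟨hpos, Or.inl fun W hW => ?_⟩
          have hpL : p ∈ L := by
            simp only [mkEdge_mem_between, Set.mem_inter_iff, Set.mem_sdiff] at he; tauto
          have hqL : q ∈ L := by
            simp only [mkEdge_mem_between, Set.mem_inter_iff, Set.mem_sdiff] at he; tauto
          have h1 := (hL p).1 hpL W hW
          have h2 := (hL q).1 hqL W hW
          rw [mkEdge_mem_cut]; tauto
      · obtain ⟨U, hU, hsep⟩ := exists_separating hsame
        obtain ⟨hpos, hcut, honly, hin⟩ := hE ⟨U, hU⟩
        have hmemG : E ⟨U, hU⟩ ∈ layerGraph x 𝒰 E := by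
          simp only [layerGraph, Finset.mem_filter, Finset.mem_univ, true_and]
          exact ⟨hpos, Or.inr ⟨⟨U, hU⟩, rfl⟩⟩
        have hEX : E ⟨U, hU⟩ ∈ inside X := by
          rcases hsep with ⟨h1, h2⟩ | ⟨h1, h2⟩
          · exact hin X hX ⟨a, hAX ha, h1⟩ ⟨b, hb.1, h2⟩
          · exact hin X hX ⟨b, hb.1, h1⟩ ⟨a, hAX ha, h2⟩
        obtain ⟨p, hp, q, hq, hpq⟩ := mem_cut_iff.1 hcut
        have hne : p ≠ q := by rintro rfl; exact hq hp
        have hEe : E ⟨U, hU⟩ = mkEdge p q hne := Subtype.ext hpq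
        rw [hEe, mkEdge_mem_inside] at hEX
        have hiff : ∀ W ∈ 𝒰, W ≠ U → (p ∈ W ↔ q ∈ W) := by
          intro W hW hWU
          have := honly W hW hWU
          rw [hEe, mkEdge_mem_cut] at this
          tauto
        -- The edge pq joins the two layers adjacent to U: p has the largest depth in U and q the
        -- smallest outside.
        have d1 : depth 𝒰 p < depth 𝒰 q := by
          apply Set.ncard_lt_ncard _ (Set.toFinite _)
          refine ⟨fun W hW => ⟨hW.1, fun hqW => ?_⟩, fun hss => ?_⟩
          · by_cases hWU : W = U
            · subst hWU; exact hW.2 hp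
            · exact hW.2 ((hiff W hW.1 hWU).2 hqW)
          · exact (hss (show U ∈ {W ∈ 𝒰 | q ∉ W} from ⟨hU, hq⟩)).2 hp
        have d2 : ∀ w ∈ U, depth 𝒰 w ≤ depth 𝒰 p := by
          intro w hw
          apply Set.ncard_le_ncard _ (Set.toFinite _)
          rintro W ⟨hW, hwW⟩
          refine ⟨hW, fun hpW => ?_⟩
          rcases h.chain W hW U hU with h1 | h1
          · have hWU : W ≠ U := by rintro rfl; exact hwW hw
            exact hq (h1 ((hiff W hW hWU).1 hpW))
          · exact hwW (h1 hw)
        have d3 : ∀ w ∉ U, depth 𝒰 q ≤ depth 𝒰 w := by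
          intro w hw
          apply Set.ncard_le_ncard _ (Set.toFinite _)
          rintro W ⟨hW, hqW⟩
          refine ⟨hW, fun hwW => ?_⟩
          rcases h.chain W hW U hU with h1 | h1
          · exact hw (h1 hwW)
          · have hWU : W ≠ U := by rintro rfl; exact hw hwW
            exact hqW ((hiff W hW hWU).1 (h1 hp))
        by_cases hpA : p ∈ A
        · by_cases hqA : q ∈ A
          · rcases hsep with ⟨h1, h2⟩ | ⟨h1, h2⟩
            · have := d2 a h1; have := d3 b h2
              exact ih _ (by omega) q hqA b hb rfl
            · have := d2 b h1; have := d3 a h2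
              exact ih _ (by omega) p hpA b hb rfl
          · exact ⟨E ⟨U, hU⟩, hmemG, by rw [hEe]; simp [hpA, hqA, hEX]⟩
        · by_cases hqA : q ∈ A
          · exact ⟨E ⟨U, hU⟩, hmemG, by rw [hEe]; simp [hpA, hqA, hEX]⟩
          · rcases hsep with ⟨h1, h2⟩ | ⟨h1, h2⟩
            · have := d2 a h1; have := d3 b h2
              exact ih _ (by omega) a ha p ⟨hEX.1, hpA⟩ rfl
            · have := d2 b h1; have := d3 a h2
              exact ih _ (by omega) a ha q ⟨hEX.2, hqA⟩ rfl
  obtain ⟨a, ha⟩ := hA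
  obtain ⟨b, hb⟩ := hXA
  exact main _ a ha b hb rfl

/-- A spanning tree in the support with exactly one edge in every cut of the chain that is
connected on every tight set. -/
theorem SparseChain.exists_tree [Nonempty V] {𝒰 : Set (Set V)} (h : SparseChain x 𝒰)
    (hx : InTreePolytope x) :
    ∃ B : Finset (Edge V), IsSpanningTree B ∧ (∀ e ∈ B, 0 < x e) ∧
      (∀ U ∈ 𝒰, (cut U ∩ B).card = 1) ∧ ∀ X, Tight x X → (B ∩ inside X).card + 1 = X.ncard := by
  classical
  choose E hE using fun U : 𝒰 => h.exists_edge hx U.2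
  have hpos : ∀ e ∈ layerGraph x 𝒰 E, 0 < x e := fun e he => (Finset.mem_filter.1 he).2.1
  have hF : IsCrossingFamily (layerGraph x 𝒰 E) {X | Tight x X} :=
    { univ_mem := hx.tight_univ
      inter_mem := fun X hX Y hY hXY => (hx.tight_uncross hX hY hXY).1
      union_mem := fun X hX Y hY hXY => (hx.tight_uncross hX hY hXY).2.1
      notMem_between := fun X hX Y hY hXY e he hb =>
        (hpos e he).ne' ((hx.tight_uncross hX hY hXY).2.2 e hb) }
  obtain ⟨B, hBG, hB, hconn⟩ := hF.exists_tree fun X hX => h.connOn_layerGraph hx hE hX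
  refine ⟨B, hB, fun e he => hpos e (hBG he), fun U hU => ?_, fun X hX => ?_⟩
  · obtain ⟨a, ha⟩ := h.nonempty U hU
    obtain ⟨b, hb⟩ := h.compl_nonempty U hU
    obtain ⟨e, he, hc⟩ := exists_mem_cut_of_connected hB.1 ha hb
    -- Every edge of the layer graph either crosses no member or is distinguished for a single
    -- member and crosses only that one.
    have huniq : ∀ f ∈ B, f ∈ cut U → f = E ⟨U, hU⟩ := by
      intro f hf hfU
      rcases (Finset.mem_filter.1 (hBG hf)).2.2 with h1 | ⟨W, rfl⟩
      · exact absurd hfU (h1 U hU)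
      · by_contra hne
        exact (hE W).2.2.1 U hU (fun h' => hne (congrArg E (Subtype.ext h'.symm))) hfU
    rw [Finset.card_eq_one]
    refine ⟨E ⟨U, hU⟩, ?_⟩
    ext f
    simp only [Finset.mem_inter, Finset.mem_singleton]
    constructor
    · rintro ⟨h1, h2⟩; exact huniq f h2 h1
    · rintro rfl
      rw [← huniq e he hc]; exact ⟨hc, he⟩
  · have h1 := (hconn X hX).ncard_le hX.1
    have h2 := hB.card_inter_inside_le hX.1
    omega

/-- With one of its |V| - 1 edges in the cut, the tree attains the maximum |U| - 1 and |Uᶜ| - 1 on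
both sides. -/
lemma IsSpanningTree.card_inter_inside_of_cut {B : Finset (Edge V)} (hB : IsSpanningTree B)
    {U : Set V} (h1 : U.Nonempty) (h2 : Uᶜ.Nonempty) (hc : (cut U ∩ B).card = 1) :
    (B ∩ inside U).card + 1 = U.ncard ∧ (B ∩ inside Uᶜ).card + 1 = Uᶜ.ncard := by
  have h3 := hB.card_inter_inside_le h1
  have h4 := hB.card_inter_inside_le h2
  have h5 := hB.card_add_one
  have h6 := Set.ncard_add_ncard_compl U (Set.toFinite _) (Set.toFinite _)
  rw [Nat.card_eq_fintype_card] at h6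
  have h7 : (B ∩ inside U).card + (B ∩ inside Uᶜ).card + (cut U ∩ B).card = B.card := by
    rw [← Finset.card_union_of_disjoint, ← Finset.card_union_of_disjoint]
    · congr 1
      ext e
      obtain ⟨a, b, hab, rfl⟩ := e.exists_mkEdge
      simp only [Finset.mem_union, Finset.mem_inter, mkEdge_mem_inside, mkEdge_mem_cut,
        Set.mem_compl_iff]
      tauto
    · rw [Finset.disjoint_left]
      intro e
      obtain ⟨a, b, hab, rfl⟩ := e.exists_mkEdge
      simp only [Finset.mem_union, Finset.mem_inter, mkEdge_mem_inside, mkEdge_mem_cut,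
        Set.mem_compl_iff]
      tauto
    · rw [Finset.disjoint_left]
      intro e
      obtain ⟨a, b, hab, rfl⟩ := e.exists_mkEdge
      simp only [Finset.mem_inter, mkEdge_mem_inside, Set.mem_compl_iff]
      tauto
  omega

/-! ### Layered decompositions -/

/-- A point of the spanning tree polytope scaled by `m`, together with a chain of sets `U`, for
each of which a prefix of weight `τ U` of a decomposition into trees has to cross `U` once. -/
structure LayeredState (z : Edge V → ℝ) (m : ℝ) (𝒰 : Set (Set V)) (τ : Set V → ℝ) : Prop where
  pos : 0 < m
  nonneg : ∀ e, 0 ≤ z e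
  total : xin z Set.univ = m * ((Set.univ : Set V).ncard - 1)
  le : ∀ X : Set V, X.Nonempty → xin z X ≤ m * (X.ncard - 1)
  chain : ∀ U ∈ 𝒰, ∀ W ∈ 𝒰, U ⊆ W ∨ W ⊆ U
  nonempty : ∀ U ∈ 𝒰, U.Nonempty
  compl_nonempty : ∀ U ∈ 𝒰, Uᶜ.Nonempty
  τ_pos : ∀ U ∈ 𝒰, 0 < τ U
  τ_le : ∀ U ∈ 𝒰, τ U ≤ m
  xin_eq : ∀ U ∈ 𝒰, xin z U = m * (U.ncard - 1) - (m - τ U) / 2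
  xin_compl_eq : ∀ U ∈ 𝒰, xin z Uᶜ = m * (Uᶜ.ncard - 1) - (m - τ U) / 2

lemma LayeredState.exists_tree [Nonempty V] {z : Edge V → ℝ} {m : ℝ} {𝒰 : Set (Set V)}
    {τ : Set V → ℝ} (h : LayeredState z m 𝒰 τ) :
    ∃ B : Finset (Edge V), IsSpanningTree B ∧ (∀ e ∈ B, 0 < z e) ∧
      (∀ U ∈ 𝒰, (cut U ∩ B).card = 1) ∧
      ∀ X : Set V, X.Nonempty → xin z X = m * (X.ncard - 1) → (B ∩ inside X).card + 1 = X.ncard := by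
  have hm := h.pos
  have hxin : ∀ X, xin (fun e => z e / m) X = xin z X / m := fun X => by
    simp only [xin, Finset.sum_div]
  have hx : InTreePolytope fun e => z e / m :=
    { nonneg := fun e => div_nonneg (h.nonneg e) hm.le
      total := by rw [hxin, h.total]; field_simp
      le := fun X hX => by
        rw [hxin, div_le_iff₀ hm]; have := h.le X hX; linarith }
  have hc : SparseChain (fun e => z e / m) 𝒰 :=
    { chain := h.chain
      nonempty := h.nonempty
      compl_nonempty := h.compl_nonempty
      lt_xin := fun U hU => by
        rw [hxin, lt_div_iff₀ hm, h.xin_eq U hU]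
        have := h.τ_pos U hU
        linarith
      lt_xin_compl := fun U hU => by
        rw [hxin, lt_div_iff₀ hm, h.xin_compl_eq U hU]
        have := h.τ_pos U hU
        linarith }
  obtain ⟨B, hB, hpos, hcut, htight⟩ := hc.exists_tree hx
  refine ⟨B, hB, fun e he => ?_, hcut, fun X hX hXt => htight X ⟨hX, ?_⟩⟩
  · have := hpos e he
    rwa [div_pos_iff_of_pos_right hm] at this
  · rw [hxin, hXt]; field_simp

/-- The largest step that keeps finitely many affine constraints satisfied makes one of them
tight. -/
lemma exists_max_step {ι : Type*} [Finite ι] (a b : ι → ℝ) (ha : ∀ i, 0 ≤ a i)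
    (hab : ∀ i, 0 < b i → 0 < a i) (hb : ∃ i, 0 < b i) :
    ∃ ε, 0 < ε ∧ (∀ i, ε * b i ≤ a i) ∧ ∃ i, 0 < b i ∧ ε * b i = a i := by
  classical
  have := Fintype.ofFinite ι
  obtain ⟨i, hi, hmin⟩ := (Finset.univ.filter fun i => 0 < b i).exists_min_image
    (fun i => a i / b i) (by obtain ⟨i, hi⟩ := hb; exact ⟨i, by simp [hi]⟩)
  have hbi : 0 < b i := (Finset.mem_filter.1 hi).2
  have hε : 0 < a i / b i := div_pos (hab i hbi) hbi
  refine ⟨a i / b i, hε, fun j => ?_, i, hbi, by field_simp⟩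
  by_cases hj : 0 < b j
  · have := hmin j (by simp [hj])
    rwa [← le_div_iff₀ hj]
  · exact (mul_nonpos_of_nonneg_of_nonpos hε.le (not_lt.1 hj)).trans (ha j)

lemma sum_Iic_eq_ite {k : ℕ} (r : Fin k) (f : Fin k → ℝ) :
    ∑ j ∈ Finset.Iic r, f j = ∑ j, if j ≤ r then f j else 0 := by
  rw [← Finset.sum_filter]
  congr 1
  ext j; simp

lemma sum_Iic_succ_cons {k : ℕ} (r : Fin k) (a : ℝ) (f : Fin k → ℝ) :
    ∑ j ∈ Finset.Iic r.succ, (Fin.cons a f : Fin (k + 1) → ℝ) j = a + ∑ j ∈ Finset.Iic r, f j := by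
  rw [sum_Iic_eq_ite, sum_Iic_eq_ite, Fin.sum_univ_succ]
  simp

lemma sum_Iic_zero_cons {k : ℕ} (a : ℝ) (f : Fin k → ℝ) :
    ∑ j ∈ Finset.Iic (0 : Fin (k + 1)), (Fin.cons a f : Fin (k + 1) → ℝ) j = a := by
  rw [sum_Iic_eq_ite, Fin.sum_univ_succ]
  simp

lemma sum_incidence (B A : Finset (Edge V)) : ∑ e ∈ A, incidence B e = (B ∩ A).card := by
  simp only [incidence, Finset.sum_ite_mem, Finset.inter_comm A B]
  simp

/-- A decomposition of `z` into weighted spanning trees, in which a prefix of weight `τ U`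
crosses `U` once, for all `U ∈ 𝒰`. -/
def HasLayeredDecomposition (z : Edge V → ℝ) (m : ℝ) (𝒰 : Set (Set V)) (τ : Set V → ℝ) : Prop :=
  ∃ (k : ℕ) (S : Fin k → Finset (Edge V)) (p : Fin k → ℝ), (∀ j, IsSpanningTree (S j)) ∧
    (∀ j, 0 ≤ p j) ∧ ∑ j, p j = m ∧ (∀ e, z e = ∑ j, p j * incidence (S j) e) ∧
    ∀ U ∈ 𝒰, ∃ r : Fin k, ∑ j ∈ Finset.Iic r, p j = τ U ∧ ∀ j ≤ r, (cut U ∩ S j).card = 1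

/-- The measure that decreases during the construction of a layered decomposition. -/
def LayeredState.potential (z : Edge V → ℝ) (m : ℝ) (𝒰 : Set (Set V)) : ℕ :=
  {e | 0 < z e}.ncard + {X : Set V | X.Nonempty ∧ xin z X < m * (X.ncard - 1)}.ncard + 𝒰.ncard

lemma HasLayeredDecomposition.cons {z : Edge V → ℝ} {m ε : ℝ} {𝒰 : Set (Set V)} {τ : Set V → ℝ}
    {B : Finset (Edge V)} (hB : IsSpanningTree B) (hcut : ∀ U ∈ 𝒰, (cut U ∩ B).card = 1)
    (hε : 0 < ε) (hετ : ∀ U ∈ 𝒰, ε ≤ τ U)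
    (h : HasLayeredDecomposition (fun e => z e - ε * incidence B e) (m - ε) {U ∈ 𝒰 | ε < τ U}
      fun U => τ U - ε) : HasLayeredDecomposition z m 𝒰 τ := by
  obtain ⟨k, S, p, hS, hp, hsum, hz, hU⟩ := h
  refine ⟨k + 1, Fin.cons B S, Fin.cons ε p, ?_, ?_, ?_, ?_, ?_⟩
  · exact fun j => Fin.cases hB hS j
  · exact fun j => Fin.cases hε.le hp j
  · rw [Fin.sum_univ_succ]; simp [hsum]
  · intro e
    rw [Fin.sum_univ_succ]
    have := hz e
    simp only [Fin.cons_zero, Fin.cons_succ]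
    linarith
  · intro U hU𝒰
    rcases (hετ U hU𝒰).eq_or_lt with heq | hlt
    · refine ⟨0, by rw [sum_Iic_zero_cons, heq], fun j hj => ?_⟩
      obtain rfl : j = 0 := Fin.le_zero_iff.1 hj
      exact hcut U hU𝒰
    · obtain ⟨r, hr, hrc⟩ := hU U ⟨hU𝒰, hlt⟩
      refine ⟨r.succ, by rw [sum_Iic_succ_cons, hr]; ring, fun j => ?_⟩
      refine Fin.cases (fun _ => hcut U hU𝒰) (fun j hj => ?_) j
      exact hrc j (Fin.succ_le_succ_iff.1 hj)

/-- Peel off a suitable tree with the largest weight ε that keeps all constraints. The deficits (m -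
τ U)/2 on the two sides of U are invariant, since m and τ U both drop by ε and the tree spans both
sides. Each step exhausts m, or empties a support edge, or makes a set tight, or completes the
prefix of a member of the chain; the last three lower the potential. -/
theorem LayeredState.hasLayeredDecomposition [Nonempty V] : ∀ (n : ℕ) {z : Edge V → ℝ} {m : ℝ}
    {𝒰 : Set (Set V)} {τ : Set V → ℝ}, LayeredState z m 𝒰 τ →
    LayeredState.potential z m 𝒰 = n → HasLayeredDecomposition z m 𝒰 τ := by
  classical
  intro n
  induction n using Nat.strong_induction_on with
  | _ n ih =>
    intro z m 𝒰 τ h hn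
    obtain ⟨B, hB, hpos, hcut, htight⟩ := h.exists_tree
    -- The reserves that limit ε: edge weights, slacks of the rank constraints, remaining prefix
    -- weights τ, and m. Below, `b` is their consumption per unit of the tree. Irrelevant indices
    -- have reserve and consumption 0.
    let a : Edge V ⊕ Set V ⊕ Set V ⊕ Unit → ℝ := Sum.elim z (Sum.elim
      (fun X => if X.Nonempty then m * (X.ncard - 1) - xin z X else 0)
      (Sum.elim (fun U => if U ∈ 𝒰 then τ U else 0) fun _ => m))
    let b : Edge V ⊕ Set V ⊕ Set V ⊕ Unit → ℝ := Sum.elim (incidence B) (Sum.elim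
      (fun X => if X.Nonempty then (X.ncard - 1) - ((B ∩ inside X).card : ℝ) else 0)
      (Sum.elim (fun U => if U ∈ 𝒰 then 1 else 0) fun _ => 1))
    have ha : ∀ i, 0 ≤ a i := by
      rintro (e | X | U | _)
      · exact h.nonneg e
      · simp only [a, Sum.elim_inr, Sum.elim_inl]
        split_ifs with hX
        · linarith [h.le X hX]
        · exact le_rfl
      · simp only [a, Sum.elim_inr, Sum.elim_inl]
        split_ifs with hU
        · exact (h.τ_pos U hU).le
        · exact le_rfl
      · exact h.pos.le
    have hab : ∀ i, 0 < b i → 0 < a i := by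
      rintro (e | X | U | _)
      · simp only [a, b, Sum.elim_inl, incidence]
        split_ifs with he
        · exact fun _ => hpos e he
        · exact fun h => absurd h (lt_irrefl _)
      · simp only [a, b, Sum.elim_inr, Sum.elim_inl]
        split_ifs with hX
        · intro hb
          rcases (h.le X hX).eq_or_lt with heq | hlt
          · have h1 := htight X hX heq
            have h2 : ((B ∩ inside X).card : ℝ) + 1 = X.ncard := by exact_mod_cast h1
            linarith
          · linarith
        · exact fun h => absurd h (lt_irrefl _)
      · simp only [a, b, Sum.elim_inr, Sum.elim_inl]
        split_ifs with hU
        · exact fun _ => h.τ_pos U hU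
        · exact fun h => absurd h (lt_irrefl _)
      · exact fun _ => h.pos
    obtain ⟨ε, hε, hle, i, hbi, hi⟩ := exists_max_step a b ha hab
      ⟨Sum.inr (Sum.inr (Sum.inr ())), by simp [b]⟩
    have hεz : ∀ e, ε * incidence B e ≤ z e := fun e => hle (Sum.inl e)
    have hεX : ∀ X : Set V, X.Nonempty →
        ε * ((X.ncard - 1) - ((B ∩ inside X).card : ℝ)) ≤ m * (X.ncard - 1) - xin z X := by
      intro X hX
      have := hle (Sum.inr (Sum.inl X))
      simpa only [a, b, Sum.elim_inr, Sum.elim_inl, if_pos hX] using this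
    have hετ : ∀ U ∈ 𝒰, ε ≤ τ U := by
      intro U hU
      have := hle (Sum.inr (Sum.inr (Sum.inl U)))
      simpa only [a, b, Sum.elim_inr, Sum.elim_inl, if_pos hU, mul_one] using this
    have hεm : ε ≤ m := by
      have := hle (Sum.inr (Sum.inr (Sum.inr ())))
      simpa only [a, b, Sum.elim_inr, mul_one] using this
    have hxin' : ∀ X, xin (fun e => z e - ε * incidence B e) X =
        xin z X - ε * (B ∩ inside X).card := by
      intro X
      simp only [xin, Finset.sum_sub_distrib, ← Finset.mul_sum, sum_incidence]
    have huniv : ((B ∩ inside Set.univ).card : ℝ) = (Set.univ : Set V).ncard - 1 := by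
      have := hB.card_add_one
      rw [inside_univ, Finset.inter_univ, Set.ncard_univ, Nat.card_eq_fintype_card, ← this]
      push_cast; ring
    refine HasLayeredDecomposition.cons hB hcut hε hετ ?_
    rcases hεm.eq_or_lt with heq | hlt
    · subst heq
      -- When ε = m the nonnegative remainder has total weight zero, so this tree finishes the
      -- decomposition.
      have hz0 : ∀ e, z e - ε * incidence B e = 0 := by
        have h1 := hxin' Set.univ
        rw [h.total, huniv, sub_self] at h1
        simp only [xin, inside_univ] at h1
        intro e
        exact (Finset.sum_eq_zero_iff_of_nonneg fun e _ => sub_nonneg.2 (hεz e)).1 h1 e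
          (Finset.mem_univ _)
      refine ⟨0, Fin.elim0, Fin.elim0, fun j => j.elim0, fun j => j.elim0, by simp, ?_, ?_⟩
      · intro e; simpa using hz0 e
      · rintro U ⟨hU, hlt⟩
        exact absurd (h.τ_le U hU) (not_le.2 hlt)
    · have hsides : ∀ U ∈ 𝒰, ((B ∩ inside U).card : ℝ) = U.ncard - 1 ∧
          ((B ∩ inside Uᶜ).card : ℝ) = Uᶜ.ncard - 1 := by
        intro U hU
        obtain ⟨h1, h2⟩ := hB.card_inter_inside_of_cut (h.nonempty U hU) (h.compl_nonempty U hU)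
          (hcut U hU)
        rw [← h1, ← h2]; push_cast; exact ⟨by ring, by ring⟩
      have hstate : LayeredState (fun e => z e - ε * incidence B e) (m - ε) {U ∈ 𝒰 | ε < τ U}
          fun U => τ U - ε :=
        { pos := by linarith
          nonneg := fun e => sub_nonneg.2 (hεz e)
          total := by rw [hxin', h.total, huniv]; ring
          le := fun X hX => by
            rw [hxin']
            have := hεX X hX
            linarith
          chain := fun U hU W hW => h.chain U hU.1 W hW.1
          nonempty := fun U hU => h.nonempty U hU.1
          compl_nonempty := fun U hU => h.compl_nonempty U hU.1
          τ_pos := fun U hU => sub_pos.2 hU.2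
          τ_le := fun U hU => by have := h.τ_le U hU.1; linarith
          xin_eq := fun U hU => by
            rw [hxin', h.xin_eq U hU.1, (hsides U hU.1).1]; ring
          xin_compl_eq := fun U hU => by
            rw [hxin', h.xin_compl_eq U hU.1, (hsides U hU.1).2]; ring }
      refine ih _ ?_ hstate rfl
      rw [← hn]
      have inc_nonneg : ∀ e, 0 ≤ incidence B e := fun e => by
        simp only [incidence]; split_ifs <;> norm_num
      have s1 : {e | 0 < z e - ε * incidence B e} ⊆ {e | 0 < z e} := by
        intro e he
        have h1 : 0 < z e - ε * incidence B e := he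
        have := mul_nonneg hε.le (inc_nonneg e)
        show 0 < z e
        linarith
      -- Tight sets stay tight, as the tree attains its rank on them.
      have s2 : {X : Set V | X.Nonempty ∧ xin (fun e => z e - ε * incidence B e) X <
          (m - ε) * (X.ncard - 1)} ⊆ {X : Set V | X.Nonempty ∧ xin z X < m * (X.ncard - 1)} := by
        rintro X ⟨hX, hlt'⟩
        refine ⟨hX, lt_of_le_of_ne (h.le X hX) fun heq => ?_⟩
        rw [hxin', heq] at hlt'
        have h2 : ((B ∩ inside X).card : ℝ) + 1 = X.ncard := by exact_mod_cast htight X hX heq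
        rw [← h2] at hlt'
        linarith
      have s3 : {U ∈ 𝒰 | ε < τ U} ⊆ 𝒰 := fun U hU => hU.1
      have l1 := Set.ncard_le_ncard s1 (Set.toFinite _)
      have l2 := Set.ncard_le_ncard s2 (Set.toFinite _)
      have l3 := Set.ncard_le_ncard s3 (Set.toFinite _)
      unfold LayeredState.potential
      beta_reduce
      rcases i with e | X | U | _
      · simp only [a, b, Sum.elim_inl] at hbi hi
        have heB : e ∈ B := by
          by_contra hne
          simp [incidence, hne] at hbi
        have : {e | 0 < z e - ε * incidence B e}.ncard < {e | 0 < z e}.ncard := by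
          refine Set.ncard_lt_ncard ⟨s1, fun hss => ?_⟩ (Set.toFinite _)
          have h1 : 0 < z e - ε * incidence B e := hss (show e ∈ {e | 0 < z e} from hpos e heB)
          linarith
        omega
      · have hXne : X.Nonempty := by
          by_contra hne
          simp [b, hne] at hbi
        simp only [a, b, Sum.elim_inr, Sum.elim_inl, if_pos hXne] at hbi hi
        have : {X : Set V | X.Nonempty ∧ xin (fun e => z e - ε * incidence B e) X <
            (m - ε) * (X.ncard - 1)}.ncard <
            {X : Set V | X.Nonempty ∧ xin z X < m * (X.ncard - 1)}.ncard := by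
          refine Set.ncard_lt_ncard ⟨s2, fun hss => ?_⟩ (Set.toFinite _)
          have hp := mul_pos hε hbi
          have h1 : X ∈ {X : Set V | X.Nonempty ∧ xin z X < m * (X.ncard - 1)} :=
            ⟨hXne, by linarith⟩
          have h2 := (hss h1).2
          rw [hxin'] at h2
          linarith
        omega
      · have hU : U ∈ 𝒰 := by
          by_contra hne
          simp [b, hne] at hbi
        simp only [a, b, Sum.elim_inr, Sum.elim_inl, if_pos hU, mul_one] at hi
        have : {U ∈ 𝒰 | ε < τ U}.ncard < 𝒰.ncard := by
          refine Set.ncard_lt_ncard ⟨s3, fun hss => ?_⟩ (Set.toFinite _)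
          have h2 : ε < τ U := (hss hU).2
          linarith
        omega
      · simp only [a, b, Sum.elim_inr, mul_one] at hi
        linarith

end STPathTSP

end

noncomputable section

namespace STPathTSP

variable {V : Type u} [Fintype V] {s t : V} {x : Edge V → ℝ}

/-! ### The linear program -/

-- The handshake identity with degree 2 everywhere except degree 1 at s and t. It translates cut
-- weights into the language of the spanning tree polytope.
open Classical in
lemma LPFeasible.xin_eq (hx : LPFeasible s t x) (hst : s ≠ t) (X : Set V) :
    xin x X = X.ncard - ((if s ∈ X then 1 else 0) + (if t ∈ X then 1 else 0) +
      ∑ e ∈ cut X, x e) / 2 := by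
  have h1 := sum_cut_singleton x X
  have h2 : ∀ v, ∑ e ∈ cut {v}, x e = 2 - (if v = s then 1 else 0) - (if v = t then 1 else 0) := by
    intro v
    by_cases hs : v = s
    · subst hs; rw [hx.degree_source]; simp [hst]; norm_num
    · by_cases ht : v = t
      · subst ht; rw [hx.degree_target]; simp [hs]; norm_num
      · rw [hx.degree_inner v hs ht]; simp [hs, ht]
  simp only [h2, Finset.sum_sub_distrib, Finset.sum_ite_eq', Finset.mem_filter, Finset.mem_univ,
    true_and, Finset.sum_const, nsmul_eq_mul] at h1
  have h3 : ((Finset.univ.filter (· ∈ X)).card : ℝ) = X.ncard := by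
    rw [Set.ncard_eq_toFinset_card' X]
    congr 2
    ext; simp
  rw [h3] at h1
  simp only [xin]
  push_cast at h1
  linarith

lemma LPFeasible.inTreePolytope (hx : LPFeasible s t x) (hst : s ≠ t) : InTreePolytope x where
  nonneg := hx.nonneg
  total := by rw [hx.xin_eq hst]; simp
  le X hX := by
    rw [hx.xin_eq hst]
    by_cases hs : s ∈ X <;> by_cases ht : t ∈ X <;> simp only [hs, ht, if_true, if_false]
    · by_cases hX' : Xᶜ.Nonempty
      · have := hx.two_le Xᶜ hX' (by simpa using hs) (by simpa using ht)
        rw [cut_compl] at this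
        linarith
      · rw [Set.not_nonempty_iff_eq_empty, Set.compl_empty_iff] at hX'
        subst hX'
        rw [cut_univ, Finset.sum_empty]; linarith
    · have := hx.one_le X hs ht
      linarith
    · have := hx.one_le Xᶜ hs (by simpa using ht)
      rw [cut_compl] at this
      linarith
    · have := hx.two_le X hX hs ht
      linarith

lemma mem_narrowCuts {C : Finset (Edge V)} : C ∈ narrowCuts s t x ↔
    (∃ U : Set V, s ∈ U ∧ t ∉ U ∧ C = cut U) ∧ ∑ e ∈ C, x e < 2 := by
  simp [narrowCuts]

open Classical in
lemma sum_cut_sdiff_le (hx : ∀ e, 0 ≤ x e) (U W : Set V) :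
    ∑ e ∈ cut (U \ W), x e + ∑ e ∈ cut (W \ U), x e ≤ ∑ e ∈ cut U, x e + ∑ e ∈ cut W, x e := by
  simp only [sum_finset_eq_ite x]
  simp only [← Finset.sum_add_distrib]
  refine Finset.sum_le_sum fun e _ => ?_
  have := hx e
  obtain ⟨a, b, h, rfl⟩ := e.exists_mkEdge
  simp only [mkEdge_mem_cut, Set.mem_sdiff]
  by_cases ha : a ∈ U <;> by_cases hb : b ∈ U <;> by_cases ha' : a ∈ W <;>
    by_cases hb' : b ∈ W <;> simp [ha, hb, ha', hb', this]

/-- If U and W crossed, U \ W and W \ U would be nonempty sets without s and t, with cut weights of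
total at least 4; but the two narrow cuts together have weight less than 4. -/
lemma LPFeasible.narrow_chain (hx : LPFeasible s t x) {U W : Set V} (hU : s ∈ U) (hU' : t ∉ U)
    (hU2 : ∑ e ∈ cut U, x e < 2) (hW : s ∈ W) (hW' : t ∉ W) (hW2 : ∑ e ∈ cut W, x e < 2) :
    U ⊆ W ∨ W ⊆ U := by
  by_contra! hno
  obtain ⟨h1, h2⟩ := hno
  rw [Set.not_subset] at h1 h2
  obtain ⟨a, ha, ha'⟩ := h1
  obtain ⟨b, hb, hb'⟩ := h2
  have h3 := hx.two_le (U \ W) ⟨a, ha, ha'⟩ (fun h => h.2 hW) (fun h => hU' h.1)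
  have h4 := hx.two_le (W \ U) ⟨b, hb, hb'⟩ (fun h => h.2 hU) (fun h => hW' h.1)
  have h5 := sum_cut_sdiff_le hx.nonneg U W
  linarith

/-- With m = 1 and τ equal to the slack of the cut, each side of a narrow cut has deficit (x(C) -
1)/2 = (1 - τ)/2, as a layered state demands. -/
theorem LPFeasible.nonempty_gvDecomposition (hx : LPFeasible s t x) (hst : s ≠ t) :
    Nonempty (GVDecomposition s t x) := by
  have : Nonempty V := ⟨s⟩
  have htp := hx.inTreePolytope hst
  have hstate : LayeredState x 1 {U | s ∈ U ∧ t ∉ U ∧ ∑ e ∈ cut U, x e < 2}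
      fun U => 2 - ∑ e ∈ cut U, x e :=
    { pos := one_pos
      nonneg := hx.nonneg
      total := by rw [htp.total, one_mul]
      le := fun X hX => by rw [one_mul]; exact htp.le X hX
      chain := fun U hU W hW => hx.narrow_chain hU.1 hU.2.1 hU.2.2 hW.1 hW.2.1 hW.2.2
      nonempty := fun U hU => ⟨s, hU.1⟩
      compl_nonempty := fun U hU => ⟨t, hU.2.1⟩
      τ_pos := fun U hU => sub_pos.2 hU.2.2
      τ_le := fun U hU => by have := hx.one_le U hU.1 hU.2.1; linarith
      xin_eq := fun U hU => by
        rw [hx.xin_eq hst]; simp only [hU.1, hU.2.1, if_true, if_false]; ring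
      xin_compl_eq := fun U hU => by
        rw [hx.xin_eq hst, cut_compl]
        simp only [Set.mem_compl_iff, hU.1, hU.2.1, if_true, if_false, not_true, not_false_eq_true]
        ring }
  obtain ⟨k, S, p, hS, hp, hsum, hz, hU⟩ := hstate.hasLayeredDecomposition _ rfl
  exact ⟨{
    k := k
    S := S
    p := p
    isSpanningTree := hS
    p_nonneg := hp
    p_sum := hsum
    eq_sum := hz
    narrow := fun C hC => by
      obtain ⟨⟨U, hs, ht, rfl⟩, h2⟩ := mem_narrowCuts.1 hC
      exact hU U ⟨hs, ht, h2⟩ }⟩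

/-- The total weight of the edges inside `X` that cross no member of a chain of proper subsets. -/
lemma InTreePolytope.sum_noncrossing_le (hx : InTreePolytope x) : ∀ (n : ℕ) (𝒲 : Finset (Set V))
    (X : Set V), 𝒲.card = n → X.Nonempty → (∀ U ∈ 𝒲, U.Nonempty ∧ U ⊂ X) →
    (∀ U ∈ 𝒲, ∀ W ∈ 𝒲, U ⊆ W ∨ W ⊆ U) →
    (open Classical in ∑ e ∈ (inside X).filter (fun e => ∀ W ∈ 𝒲, e ∉ cut W), x e) ≤
      X.ncard - 1 - n := by
  classical
  intro n
  induction n with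
  | zero =>
    intro 𝒲 X h0 hX _ _
    rw [Finset.card_eq_zero] at h0
    subst h0
    have := hx.le X hX
    simpa [xin] using this
  | succ n ih =>
    intro 𝒲 X hn hX hsub hchain
    obtain ⟨U, hU, hmax⟩ := 𝒲.exists_max_image Set.ncard (Finset.card_pos.1 (by omega))
    have hlt : ∀ W ∈ 𝒲.erase U, W ⊂ U := by
      intro W hW
      obtain ⟨hne, hW⟩ := Finset.mem_erase.1 hW
      rcases hchain W hW U hU with h | h
      · exact h.ssubset_of_ne hne
      · exact absurd (Set.eq_of_subset_of_ncard_le h (hmax W hW) (Set.toFinite _)).symm hne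
    have hIH := ih (𝒲.erase U) U (by rw [Finset.card_erase_of_mem hU]; omega) (hsub U hU).1
      (fun W hW => ⟨(hsub W (Finset.mem_of_mem_erase hW)).1, hlt W hW⟩)
      (fun W hW W' hW' => hchain W (Finset.mem_of_mem_erase hW) W' (Finset.mem_of_mem_erase hW'))
    have hUX := (hsub U hU).2
    have h1 := hx.le (X \ U) (Set.nonempty_of_ssubset hUX)
    -- U is the largest member, so X splits into the layer X \ U and U with a shorter chain. Each of
    -- the n + 1 layers contributes at most its size minus one.
    have h2 : (inside X).filter (fun e => ∀ W ∈ 𝒲, e ∉ cut W) ⊆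
        (inside U).filter (fun e => ∀ W ∈ 𝒲.erase U, e ∉ cut W) ∪ inside (X \ U) := by
      intro e he
      obtain ⟨he1, he2⟩ := Finset.mem_filter.1 he
      rw [Finset.mem_union, Finset.mem_filter]
      have he3 := he2 U hU
      obtain ⟨a, b, hab, rfl⟩ := e.exists_mkEdge
      simp only [mkEdge_mem_inside, mkEdge_mem_cut, Set.mem_sdiff] at he1 he3 ⊢
      by_cases ha : a ∈ U
      · exact Or.inl ⟨⟨ha, by tauto⟩, fun W hW => by
          have := he2 W (Finset.mem_of_mem_erase hW)
          rwa [mkEdge_mem_cut] at this⟩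
      · exact Or.inr ⟨⟨he1.1, ha⟩, he1.2, by tauto⟩
    have h3 := Finset.sum_le_sum_of_subset_of_nonneg (f := x) h2 fun e _ _ => hx.nonneg e
    have h4 := Finset.sum_union_inter (f := x)
      (s₁ := (inside U).filter (fun e => ∀ W ∈ 𝒲.erase U, e ∉ cut W)) (s₂ := inside (X \ U))
    have h5 := hx.sum_nonneg ((inside U).filter (fun e => ∀ W ∈ 𝒲.erase U, e ∉ cut W) ∩
      inside (X \ U))
    have h6 : ((X \ U).ncard : ℝ) + U.ncard = X.ncard := by
      exact_mod_cast ncard_sdiff_add hUX.subset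
    simp only [xin] at h1
    push_cast
    linarith

/-- Distinct narrow cuts have total weight at least their number. -/
lemma LPFeasible.card_le_sum_biUnion (hx : LPFeasible s t x) (hst : s ≠ t)
    {L : Finset (Finset (Edge V))} (hL : L ⊆ narrowCuts s t x) :
    (L.card : ℝ) ≤ ∑ e ∈ L.biUnion id, x e := by
  classical
  have hL' : ∀ C ∈ L, ∃ U : Set V, s ∈ U ∧ t ∉ U ∧ C = cut U ∧ ∑ e ∈ C, x e < 2 := by
    intro C hC
    obtain ⟨⟨U, h1, h2, h3⟩, h4⟩ := mem_narrowCuts.1 (hL hC)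
    exact ⟨U, h1, h2, h3, h4⟩
  choose! U hU using hL'
  have htp := hx.inTreePolytope hst
  have hinj : Set.InjOn U L := by
    intro C hC D hD h
    rw [(hU C hC).2.2.1, (hU D hD).2.2.1, h]
  have h1 := htp.sum_noncrossing_le _ (L.image U) Set.univ rfl ⟨s, Set.mem_univ s⟩ (by
      intro W hW
      obtain ⟨C, hC, rfl⟩ := Finset.mem_image.1 hW
      refine ⟨⟨s, (hU C hC).1⟩, Set.ssubset_univ_iff.2 fun h => (hU C hC).2.1 ?_⟩
      rw [h]; trivial) (by
      intro W hW W' hW'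
      obtain ⟨C, hC, rfl⟩ := Finset.mem_image.1 hW
      obtain ⟨D, hD, rfl⟩ := Finset.mem_image.1 hW'
      have hCU := hU C hC
      have hDU := hU D hD
      exact hx.narrow_chain hCU.1 hCU.2.1 (by rw [← hCU.2.2.1]; exact hCU.2.2.2)
        hDU.1 hDU.2.1 (by rw [← hDU.2.2.1]; exact hDU.2.2.2))
  rw [Finset.card_image_of_injOn hinj] at h1
  have h2 : (inside (Set.univ : Set V)).filter (fun e => ∀ W ∈ L.image U, e ∉ cut W) =
      Finset.univ \ L.biUnion id := by
    ext e
    simp only [inside_univ, Finset.mem_filter, Finset.mem_univ, true_and, Finset.mem_image,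
      forall_exists_index, and_imp, forall_apply_eq_imp_iff₂, Finset.mem_sdiff, Finset.mem_biUnion,
      id, not_exists, not_and]
    exact forall₂_congr fun C hC => by rw [← (hU C hC).2.2.1]
  rw [h2] at h1
  have h3 := Finset.sum_sdiff (f := x) (Finset.subset_univ (L.biUnion id))
  have h4 := htp.total
  simp only [xin, inside_univ] at h4
  linarith

/-- Subtract the least value c C₀ from all members and induct. The left side loses |L| times this
value, and the right side loses at least this value on the whole union of L, whose x-weight is at
least |L|. -/
lemma sum_le_sum_mul_fold_max (hx : ∀ e, 0 ≤ x e) : ∀ (n : ℕ) (L : Finset (Finset (Edge V)))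
    (c : Finset (Edge V) → ℝ), L.card = n →
    (∀ L' ⊆ L, (L'.card : ℝ) ≤ ∑ e ∈ L'.biUnion id, x e) → (∀ C ∈ L, 0 ≤ c C) →
    ∑ C ∈ L, c C ≤ ∑ e, x e * (L.filter (e ∈ ·)).fold max 0 c := by
  classical
  intro n
  induction n with
  | zero =>
    intro L c h0 _ _
    rw [Finset.card_eq_zero] at h0
    subst h0
    simp
  | succ n ih =>
    intro L c hn hcov hc
    obtain ⟨C₀, hC₀, hmin⟩ := L.exists_min_image c (Finset.card_pos.1 (by omega))
    have hcard : (L.erase C₀).card = n := by rw [Finset.card_erase_of_mem hC₀]; omega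
    have hIH := ih (L.erase C₀) (fun C => c C - c C₀) hcard
      (fun L' hL' => hcov L' (hL'.trans (Finset.erase_subset _ _)))
      (fun C hC => sub_nonneg.2 (hmin C (Finset.mem_of_mem_erase hC)))
    have hpt : ∀ e, (if e ∈ L.biUnion id then c C₀ else 0) +
        ((L.erase C₀).filter (e ∈ ·)).fold max 0 (fun C => c C - c C₀) ≤
        (L.filter (e ∈ ·)).fold max 0 c := by
      intro e
      by_cases he : e ∈ L.biUnion id
      · rw [if_pos he]
        obtain ⟨C, hC, heC⟩ := Finset.mem_biUnion.1 he
        have h1 : c C₀ ≤ (L.filter (e ∈ ·)).fold max 0 c :=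
          (Finset.le_fold_max _).2 (Or.inr ⟨C, Finset.mem_filter.2 ⟨hC, heC⟩, hmin C hC⟩)
        have h2 : ((L.erase C₀).filter (e ∈ ·)).fold max 0 (fun C => c C - c C₀) ≤
            (L.filter (e ∈ ·)).fold max 0 c - c C₀ := by
          rw [Finset.fold_max_le]
          refine ⟨by linarith, fun D hD => ?_⟩
          obtain ⟨hD, heD⟩ := Finset.mem_filter.1 hD
          have : c D ≤ (L.filter (e ∈ ·)).fold max 0 c :=
            (Finset.le_fold_max _).2 (Or.inr ⟨D, Finset.mem_filter.2
              ⟨Finset.mem_of_mem_erase hD, heD⟩, le_rfl⟩)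
          linarith
        linarith
      · rw [if_neg he, zero_add]
        have h1 : (L.erase C₀).filter (e ∈ ·) = ∅ := by
          rw [Finset.filter_eq_empty_iff]
          intro C hC heC
          exact he (Finset.mem_biUnion.2 ⟨C, Finset.mem_of_mem_erase hC, heC⟩)
        rw [h1, Finset.fold_empty, Finset.le_fold_max]
        exact Or.inl le_rfl
    have h1 : ∑ e, x e * ((if e ∈ L.biUnion id then c C₀ else 0) +
        ((L.erase C₀).filter (e ∈ ·)).fold max 0 (fun C => c C - c C₀)) ≤
        ∑ e, x e * (L.filter (e ∈ ·)).fold max 0 c :=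
      Finset.sum_le_sum fun e _ => mul_le_mul_of_nonneg_left (hpt e) (hx e)
    simp only [mul_add, Finset.sum_add_distrib, mul_ite, mul_zero] at h1
    rw [Finset.sum_ite_mem, Finset.univ_inter, ← Finset.sum_mul] at h1
    rw [Finset.sum_sub_distrib, Finset.sum_const, hcard, nsmul_eq_mul] at hIH
    have h2 := hcov L subset_rfl
    rw [hn] at h2
    have h3 := Finset.add_sum_erase L c hC₀
    have h4 := mul_le_mul_of_nonneg_right h2 (hc C₀ hC₀)
    push_cast at h4
    linarith

/-! ### Existence of an optimum solution -/

open Classical in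
lemma sum_cut_lift {g : V → V → ℝ} (hg : ∀ a b, g a b = g b a) (U : Set V) :
    ∑ e ∈ cut U, Sym2.lift ⟨g, hg⟩ e.1 = ∑ u with u ∈ U, ∑ v with v ∈ Uᶜ, g u v := by
  rw [← Finset.sum_product']
  symm
  have hne : ∀ q ∈ (Finset.univ.filter (· ∈ U)) ×ˢ (Finset.univ.filter (· ∈ Uᶜ)), q.1 ≠ q.2 := by
    rintro ⟨a, b⟩ hq h
    simp only [Finset.mem_product, Finset.mem_filter, Finset.mem_univ, true_and] at hq
    obtain rfl : a = b := h
    exact hq.2 hq.1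
  refine Finset.sum_bij (fun q hq => mkEdge q.1 q.2 (hne q hq)) ?_ ?_ ?_ ?_
  · rintro ⟨a, b⟩ hq
    simp only [Finset.mem_product, Finset.mem_filter, Finset.mem_univ, true_and,
      Set.mem_compl_iff] at hq
    simp [hq.1, hq.2]
  · rintro ⟨a, b⟩ hq ⟨a', b'⟩ hq' h
    simp only [Finset.mem_product, Finset.mem_filter, Finset.mem_univ, true_and,
      Set.mem_compl_iff] at hq hq'
    have h' : s(a, b) = s(a', b') := congrArg Subtype.val h
    rcases Sym2.eq_iff.1 h' with ⟨rfl, rfl⟩ | ⟨rfl, rfl⟩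
    · rfl
    · exact absurd hq.1 hq'.2
  · intro e he
    obtain ⟨a, ha, b, hb, h⟩ := mem_cut_iff.1 he
    exact ⟨(a, b), by simp [ha, hb], Subtype.ext h.symm⟩
  · intro q hq
    rfl

/-- For at least three vertices let a be 1/2 at s and t and 1 elsewhere, and k = |V| - 2. Spreading
2 a_u a_v / k over the edges and then removing the weight 1/(2k) of the edge st meets all
constraints. Two vertices make k = 0 and are treated separately. -/
lemma exists_lpFeasible (hst : s ≠ t) : ∃ x, LPFeasible s t x := by
  classical
  by_cases hcard : Fintype.card V = 2
  · have hV : ∀ v, v = s ∨ v = t := by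
      intro v
      by_contra! h
      have h1 : ({v, s, t} : Finset V).card ≤ Fintype.card V := Finset.card_le_univ _
      rw [Finset.card_insert_of_notMem (by simp [h.1, h.2]), Finset.card_pair hst] at h1
      omega
    have hone : ∀ U : Set V, (s ∈ U ↔ t ∉ U) → ∑ e ∈ cut U, (1 : ℝ) = 1 := by
      intro U hU
      have : cut U = {mkEdge s t hst} := by
        ext e
        obtain ⟨a, b, hab, rfl⟩ := e.exists_mkEdge
        rw [mkEdge_mem_cut, Finset.mem_singleton]
        have h1 : mkEdge a b hab = mkEdge s t hst := by
          apply Subtype.ext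
          show s(a, b) = s(s, t)
          rcases hV a with rfl | rfl <;> rcases hV b with rfl | rfl
          · exact absurd rfl hab
          · rfl
          · exact Sym2.eq_swap
          · exact absurd rfl hab
        simp only [h1, iff_true]
        rcases hV a with rfl | rfl <;> rcases hV b with rfl | rfl
        · exact absurd rfl hab
        · tauto
        · tauto
        · exact absurd rfl hab
      rw [this]; simp
    refine ⟨fun _ => 1, ?_, ?_, ?_, ?_, ?_, fun _ => zero_le_one⟩
    · rintro U ⟨v, hv⟩ hs ht
      rcases hV v with rfl | rfl
      · exact absurd hv hs
      · exact absurd hv ht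
    · intro U hs ht
      rw [hone U (by simp [hs, ht])]
    · intro v h1 h2
      rcases hV v with rfl | rfl
      · exact absurd rfl h1
      · exact absurd rfl h2
    · exact hone _ (by simp [hst.symm])
    · exact hone _ (by simp [hst])
  · set k : ℝ := (Fintype.card V : ℝ) - 2 with hk
    have hk1 : 1 ≤ k := by
      have h1 : ({s, t} : Finset V).card ≤ Fintype.card V := Finset.card_le_univ _
      rw [Finset.card_pair hst] at h1
      have h2 : 3 ≤ Fintype.card V := by omega
      have : (3 : ℝ) ≤ Fintype.card V := by exact_mod_cast h2
      linarith
    have hk0 : 0 < k := by linarith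
    let a : V → ℝ := fun v => 1 - (if v = s then 1 / 2 else 0) - (if v = t then 1 / 2 else 0)
    have as : a s = 1 / 2 := by simp [a, hst]; norm_num
    have at' : a t = 1 / 2 := by simp [a, hst.symm]; norm_num
    have ai : ∀ v, v ≠ s → v ≠ t → a v = 1 := fun v h1 h2 => by simp [a, h1, h2]
    have a0 : ∀ v, 0 ≤ a v := by
      intro v
      by_cases h1 : v = s
      · subst h1; rw [as]; norm_num
      · by_cases h2 : v = t
        · subst h2; rw [at']; norm_num
        · rw [ai v h1 h2]; norm_num
    let m : Set V → ℝ := fun U => ∑ v with v ∈ U, a v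
    have mtot : ∀ U, m U + m Uᶜ = k + 1 := by
      intro U
      simp only [m, Set.mem_compl_iff]
      rw [Finset.sum_filter_add_sum_filter_not]
      simp only [a, Finset.sum_sub_distrib, Finset.sum_ite_eq', Finset.mem_univ, if_true,
        Finset.sum_const, Finset.card_univ, nsmul_eq_mul, hk]
      ring
    have mmono : ∀ (F : Finset V) (U : Set V), (∀ v ∈ F, v ∈ U) → ∑ v ∈ F, a v ≤ m U := by
      intro F U hF
      exact Finset.sum_le_sum_of_subset_of_nonneg (fun v hv => by simpa using hF v hv)
        fun v _ _ => a0 v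
    have msing : ∀ v, m {v} = a v := by
      intro v
      have : (Finset.univ.filter (· ∈ ({v} : Set V))) = {v} := by ext; simp
      change ∑ w with w ∈ ({v} : Set V), a w = a v
      rw [this, Finset.sum_singleton]
    let g : V → V → ℝ := fun u v => 2 / k * (a u * a v) -
      ((if u = s then 1 else 0) * (if v = t then 1 else 0) +
       (if u = t then 1 else 0) * (if v = s then 1 else 0)) * (1 / (2 * k))
    have hg : ∀ u v, g u v = g v u := fun u v => by simp only [g]; ring
    have hsum : ∀ U, ∑ e ∈ cut U, Sym2.lift ⟨g, hg⟩ e.1 = 2 / k * (m U * (k + 1 - m U)) -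
        ((if s ∈ U then 1 else 0) * (if t ∈ Uᶜ then 1 else 0) +
         (if t ∈ U then 1 else 0) * (if s ∈ Uᶜ then 1 else 0)) * (1 / (2 * k)) := by
      intro U
      rw [sum_cut_lift hg, show k + 1 - m U = m Uᶜ by rw [← mtot U]; ring]
      simp only [g, Finset.sum_sub_distrib, ← Finset.mul_sum, ← Finset.sum_mul,
        Finset.sum_add_distrib, Finset.sum_ite_eq', Finset.mem_filter, Finset.mem_univ, true_and]
      congr!
    -- The cut weights are written as the required minimum plus a product, nonnegative because both
    -- sides contain their prescribed terminals or inner vertices.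
    have hsep : ∀ U : Set V, (s ∈ U ∧ t ∉ U) ∨ (t ∈ U ∧ s ∉ U) →
        ∑ e ∈ cut U, Sym2.lift ⟨g, hg⟩ e.1 = 1 + 2 * ((m U - 1 / 2) * (k + 1 / 2 - m U)) / k := by
      intro U hU
      rw [hsum]
      have : ((if s ∈ U then (1 : ℝ) else 0) * (if t ∈ Uᶜ then 1 else 0) +
         (if t ∈ U then 1 else 0) * (if s ∈ Uᶜ then 1 else 0)) = 1 := by
        rcases hU with ⟨h1, h2⟩ | ⟨h1, h2⟩ <;> simp [h1, h2]
      rw [this]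
      field_simp
      ring
    have hnsep : ∀ U : Set V, s ∉ U → t ∉ U →
        ∑ e ∈ cut U, Sym2.lift ⟨g, hg⟩ e.1 = 2 + 2 * ((m U - 1) * (k - m U)) / k := by
      intro U h1 h2
      rw [hsum]
      simp only [h1, h2, if_false, zero_mul, add_zero, sub_zero]
      field_simp
      ring
    refine ⟨fun e => Sym2.lift ⟨g, hg⟩ e.1, ?_, ?_, ?_, ?_, ?_, ?_⟩
    · rintro U ⟨v, hv⟩ hs ht
      rw [hnsep U hs ht]
      have h1 := mmono {v} U (by simpa using hv)
      rw [Finset.sum_singleton, ai v (by rintro rfl; exact hs hv) (by rintro rfl; exact ht hv)] at h1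
      have h2 := mmono {s, t} Uᶜ (by simp [hs, ht])
      rw [Finset.sum_pair hst, as, at'] at h2
      have h3 := mtot U
      have : 0 ≤ 2 * ((m U - 1) * (k - m U)) / k := by
        apply div_nonneg _ hk0.le
        have := mul_nonneg (sub_nonneg.2 h1) (show 0 ≤ k - m U by linarith)
        linarith
      linarith
    · intro U hs ht
      rw [hsep U (Or.inl ⟨hs, ht⟩)]
      have h1 := mmono {s} U (by simpa using hs)
      have h2 := mmono {t} Uᶜ (by simpa using ht)
      rw [Finset.sum_singleton, as] at h1
      rw [Finset.sum_singleton, at'] at h2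
      have h3 := mtot U
      have : 0 ≤ 2 * ((m U - 1 / 2) * (k + 1 / 2 - m U)) / k := by
        apply div_nonneg _ hk0.le
        have := mul_nonneg (sub_nonneg.2 h1) (show 0 ≤ k + 1 / 2 - m U by linarith)
        linarith
      linarith
    · intro v h1 h2
      rw [hnsep {v} (by simpa using h1.symm) (by simpa using h2.symm), msing, ai v h1 h2]; simp
    · rw [hsep {s} (Or.inl (by simp [hst.symm])), msing, as]; simp
    · rw [hsep {t} (Or.inr (by simp [hst])), msing, at']; simp
    · intro e
      obtain ⟨u, v, huv, rfl⟩ := e.exists_mkEdge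
      show 0 ≤ g u v
      simp only [g]
      have hpos := mul_nonneg (a0 u) (a0 v)
      by_cases h1 : (u = s ∧ v = t) ∨ (u = t ∧ v = s)
      · rcases h1 with ⟨rfl, rfl⟩ | ⟨rfl, rfl⟩
        · simp only [as, at', if_true, if_neg hst, if_neg hst.symm]
          apply le_of_eq; field_simp; norm_num
        · simp only [as, at', if_true, if_neg hst, if_neg hst.symm]
          apply le_of_eq; field_simp; norm_num
      · have h2 : ((if u = s then (1 : ℝ) else 0) * (if v = t then 1 else 0) +
            (if u = t then 1 else 0) * (if v = s then 1 else 0)) = 0 := by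
          by_cases c1 : u = s <;> by_cases c2 : v = t <;> by_cases c3 : u = t <;>
            by_cases c4 : v = s <;> simp_all
        rw [h2, zero_mul, sub_zero]
        positivity

lemma LPFeasible.le_two (hx : LPFeasible s t x) (e : Edge V) : x e ≤ 2 := by
  obtain ⟨a, b, hab, rfl⟩ := e.exists_mkEdge
  have h1 : x (mkEdge a b hab) ≤ ∑ e ∈ cut {a}, x e :=
    Finset.single_le_sum (f := x) (fun e _ => hx.nonneg e) (by simp [hab.symm])
  have h2 : ∑ e ∈ cut {a}, x e ≤ 2 := by
    by_cases hs : a = s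
    · subst hs; rw [hx.degree_source]; norm_num
    · by_cases ht : a = t
      · subst ht; rw [hx.degree_target]; norm_num
      · rw [hx.degree_inner a hs ht]
  linarith

lemma isClosed_lpFeasible : IsClosed {x : Edge V → ℝ | LPFeasible s t x} := by
  have hc : ∀ A : Finset (Edge V), Continuous fun x : Edge V → ℝ => ∑ e ∈ A, x e := fun A =>
    continuous_finsetSum _ fun e _ => continuous_apply e
  have : {x : Edge V → ℝ | LPFeasible s t x} =
      (⋂ (U : Set V) (_ : U.Nonempty) (_ : s ∉ U) (_ : t ∉ U), {x | 2 ≤ ∑ e ∈ cut U, x e}) ∩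
      (⋂ (U : Set V) (_ : s ∈ U) (_ : t ∉ U), {x | 1 ≤ ∑ e ∈ cut U, x e}) ∩
      (⋂ (v : V) (_ : v ≠ s) (_ : v ≠ t), {x | ∑ e ∈ cut {v}, x e = 2}) ∩
      {x | ∑ e ∈ cut {s}, x e = 1} ∩ {x | ∑ e ∈ cut {t}, x e = 1} ∩
      ⋂ e : Edge V, {x | 0 ≤ x e} := by
    ext x
    simp only [Set.mem_inter_iff, Set.mem_iInter]
    constructor
    · intro h
      exact ⟨⟨⟨⟨⟨h.two_le, h.one_le⟩, h.degree_inner⟩, h.degree_source⟩, h.degree_target⟩, h.nonneg⟩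
    · rintro ⟨⟨⟨⟨⟨h1, h2⟩, h3⟩, h4⟩, h5⟩, h6⟩
      exact ⟨h1, h2, h3, h4, h5, h6⟩
  rw [this]
  refine ((((IsClosed.inter ?_ ?_).inter ?_).inter ?_).inter ?_).inter ?_
  · exact isClosed_iInter fun U => isClosed_iInter fun _ => isClosed_iInter fun _ =>
      isClosed_iInter fun _ => isClosed_le continuous_const (hc _)
  · exact isClosed_iInter fun U => isClosed_iInter fun _ => isClosed_iInter fun _ =>
      isClosed_le continuous_const (hc _)
  · exact isClosed_iInter fun U => isClosed_iInter fun _ => isClosed_iInter fun _ =>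
      isClosed_eq (hc _) continuous_const
  · exact isClosed_eq (hc _) continuous_const
  · exact isClosed_eq (hc _) continuous_const
  · exact isClosed_iInter fun e => isClosed_le continuous_const (continuous_apply e)

theorem exists_isLPOptimum [MetricSpace V] (hst : s ≠ t) : ∃ x : Edge V → ℝ, IsLPOptimum s t x := by
  have hcomp : IsCompact {x : Edge V → ℝ | LPFeasible s t x} := by
    refine IsCompact.of_isClosed_subset (isCompact_univ_pi fun _ : Edge V =>
      isCompact_Icc (a := (0 : ℝ)) (b := 2)) isClosed_lpFeasible ?_
    intro x hx
    rw [Set.mem_univ_pi]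
    exact fun e => ⟨LPFeasible.nonneg hx e, LPFeasible.le_two hx e⟩
  obtain ⟨x, hx, hmin⟩ := hcomp.exists_isMinOn (exists_lpFeasible hst)
    (f := fun x => lpCost x) (by
      unfold lpCost
      exact (continuous_finsetSum _ fun e _ =>
        continuous_const.mul (continuous_apply e)).continuousOn)
  exact ⟨x, hx, fun y hy => hmin hy⟩

end STPathTSP

end

noncomputable section

namespace STPathTSP

variable {V : Type u} [Fintype V] {s t : V}

/-! ### Eulerian walks -/

/-- The degree parities of a multiset of edges. -/
def mbd (D : Multiset (Edge V)) : V → ZMod 2 := (D.map fun e => bd {e}).sum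

lemma mbd_add (D E : Multiset (Edge V)) : mbd (D + E) = mbd D + mbd E := by
  simp [mbd]

lemma mbd_cons (e : Edge V) (D : Multiset (Edge V)) : mbd (e ::ₘ D) = bd {e} + mbd D := by
  simp [mbd]

lemma mbd_val (F : Finset (Edge V)) : mbd F.val = bd F := by
  induction F using Finset.induction_on with
  | empty => simp [mbd, bd_empty]
  | insert e F he ih =>
    rw [Finset.insert_val_of_notMem he, mbd_cons, ih, ← bd_symmDiff]
    congr 1
    rw [Finset.insert_eq]
    exact (Finset.disjoint_singleton_left.2 he).symmDiff_eq_sup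

/-- The edges of a walk in the complete graph. -/
def walkEdges : {u v : V} → (⊤ : SimpleGraph V).Walk u v → List (Edge V)
  | _, _, .nil => []
  | _, _, .cons h p => mkEdge _ _ h.ne :: walkEdges p

lemma map_val_walkEdges {u v : V} (W : (⊤ : SimpleGraph V).Walk u v) :
    (walkEdges W).map Subtype.val = W.edges := by
  induction W with
  | nil => rfl
  | cons h p ih => simp [walkEdges, ih, mkEdge]

lemma walkEdges_append {u v w : V} (W : (⊤ : SimpleGraph V).Walk u v)
    (Z : (⊤ : SimpleGraph V).Walk v w) : walkEdges (W.append Z) = walkEdges W ++ walkEdges Z := by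
  induction W with
  | nil => rfl
  | cons h p ih => simp [walkEdges, ih]

lemma mbd_walkEdges {u v : V} (W : (⊤ : SimpleGraph V).Walk u v) :
    mbd (walkEdges W : Multiset (Edge V)) = sing u + sing v := by
  induction W with
  | nil => simp [walkEdges, mbd, sing_add_self]
  | @cons u w v h p ih =>
    simp only [walkEdges]
    rw [← Multiset.cons_coe, mbd_cons, ih, bd_singleton]
    rw [show sing u + sing w + (sing w + sing v) = sing u + (sing w + sing w) + sing v by ring,
      sing_add_self, add_zero]

lemma mem_support_of_mem_walkEdges {u v : V} {W : (⊤ : SimpleGraph V).Walk u v} {e : Edge V}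
    (he : e ∈ walkEdges W) {a : V} (ha : a ∈ e.1) : a ∈ W.support := by
  have h : e.1 ∈ W.edges := by
    rw [← map_val_walkEdges]; exact List.mem_map_of_mem he
  exact W.mem_support_of_mem_edges h ha

/-- Walk greedily along unused edges. Removing the edge uw moves the odd end from u to w; when no
edge is left at the current vertex, parity forces it to be v. -/
lemma exists_walk_of_mbd (D : Multiset (Edge V)) {u v : V} (hD : mbd D = sing u + sing v) :
    ∃ W : (⊤ : SimpleGraph V).Walk u v, (walkEdges W : Multiset (Edge V)) ≤ D ∧
      ((∃ e ∈ D, u ∈ e.1) → walkEdges W ≠ []) := by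
  induction hn : Multiset.card D generalizing D u with
  | zero =>
    rw [Multiset.card_eq_zero] at hn
    subst hn
    have huv : u = v := by
      by_contra h
      have := congrFun hD u
      simp [mbd, sing, h] at this
    subst huv
    exact ⟨.nil, by simp [walkEdges], by simp⟩
  | succ n ih =>
    by_cases he : ∃ e ∈ D, u ∈ e.1
    · obtain ⟨e, heD, hue⟩ := he
      obtain ⟨D', rfl⟩ := Multiset.exists_cons_of_mem heD
      obtain ⟨w, hw⟩ := Sym2.mem_iff_exists.1 hue
      have huw : u ≠ w := by
        rintro rfl
        exact e.2 (by rw [hw]; simp)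
      obtain rfl : e = mkEdge u w huw := Subtype.ext hw
      have hD' : mbd D' = sing w + sing v := by
        rw [mbd_cons, bd_singleton] at hD
        have := congrArg (fun f => sing u + sing w + f) hD
        rw [← add_assoc, show sing u + sing w + (sing u + sing w) =
          (sing u + sing u) + (sing w + sing w) by ring, sing_add_self, sing_add_self, add_zero,
          zero_add, show sing u + sing w + (sing u + sing v) =
          (sing u + sing u) + (sing w + sing v) by ring, sing_add_self, zero_add] at this
        exact this
      obtain ⟨W, hW, -⟩ := ih D' hD' (by simpa using hn)
      refine ⟨.cons (by simpa using huw) W, ?_, by simp [walkEdges]⟩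
      simp only [walkEdges]
      rw [← Multiset.cons_coe]
      exact Multiset.cons_le_cons _ hW
    · have huv : u = v := by
        by_contra h
        have := congrFun hD u
        have h0 : mbd D u = 0 := by
          simp only [mbd]
          rw [Pi.multiset_sum_apply, Multiset.map_map]
          apply Multiset.sum_eq_zero
          intro z hz
          obtain ⟨e, heD, rfl⟩ := Multiset.mem_map.1 hz
          obtain ⟨a, b, h, rfl⟩ := e.exists_mkEdge
          have hu : u ∉ s(a, b) := fun hu => he ⟨_, heD, hu⟩
          simp only [Sym2.mem_iff, not_or] at hu
          simp [bd_singleton, sing, hu.1, hu.2]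
        rw [h0] at this
        simp [sing, h] at this
      subst huv
      exact ⟨.nil, by simp [walkEdges], fun h => absurd h he⟩

/-- A longest walk that uses only available edges uses all of them: otherwise the unused edges have
even degrees and, by connectivity, touch the walk, so a closed walk can be spliced in. -/
lemma exists_eulerian_walk (H : Multiset (Edge V)) (hconn : (graph H.toFinset).Connected)
    (hpar : mbd H = sing s + sing t) :
    ∃ W : (⊤ : SimpleGraph V).Walk s t, (walkEdges W : Multiset (Edge V)) = H := by
  classical
  let P : ℕ → Prop := fun n => ∃ W : (⊤ : SimpleGraph V).Walk s t,
    (walkEdges W : Multiset (Edge V)) ≤ H ∧ (walkEdges W).length = n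
  have hbd : ∀ n, P n → n ≤ Multiset.card H := by
    rintro n ⟨W, hW, rfl⟩
    simpa using Multiset.card_le_card hW
  obtain ⟨W₀, hW₀, -⟩ := exists_walk_of_mbd H hpar
  have hP0 : P (walkEdges W₀).length := ⟨W₀, hW₀, rfl⟩
  obtain ⟨W, hW, hlen⟩ := Nat.findGreatest_spec (P := P) (hbd _ hP0) hP0
  refine ⟨W, ?_⟩
  obtain ⟨D, hD⟩ := Multiset.le_iff_exists_add.1 hW
  by_contra hne
  have hD0 : D ≠ 0 := by
    rintro rfl
    exact hne (by rw [hD, add_zero])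
  have hDpar : mbd D = 0 := by
    rw [hD, mbd_add, mbd_walkEdges] at hpar
    simpa using hpar
  have hvert : ∃ a ∈ W.support, ∃ e ∈ D, a ∈ e.1 := by
    by_cases hU : ∀ v, v ∈ W.support
    · obtain ⟨e, he⟩ := Multiset.exists_mem_of_ne_zero hD0
      obtain ⟨a, b, h, rfl⟩ := e.exists_mkEdge
      exact ⟨a, hU a, _, he, Sym2.mem_mk_left _ _⟩
    · push Not at hU
      obtain ⟨b, hb⟩ := hU
      obtain ⟨e, heH, he⟩ := exists_mem_cut_of_connected hconn
        (U := {v | v ∈ W.support}) (a := s) (b := b) W.start_mem_support hb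
      obtain ⟨c, d, h, rfl⟩ := e.exists_mkEdge
      rw [Multiset.mem_toFinset, hD, Multiset.mem_add] at heH
      have hnW : mkEdge c d h ∉ walkEdges W := by
        intro hmem
        have h1 := mem_support_of_mem_walkEdges hmem (a := c) (Sym2.mem_mk_left _ _)
        have h2 := mem_support_of_mem_walkEdges hmem (a := d) (Sym2.mem_mk_right _ _)
        simp [h1, h2] at he
      have heD := heH.resolve_left (by simpa using hnW)
      by_cases hc : c ∈ W.support
      · exact ⟨c, hc, _, heD, Sym2.mem_mk_left _ _⟩
      · by_cases hd : d ∈ W.support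
        · exact ⟨d, hd, _, heD, Sym2.mem_mk_right _ _⟩
        · simp [hc, hd] at he
  obtain ⟨a, haW, he⟩ := hvert
  obtain ⟨Z, hZ, hZne⟩ := exists_walk_of_mbd D (u := a) (v := a) (by rw [hDpar, sing_add_self])
  have hsplit : walkEdges W =
      walkEdges (W.takeUntil a haW) ++ walkEdges (W.dropUntil a haW) := by
    rw [← walkEdges_append, W.take_spec haW]
  let W' := ((W.takeUntil a haW).append Z).append (W.dropUntil a haW)
  have hW' : (walkEdges W' : Multiset (Edge V)) = walkEdges W + walkEdges Z := by
    simp only [W', walkEdges_append, hsplit, ← Multiset.coe_add]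
    abel
  have hW'H : (walkEdges W' : Multiset (Edge V)) ≤ H := by
    rw [hW', hD]
    exact Multiset.add_le_add_left hZ
  have hlt : (walkEdges W).length < (walkEdges W').length := by
    have := congrArg Multiset.card hW'
    simp only [Multiset.coe_card, Multiset.card_add] at this
    have := List.length_pos_of_ne_nil (hZne he)
    omega
  have hP' : P (walkEdges W').length := ⟨W', hW'H, rfl⟩
  have := Nat.le_findGreatest (P := P) (hbd _ hP') hP'
  omega

lemma forall_mem_support_of_connected {F : Finset (Edge V)} (hconn : (graph F).Connected)
    {W : (⊤ : SimpleGraph V).Walk s t} (hF : ∀ e ∈ F, e ∈ walkEdges W) (v : V) :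
    v ∈ W.support := by
  by_contra hb
  obtain ⟨e, heH, he⟩ := exists_mem_cut_of_connected hconn
    (U := {v | v ∈ W.support}) (a := s) (b := v) W.start_mem_support hb
  obtain ⟨c, d, h, rfl⟩ := e.exists_mkEdge
  have h1 := mem_support_of_mem_walkEdges (hF _ heH) (a := c) (Sym2.mem_mk_left _ _)
  have h2 := mem_support_of_mem_walkEdges (hF _ heH) (a := d) (Sym2.mem_mk_right _ _)
  simp [h1, h2] at he

lemma exists_walk_support_eq (l : List V) (u : V) (h : (u :: (l ++ [t])).Nodup) :
    ∃ P : (⊤ : SimpleGraph V).Walk u t, P.support = u :: (l ++ [t]) := by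
  induction l generalizing u with
  | nil =>
    have hut : u ≠ t := by
      rintro rfl
      simp at h
    exact ⟨.cons (by simpa using hut) .nil, by simp⟩
  | cons w l ih =>
    obtain ⟨P, hP⟩ := ih w (by simpa using (List.nodup_cons.1 h).2)
    have huw : u ≠ w := by
      rintro rfl
      simp at h
    exact ⟨.cons (by simpa using huw) P, by simp [hP]⟩

/-! ### Shortcutting -/

section

variable [MetricSpace V]

lemma exists_tour_of_walk (hst : s ≠ t) (W : (⊤ : SimpleGraph V).Walk s t)
    (hW : ∀ v, v ∈ W.support) :
    ∃ P : (⊤ : SimpleGraph V).Walk s t, IsTour P ∧ P.support.Sublist W.support := by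
  classical
  cases W with
  | nil => exact absurd rfl hst
  | @cons _ w _ h p =>
    have hp : p.support = p.support.dropLast ++ [t] := by
      conv_lhs => rw [← List.dropLast_append_getLast p.support_ne_nil, p.getLast_support]
    -- The first occurrence of s and the last occurrence of t are kept; the inner vertices are
    -- deduplicated.
    let m := (p.support.dropLast.filter fun v => v ≠ s ∧ v ≠ t).dedup
    have hmem : ∀ v, v ∈ m ↔ v ∈ p.support.dropLast ∧ v ≠ s ∧ v ≠ t := by
      intro v; simp [m]
    have hnd : (s :: (m ++ [t])).Nodup := by
      rw [List.nodup_cons]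
      refine ⟨?_, ?_⟩
      · simp [hmem, hst]
      · rw [List.nodup_append]
        refine ⟨List.nodup_dedup _, by simp, ?_⟩
        intro a ha b hb
        rw [List.mem_singleton] at hb
        subst hb
        exact ((hmem a).1 ha).2.2
    obtain ⟨P, hP⟩ := exists_walk_support_eq m s hnd
    refine ⟨P, ?_, ?_⟩
    · intro v
      rw [hP]
      refine List.count_eq_one_of_mem hnd ?_
      have := hW v
      rw [SimpleGraph.Walk.support_cons, hp] at this
      simp only [List.mem_cons, List.mem_append, List.not_mem_nil, or_false, hmem] at this ⊢
      tauto
    · rw [hP, SimpleGraph.Walk.support_cons, hp]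
      refine List.Sublist.cons_cons _ (List.Sublist.append ?_ (List.Sublist.refl _))
      exact (List.dedup_sublist _).trans List.filter_sublist

/-- The length of the path that starts in `a` and visits the vertices of `l` in this order. -/
def chainCost : V → List V → ℝ
  | _, [] => 0
  | a, b :: l => dist a b + chainCost b l

lemma chainCost_le (a b : V) (l : List V) : chainCost a l ≤ dist a b + chainCost b l := by
  cases l with
  | nil => simp [chainCost]
  | cons c l =>
    simp only [chainCost]
    linarith [dist_triangle a b c]

lemma chainCost_le_of_sublist {l' l : List V} (h : l'.Sublist l) (a : V) :
    chainCost a l' ≤ chainCost a l := by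
  induction h generalizing a with
  | slnil => exact le_rfl
  | cons b _ ih => exact (chainCost_le a b _).trans (by simp only [chainCost]; linarith [ih b])
  | cons_cons b _ ih => simp only [chainCost]; linarith [ih b]

lemma walkCost_eq_chainCost {u v : V} (W : (⊤ : SimpleGraph V).Walk u v) :
    walkCost W = chainCost u W.support.tail := by
  induction W with
  | nil => simp [walkCost, chainCost]
  | @cons u w v h p ih =>
    rw [SimpleGraph.Walk.support_cons, List.tail_cons, ← p.cons_tail_support]
    simp only [chainCost]
    rw [← ih]
    simp [walkCost, pairCost]

lemma walkCost_le_of_sublist {P W : (⊤ : SimpleGraph V).Walk s t}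
    (h : P.support.Sublist W.support) : walkCost P ≤ walkCost W := by
  rw [walkCost_eq_chainCost, walkCost_eq_chainCost]
  rw [← P.cons_tail_support, ← W.cons_tail_support, List.cons_sublist_cons] at h
  exact chainCost_le_of_sublist h s

lemma walkCost_eq_sum {W : (⊤ : SimpleGraph V).Walk s t} {H : Multiset (Edge V)}
    (h : (W.edges : Multiset (Sym2 V)) = H.map Subtype.val) :
    walkCost W = (H.map fun e => pairCost e.1).sum := by
  have := congrArg (fun M => (M.map pairCost).sum) h
  simpa [walkCost, Multiset.map_map] using this

end

end STPathTSP

end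

noncomputable section

namespace STPathTSP

variable {V : Type u} [Fintype V] {s t : V} {x : Edge V → ℝ}

/-! ### Lonely cuts and edges -/

lemma par_of_bd_eq {P : Finset (Edge V)} {u v : V} (h : bd P = sing u + sing v) (U : Set V)
    [Decidable (u ∈ U)] [Decidable (v ∈ U)] :
    par P U = (if u ∈ U then 1 else 0) + (if v ∈ U then 1 else 0) := by
  classical
  rw [par_eq_sum, h]
  simp only [Pi.add_apply, Finset.sum_add_distrib, sum_sing]
  congr!

lemma par_of_inter_eq {P S : Finset (Edge V)} {U : Set V} {e : Edge V} (hP : P ⊆ S)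
    (h : cut U ∩ S = {e}) : par P U = if e ∈ P then 1 else 0 := by
  have : P ∩ cut U = if e ∈ P then {e} else ∅ := by
    ext f
    have := Finset.ext_iff.1 h f
    simp only [Finset.mem_inter, Finset.mem_singleton] at this ⊢
    split_ifs with he
    · rw [Finset.mem_singleton]
      exact ⟨fun hf => this.1 ⟨hf.2, hP hf.1⟩, fun hf => by subst hf; exact ⟨he, (this.2 rfl).1⟩⟩
    · simp only [Finset.notMem_empty, iff_false]
      rintro ⟨h1, h2⟩
      exact he (this.1 ⟨h2, hP h1⟩ ▸ h1)
  rw [par, this]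
  split_ifs <;> simp

lemma par_eq_zero_of_disjoint {P : Finset (Edge V)} {U : Set V} (h : ∀ e ∈ P, e ∉ cut U) :
    par P U = 0 := by
  have : P ∩ cut U = ∅ := by
    rw [← Finset.disjoint_iff_inter_eq_empty, Finset.disjoint_left]
    exact fun e he => h e he
  simp [par, this]

/-- A narrow cut is determined by the edge in which it meets a spanning tree, if this is unique. -/
lemma narrowCuts_eq_of_inter_eq {S C C' : Finset (Edge V)} {e : Edge V} (hS : (graph S).Connected)
    (hC : C ∈ narrowCuts s t x) (hC' : C' ∈ narrowCuts s t x) (h : C ∩ S = {e})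
    (h' : C' ∩ S = {e}) : C = C' := by
  classical
  obtain ⟨⟨U, hsU, -, rfl⟩, -⟩ := mem_narrowCuts.1 hC
  obtain ⟨⟨W, hsW, -, rfl⟩, -⟩ := mem_narrowCuts.1 hC'
  congr 1
  ext v
  -- A vertex v lies on the side of s exactly when the tree connection from s to v avoids e, so e
  -- determines the side.
  obtain ⟨P, hPS, hP⟩ := exists_join_of_reachable (hS.preconnected s v)
  have h1 := par_of_bd_eq hP U
  have h2 := par_of_bd_eq hP W
  rw [par_of_inter_eq hPS h] at h1
  rw [par_of_inter_eq hPS h'] at h2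
  rw [h1, if_pos hsU, if_pos hsW] at h2
  by_cases hU : v ∈ U <;> by_cases hW : v ∈ W <;> simp_all

namespace GVDecomposition

variable (D : GVDecomposition s t x) {j : Fin D.k}

lemma connected_S (j : Fin D.k) : (graph (D.S j)).Connected :=
  (D.isSpanningTree j).connected

lemma mem_lonelyCuts {C : Finset (Edge V)} : C ∈ D.lonelyCuts j ↔ C ∈ narrowCuts s t x ∧
    (∃ e, C ∩ D.S j = {e}) ∧ ∑ i ∈ Finset.Iic j, D.p i ≤ 2 - ∑ f ∈ C, x f := by
  classical
  rw [lonelyCuts, Finset.mem_filter]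
  simp only [IsLonelyAt, Finset.mem_univ, true_and, exists_and_left, exists_and_right]

lemma lonelyCuts_subset : D.lonelyCuts j ⊆ narrowCuts s t x :=
  fun _ hC => (D.mem_lonelyCuts.1 hC).1

lemma mem_lonelyEdges {e : Edge V} : e ∈ D.lonelyEdges j ↔
    ∃ C ∈ D.lonelyCuts j, C ∩ D.S j = {e} := by
  classical
  rw [lonelyEdges, Finset.mem_filter]
  simp only [IsLonelyAt, Finset.mem_univ, true_and, mem_lonelyCuts]
  constructor
  · rintro ⟨C, h1, h2, h3⟩
    exact ⟨C, ⟨h1, ⟨e, h2⟩, h3⟩, h2⟩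
  · rintro ⟨C, ⟨h1, -, h3⟩, h2⟩
    exact ⟨C, h1, h2, h3⟩

lemma eq_of_mem_lonelyCuts {C C' : Finset (Edge V)} {e : Edge V} (hC : C ∈ D.lonelyCuts j)
    (hC' : C' ∈ D.lonelyCuts j) (he : e ∈ C) (he' : e ∈ C') (heS : e ∈ D.S j) : C = C' := by
  obtain ⟨h1, ⟨f, hf⟩, -⟩ := D.mem_lonelyCuts.1 hC
  obtain ⟨h1', ⟨f', hf'⟩, -⟩ := D.mem_lonelyCuts.1 hC'
  have e1 : e = f := by
    have : e ∈ C ∩ D.S j := Finset.mem_inter.2 ⟨he, heS⟩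
    simpa [hf] using this
  have e2 : e = f' := by
    have : e ∈ C' ∩ D.S j := Finset.mem_inter.2 ⟨he', heS⟩
    simpa [hf'] using this
  subst e1 e2
  exact narrowCuts_eq_of_inter_eq (D.connected_S j) h1 h1' hf hf'

lemma lonelyEdges_eq_biUnion : D.lonelyEdges j = (D.lonelyCuts j).biUnion (· ∩ D.S j) := by
  ext e
  rw [mem_lonelyEdges, Finset.mem_biUnion]
  constructor
  · rintro ⟨C, hC, h⟩
    exact ⟨C, hC, by rw [h]; simp⟩
  · rintro ⟨C, hC, h⟩
    refine ⟨C, hC, ?_⟩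
    obtain ⟨-, ⟨f, hf⟩, -⟩ := D.mem_lonelyCuts.1 hC
    rw [hf] at h
    rw [hf, Finset.mem_singleton.1 h]

lemma lonelyEdges_subset : D.lonelyEdges j ⊆ D.S j := by
  rw [lonelyEdges_eq_biUnion]
  exact Finset.biUnion_subset.2 fun C _ => Finset.inter_subset_right

lemma sdiff_forest : D.S j \ D.forest j = D.lonelyEdges j := by
  rw [forest, Finset.sdiff_sdiff_eq_self D.lonelyEdges_subset]

lemma isTJoin_wrongParity_iff (hst : s ≠ t) {J : Finset (Edge V)} :
    IsTJoin (D.wrongParity j) J ↔ bd J = bd (D.forest j) + (sing s + sing t) := by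
  have h : D.wrongParity j = oddVertices (symmDiff (D.forest j) {mkEdge s t hst}) := by
    ext v
    rw [mem_oddVertices, bd_symmDiff, bd_singleton, wrongParity, Set.mem_symmDiff,
      mem_oddVertices]
    simp only [Pi.add_apply, sing, Pi.single_apply, Set.mem_insert_iff, Set.mem_singleton_iff]
    rcases zmod_two_cases (bd (D.forest j) v) with h0 | h0 <;> by_cases h1 : v = s <;>
      by_cases h2 : v = t <;> simp_all [zmod_two_add_self]
  rw [IsTJoin, h, oddVertices_eq_iff, bd_symmDiff, bd_singleton]

lemma exists_isTJoin (hst : s ≠ t) : ∃ J, IsTJoin (D.wrongParity j) J :=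
  ⟨symmDiff (D.forest j) {mkEdge s t hst}, by
    rw [D.isTJoin_wrongParity_iff hst, bd_symmDiff, bd_singleton]⟩

open Classical in
lemma par_join {J : Finset (Edge V)} (hJ : bd J = bd (D.forest j) + (sing s + sing t))
    (U : Set V) : par J U = par (D.forest j) U +
      ((if s ∈ U then 1 else 0) + (if t ∈ U then 1 else 0)) := by
  rw [par_eq_sum, hJ, par_eq_sum]
  simp only [Pi.add_apply, Finset.sum_add_distrib, sum_sing]

/-- A join for the wrong parities meets every lonely cut. -/
lemma exists_mem_of_mem_lonelyCuts {J C : Finset (Edge V)}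
    (hJ : bd J = bd (D.forest j) + (sing s + sing t)) (hC : C ∈ D.lonelyCuts j) :
    ∃ f ∈ J, f ∈ C := by
  classical
  obtain ⟨h1, ⟨e, he⟩, -⟩ := D.mem_lonelyCuts.1 hC
  obtain ⟨⟨U, hs, ht, rfl⟩, -⟩ := mem_narrowCuts.1 h1
  by_contra! hf
  have h2 := D.par_join hJ U
  rw [par_eq_zero_of_disjoint hf, par_eq_zero_of_disjoint (P := D.forest j)] at h2
  · simp [hs, ht] at h2
  · intro f hf hfU
    obtain ⟨hfS, hfl⟩ := Finset.mem_sdiff.1 hf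
    refine hfl (D.mem_lonelyEdges.2 ⟨_, hC, ?_⟩)
    have : f ∈ cut U ∩ D.S j := Finset.mem_inter.2 ⟨hfU, hfS⟩
    rw [he] at this
    rw [he, Finset.mem_singleton.1 this]

-- Trees up to the index r of C meet C once. A later tree of positive weight has a prefix sum beyond
-- the slack, so only trees of weight zero need to be excluded.
variable {D} in
lemma lonely_of_le (hj : 0 < D.p j) {C : Finset (Edge V)} (hC : C ∈ narrowCuts s t x)
    (h : ∑ i ∈ Finset.Iic j, D.p i ≤ 2 - ∑ f ∈ C, x f) : C ∈ D.lonelyCuts j := by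
  obtain ⟨r, hr, hr1⟩ := D.narrow C hC
  have hjr : j ≤ r := by
    by_contra! hlt
    rw [← hr] at h
    have h1 : ∑ i ∈ Finset.Iic r, D.p i + D.p j ≤ ∑ i ∈ Finset.Iic j, D.p i := by
      rw [add_comm, ← Finset.sum_insert (by simpa using hlt)]
      refine Finset.sum_le_sum_of_subset_of_nonneg ?_ fun i _ _ => D.p_nonneg i
      intro i hi
      rw [Finset.mem_insert, Finset.mem_Iic] at hi
      rw [Finset.mem_Iic]
      rcases hi with rfl | hi
      · exact le_rfl
      · exact hi.trans hlt.le
    linarith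
  exact D.mem_lonelyCuts.2 ⟨hC, Finset.card_eq_one.1 (hr1 j hjr), h⟩

end GVDecomposition

/-! ### Costs of forests and of reconnection -/

section

variable [MetricSpace V]

lemma pairCost_nonneg (e : Sym2 V) : 0 ≤ pairCost e := by
  induction e using Sym2.ind with
  | _ a b => exact dist_nonneg

lemma cost_nonneg (F : Finset (Edge V)) : 0 ≤ cost F :=
  Finset.sum_nonneg fun _ _ => pairCost_nonneg _

lemma cost_biUnion_le {ι : Type*} (A : Finset ι) (F : ι → Finset (Edge V)) :
    cost (A.biUnion F) ≤ ∑ i ∈ A, cost (F i) := by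
  classical
  induction A using Finset.induction_on with
  | empty => simp [cost]
  | insert i A hi ih =>
    rw [Finset.biUnion_insert, Finset.sum_insert hi]
    have h := Finset.sum_union_inter (s₁ := F i) (s₂ := A.biUnion F)
      (f := fun e : Edge V => pairCost e.1)
    have h0 := cost_nonneg (F i ∩ A.biUnion F)
    simp only [cost] at *
    linarith

namespace GVDecomposition

variable (D : GVDecomposition s t x) {j : Fin D.k}

lemma cost_forest : cost (D.forest j) =
    cost (D.S j) - ∑ C ∈ D.lonelyCuts j, cost (C ∩ D.S j) := by
  have h1 : cost (D.lonelyEdges j) = ∑ C ∈ D.lonelyCuts j, cost (C ∩ D.S j) := by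
    rw [cost, lonelyEdges_eq_biUnion, Finset.sum_biUnion]
    · rfl
    · intro C hC C' hC' hne
      refine Finset.disjoint_left.2 fun e he he' => hne ?_
      rw [Finset.mem_inter] at he he'
      exact D.eq_of_mem_lonelyCuts hC hC' he.1 he'.1 he.2
  have h2 := Finset.sum_sdiff (f := fun e : Edge V => pairCost e.1) (D.lonelyEdges_subset (j := j))
  rw [← h1]
  simp only [cost, forest]
  linarith

/-- The cuts to be reconnected on behalf of a join edge `f`: all lonely cuts that contain `f`
except one of maximum cost. -/
lemma exists_erase_max (j : Fin D.k) (f : Edge V) : ∃ M ⊆ (D.lonelyCuts j).filter (f ∈ ·),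
    2 * ∑ C ∈ M, cost (C ∩ D.S j) = D.modCost j f - pairCost f.1 ∧
    ∀ C ∈ (D.lonelyCuts j).filter (f ∈ ·), C ∉ M →
      M = ((D.lonelyCuts j).filter (f ∈ ·)).erase C := by
  rw [modCost]
  generalize (D.lonelyCuts j).filter (f ∈ ·) = L
  rcases L.eq_empty_or_nonempty with rfl | hL
  · exact ⟨∅, by simp, by simp, by simp⟩
  · obtain ⟨C₀, hC₀, hmax⟩ := L.exists_max_image (fun C => 2 * cost (C ∩ D.S j)) hL
    refine ⟨L.erase C₀, Finset.erase_subset _ _, ?_, ?_⟩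
    · have h1 : L.fold max 0 (fun C => 2 * cost (C ∩ D.S j)) = 2 * cost (C₀ ∩ D.S j) := by
        apply le_antisymm
        · rw [Finset.fold_max_le]
          exact ⟨mul_nonneg zero_le_two (cost_nonneg _), hmax⟩
        · exact (Finset.le_fold_max _).2 (Or.inr ⟨C₀, hC₀, le_rfl⟩)
      rw [h1, ← Finset.add_sum_erase L _ hC₀, Finset.mul_sum]
      ring
    · intro C hC hCM
      have : C = C₀ := by
        by_contra h
        exact hCM (Finset.mem_erase.2 ⟨h, hC⟩)
      rw [this]

lemma pairCost_le_modCost (f : Edge V) : pairCost f.1 ≤ D.modCost j f := by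
  obtain ⟨M, -, h, -⟩ := D.exists_erase_max j f
  have : 0 ≤ ∑ C ∈ M, cost (C ∩ D.S j) := Finset.sum_nonneg fun _ _ => cost_nonneg _
  linarith

lemma modCost_nonneg (f : Edge V) : 0 ≤ D.modCost j f :=
  (pairCost_nonneg _).trans (D.pairCost_le_modCost f)

/-- If at most one lonely cut contains `f`, then the modified cost of `f` is the original one. -/
lemma modCost_eq {f : Edge V}
    (h : ∀ C ∈ D.lonelyCuts j, ∀ C' ∈ D.lonelyCuts j, f ∈ C → f ∈ C' → C = C') :
    D.modCost j f = pairCost f.1 := by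
  rw [modCost]
  rcases ((D.lonelyCuts j).filter (f ∈ ·)).eq_empty_or_nonempty with hL | ⟨C, hC⟩
  · rw [hL]; simp
  · have hL : (D.lonelyCuts j).filter (f ∈ ·) = {C} := by
      refine Finset.eq_singleton_iff_unique_mem.2 ⟨hC, fun C' hC' => ?_⟩
      rw [Finset.mem_filter] at hC hC'
      exact h _ hC'.1 _ hC.1 hC'.2 hC.2
    rw [hL, Finset.fold_singleton, Finset.sum_singleton, max_eq_left]
    · ring
    · exact mul_nonneg zero_le_two (cost_nonneg _)

/-- For every join edge f, restore the lonely edges of all lonely cuts through f except a most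
expensive one. If a set U were uncrossed, some tree edge e across U is deleted and not restored. Its
lonely cut C contains a join edge f and must be the omitted one for f. All other edges of the tree
connection between the ends of f are present, so this connection crosses U only in e, although f
does not cross U: a parity contradiction. -/
lemma exists_reconnects {J : Finset (Edge V)}
    (hJ : bd J = bd (D.forest j) + (sing s + sing t)) :
    ∃ R, D.Reconnects j J R ∧ 2 * cost R ≤ ∑ e ∈ J, (D.modCost j e - pairCost e.1) := by
  classical
  choose M hM hMc hMe using D.exists_erase_max j
  let R := J.biUnion fun f => (M f).biUnion (· ∩ D.S j)
  have hMl : ∀ f, ∀ C ∈ M f, C ∈ D.lonelyCuts j := fun f C hC =>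
    (Finset.mem_filter.1 (hM f hC)).1
  have hRl : R ⊆ D.lonelyEdges j := by
    refine Finset.biUnion_subset.2 fun f _ => Finset.biUnion_subset.2 fun C hC => ?_
    rw [lonelyEdges_eq_biUnion]
    exact Finset.subset_biUnion_of_mem (· ∩ D.S j) (hMl f C hC)
  refine ⟨R, ⟨by rwa [sdiff_forest], ?_⟩, ?_⟩
  · have hne : Nonempty V := ⟨s⟩
    refine ⟨fun a b => reachable_of_forall_cut fun U ha hb => ?_⟩
    by_contra! hH
    obtain ⟨e, heS, heU⟩ := exists_mem_cut_of_connected (D.connected_S j) ha hb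
    have heF : e ∉ D.forest j := fun h => hH e (by simp [h]) heU
    have hel : e ∈ D.lonelyEdges j := by
      rw [← sdiff_forest]; exact Finset.mem_sdiff.2 ⟨heS, heF⟩
    obtain ⟨C, hC, hCe⟩ := D.mem_lonelyEdges.1 hel
    obtain ⟨f, hfJ, hfC⟩ := D.exists_mem_of_mem_lonelyCuts hJ hC
    have heC : e ∈ C ∩ D.S j := by rw [hCe]; simp
    have hCM : C ∉ M f := fun h => hH e (Finset.mem_union_right _ (Finset.mem_biUnion.2
      ⟨f, hfJ, Finset.mem_biUnion.2 ⟨C, h, heC⟩⟩)) heU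
    have hMf := hMe f C (Finset.mem_filter.2 ⟨hC, hfC⟩) hCM
    obtain ⟨u, v, huv, rfl⟩ := f.exists_mkEdge
    obtain ⟨P, hPS, hP⟩ := exists_join_of_reachable ((D.connected_S j).preconnected u v)
    have hpar : ∀ W : Set V, par P W = if mkEdge u v huv ∈ cut W then 1 else 0 := by
      intro W
      rw [par_of_bd_eq hP W]
      by_cases h1 : u ∈ W <;> by_cases h2 : v ∈ W <;> simp [h1, h2, zmod_two_add_self]
    -- The lonely edges on the tree connection are exactly those whose lonely cut contains f.
    have hmemP : ∀ g, ∀ C' ∈ D.lonelyCuts j, C' ∩ D.S j = {g} →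
        (g ∈ P ↔ mkEdge u v huv ∈ C') := by
      intro g C' hC' hg
      obtain ⟨⟨W, -, -, rfl⟩, -⟩ := mem_narrowCuts.1 (D.lonelyCuts_subset hC')
      have h1 := hpar W
      rw [par_of_inter_eq hPS hg] at h1
      by_cases h2 : g ∈ P <;> by_cases h3 : mkEdge u v huv ∈ cut W <;> simp_all
    have hPU : ∀ g ∈ P, g ≠ e → g ∉ cut U := by
      intro g hgP hge
      by_cases hgF : g ∈ D.forest j
      · exact hH g (by simp [hgF])
      · have hgl : g ∈ D.lonelyEdges j := by
          rw [← sdiff_forest]; exact Finset.mem_sdiff.2 ⟨hPS hgP, hgF⟩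
        obtain ⟨C', hC', hg⟩ := D.mem_lonelyEdges.1 hgl
        have h1 := (hmemP g C' hC' hg).1 hgP
        have h2 : C' ∈ M (mkEdge u v huv) := by
          rw [hMf]
          refine Finset.mem_erase.2 ⟨?_, Finset.mem_filter.2 ⟨hC', h1⟩⟩
          rintro rfl
          rw [hCe, Finset.singleton_inj] at hg
          exact hge hg.symm
        exact hH g (Finset.mem_union_right _ (Finset.mem_biUnion.2
          ⟨_, hfJ, Finset.mem_biUnion.2 ⟨C', h2, by rw [hg]; simp⟩⟩))
    have heP := (hmemP e C hC hCe).2 hfC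
    have h1 := hpar U
    rw [if_neg (hH _ (by simp [hfJ]))] at h1
    have h2 : P ∩ cut U = {e} := by
      ext g
      rw [Finset.mem_inter, Finset.mem_singleton]
      constructor
      · rintro ⟨h3, h4⟩
        by_contra h5
        exact hPU g h3 h5 h4
      · rintro rfl
        exact ⟨heP, heU⟩
    simp [par, h2] at h1
  · have h1 : cost R ≤ ∑ f ∈ J, cost ((M f).biUnion (· ∩ D.S j)) := cost_biUnion_le _ _
    rw [← Finset.sum_congr rfl fun f _ => hMc f, ← Finset.mul_sum]
    have h2 := Finset.sum_le_sum fun f (_ : f ∈ J) =>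
      cost_biUnion_le (M f) (· ∩ D.S j)
    linarith

end GVDecomposition

end

end STPathTSP

end

noncomputable section

namespace STPathTSP

variable {V : Type u} [Fintype V] {s t : V} {x : Edge V → ℝ}

/-! ### The cost of the tour computed from a single tree -/

/-- The slack `2 - x(C)` of a narrow cut. -/
def slack (x : Edge V → ℝ) (C : Finset (Edge V)) : ℝ := 2 - ∑ e ∈ C, x e

lemma sum_mul_incidence (f : Edge V → ℝ) (B : Finset (Edge V)) :
    ∑ e, f e * incidence B e = ∑ e ∈ B, f e := by
  simp [incidence]

lemma slack_pos {C : Finset (Edge V)}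
    (hC : C ∈ narrowCuts s t x) : 0 < slack x C := by
  have := (mem_narrowCuts.1 hC).2
  simp only [slack]
  linarith

namespace GVDecomposition

variable (D : GVDecomposition s t x) {j : Fin D.k}

/-- Convex combinations over the trees in which a cut is lonely. -/
structure IsLonelyWeight (C : Finset (Edge V)) (q : Fin D.k → ℝ) : Prop where
  nonneg : ∀ i, 0 ≤ q i
  sum_eq : ∑ i, q i = 1
  lonely : ∀ i, q i ≠ 0 → 0 < D.p i ∧ C ∈ D.lonelyCuts i

/-- The vector that bounds the cost of the join. -/
def joinVector (j : Fin D.k) (α : ℝ) (q : Finset (Edge V) → Fin D.k → ℝ) (e : Edge V) : ℝ :=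
  (1 - α) / 2 * x e + α * incidence (D.S j) e +
    ∑ C ∈ D.lonelyCuts j, (1 - α) * slack x C / 2 * incidence (C ∩ D.S j) e +
    ∑ C ∈ narrowCuts s t x \ D.lonelyCuts j, max 0 ((slack x C - α * (slack x C + 2)) / 2) *
      ∑ i, q C i * incidence (C ∩ D.S i) e

lemma sum_mul_joinVector (j : Fin D.k) (α : ℝ) (q : Finset (Edge V) → Fin D.k → ℝ)
    (f : Edge V → ℝ) : ∑ e, f e * D.joinVector j α q e =
      (1 - α) / 2 * ∑ e, f e * x e + α * ∑ e ∈ D.S j, f e +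
      ∑ C ∈ D.lonelyCuts j, (1 - α) * slack x C / 2 * ∑ e ∈ C ∩ D.S j, f e +
      ∑ C ∈ narrowCuts s t x \ D.lonelyCuts j,
        max 0 ((slack x C - α * (slack x C + 2)) / 2) * ∑ i, q C i * ∑ e ∈ C ∩ D.S i, f e := by
  simp only [joinVector, ← sum_mul_incidence f, mul_add, Finset.sum_add_distrib, Finset.mul_sum]
  congr 1
  · congr 1
    · congr 1
      · exact Finset.sum_congr rfl fun e _ => by ring
      · exact Finset.sum_congr rfl fun e _ => by ring
    · rw [Finset.sum_comm]
      exact Finset.sum_congr rfl fun C _ => Finset.sum_congr rfl fun e _ => by ring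
  · rw [Finset.sum_comm]
    refine Finset.sum_congr rfl fun C _ => ?_
    rw [Finset.sum_comm]
    exact Finset.sum_congr rfl fun i _ => Finset.sum_congr rfl fun e _ => by ring

lemma incidence_nonneg (B : Finset (Edge V)) (e : Edge V) : 0 ≤ incidence B e := by
  unfold incidence; split_ifs <;> norm_num

lemma joinVector_nonneg (hx : LPFeasible s t x) {α : ℝ} (h0 : 0 ≤ α) (h1 : α ≤ 1)
    {q : Finset (Edge V) → Fin D.k → ℝ}
    (hq : ∀ C ∈ narrowCuts s t x, D.IsLonelyWeight C (q C)) (e : Edge V) :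
    0 ≤ D.joinVector j α q e := by
  have hx0 := hx.nonneg e
  have hi := incidence_nonneg (D.S j) e
  have h2 : 0 ≤ ∑ C ∈ D.lonelyCuts j, (1 - α) * slack x C / 2 * incidence (C ∩ D.S j) e := by
    refine Finset.sum_nonneg fun C hC => ?_
    have := slack_pos (D.lonelyCuts_subset hC)
    have h3 : 0 ≤ 1 - α := by linarith
    have := incidence_nonneg (C ∩ D.S j) e
    positivity
  have h3 : 0 ≤ ∑ C ∈ narrowCuts s t x \ D.lonelyCuts j,
      max 0 ((slack x C - α * (slack x C + 2)) / 2) * ∑ i, q C i * incidence (C ∩ D.S i) e := by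
    refine Finset.sum_nonneg fun C hC => mul_nonneg (le_max_left _ _)
      (Finset.sum_nonneg fun i _ => mul_nonneg ?_ (incidence_nonneg _ _))
    exact (hq C (Finset.mem_sdiff.1 hC).1).nonneg i
  have h4 : 0 ≤ (1 - α) / 2 * x e := mul_nonneg (by linarith) hx0
  have h5 : 0 ≤ α * incidence (D.S j) e := mul_nonneg h0 hi
  simp only [joinVector]
  linarith

lemma card_inter_eq_one {i : Fin D.k} {C : Finset (Edge V)} (hC : C ∈ D.lonelyCuts i) :
    (C ∩ D.S i).card = 1 :=
  Finset.card_eq_one.2 (D.mem_lonelyCuts.1 hC).2.1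

/-- If x(δ(U)) ≥ 2, the first two terms suffice. Otherwise δ(U) is narrow and separates s from t. A
lonely cut is topped up by its own tree edge. In a cut that is not lonely, odd parity of the join
means even parity of the forest, hence at least two tree edges, and the borrowed lonely edges supply
the rest. -/
lemma one_le_sum_joinVector (hx : LPFeasible s t x) {α : ℝ} (h0 : 0 ≤ α)
    (h1 : α ≤ 1) {q : Finset (Edge V) → Fin D.k → ℝ}
    (hq : ∀ C ∈ narrowCuts s t x, D.IsLonelyWeight C (q C)) {J : Finset (Edge V)}
    (hJ : bd J = bd (D.forest j) + (sing s + sing t)) {U : Set V} (hU : par J U = 1) :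
    1 ≤ ∑ e ∈ cut U, D.joinVector j α q e := by
  classical
  have hs1 : ∀ B : Finset (Edge V), ∑ e ∈ B, incidence (cut U) e = ((cut U ∩ B).card : ℝ) :=
    fun B => sum_incidence _ _
  have hexp : ∑ e ∈ cut U, D.joinVector j α q e =
      (1 - α) / 2 * ∑ e ∈ cut U, x e + α * ((cut U ∩ D.S j).card : ℝ) +
      ∑ C ∈ D.lonelyCuts j, (1 - α) * slack x C / 2 * ((cut U ∩ (C ∩ D.S j)).card : ℝ) +
      ∑ C ∈ narrowCuts s t x \ D.lonelyCuts j, max 0 ((slack x C - α * (slack x C + 2)) / 2) *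
        ∑ i, q C i * ((cut U ∩ (C ∩ D.S i)).card : ℝ) := by
    have h := D.sum_mul_joinVector j α q (incidence (cut U))
    simpa only [hs1, mul_comm (incidence (cut U) _), sum_mul_incidence] using h
  have hL0 : ∀ C ∈ D.lonelyCuts j,
      0 ≤ (1 - α) * slack x C / 2 * ((cut U ∩ (C ∩ D.S j)).card : ℝ) := by
    intro C hC
    have := slack_pos (D.lonelyCuts_subset hC)
    have h3 : 0 ≤ 1 - α := by linarith
    positivity
  have hK0 : ∀ C ∈ narrowCuts s t x \ D.lonelyCuts j,
      0 ≤ max 0 ((slack x C - α * (slack x C + 2)) / 2) *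
        ∑ i, q C i * ((cut U ∩ (C ∩ D.S i)).card : ℝ) := fun C hC =>
    mul_nonneg (le_max_left _ _) (Finset.sum_nonneg fun i _ =>
      mul_nonneg ((hq C (Finset.mem_sdiff.1 hC).1).nonneg i) (Nat.cast_nonneg _))
  have hLs := Finset.sum_nonneg hL0
  have hKs := Finset.sum_nonneg hK0
  have hUne : ∃ a b, a ∈ U ∧ b ∉ U := by
    by_contra! h
    have : cut U = ∅ := by
      rw [Finset.eq_empty_iff_forall_notMem]
      intro e
      obtain ⟨a, b, hab, rfl⟩ := e.exists_mkEdge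
      rw [mkEdge_mem_cut]
      rintro (⟨h1, h2⟩ | ⟨h1, h2⟩)
      · exact h2 (h _ _ h1)
      · exact h2 (h _ _ h1)
    simp [par, this] at hU
  obtain ⟨a, b, ha, hb⟩ := hUne
  have hcard : 1 ≤ (cut U ∩ D.S j).card := by
    obtain ⟨e, heS, heU⟩ := exists_mem_cut_of_connected (D.connected_S j) ha hb
    exact Finset.card_pos.2 ⟨e, Finset.mem_inter.2 ⟨heU, heS⟩⟩
  have hcard' : (1 : ℝ) ≤ ((cut U ∩ D.S j).card : ℝ) := by exact_mod_cast hcard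
  rw [hexp]
  by_cases hx2 : 2 ≤ ∑ e ∈ cut U, x e
  · have e1 : (1 - α) / 2 * 2 ≤ (1 - α) / 2 * ∑ e ∈ cut U, x e :=
      mul_le_mul_of_nonneg_left hx2 (by linarith)
    have e2 : α * 1 ≤ α * ((cut U ∩ D.S j).card : ℝ) := mul_le_mul_of_nonneg_left hcard' h0
    linarith
  push Not at hx2
  have hsep : (s ∈ U ∧ t ∉ U) ∨ (s ∉ U ∧ t ∈ U) := by
    by_cases hs : s ∈ U <;> by_cases ht : t ∈ U
    · have := hx.two_le Uᶜ ⟨b, hb⟩ (by simpa using hs) (by simpa using ht)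
      rw [cut_compl] at this
      linarith
    · exact Or.inl ⟨hs, ht⟩
    · exact Or.inr ⟨hs, ht⟩
    · have := hx.two_le U ⟨a, ha⟩ hs ht
      linarith
  have hN : cut U ∈ narrowCuts s t x := by
    rw [mem_narrowCuts]
    refine ⟨?_, hx2⟩
    rcases hsep with ⟨h1, h2⟩ | ⟨h1, h2⟩
    · exact ⟨U, h1, h2, rfl⟩
    · exact ⟨Uᶜ, by simpa using h1, by simpa using h2, by rw [cut_compl]⟩
  have hxs : ∑ e ∈ cut U, x e = 2 - slack x (cut U) := by simp [slack]
  by_cases hl : cut U ∈ D.lonelyCuts j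
  · have e1 := Finset.single_le_sum hL0 hl
    rw [← Finset.inter_assoc, Finset.inter_self, D.card_inter_eq_one hl, Nat.cast_one] at e1
    rw [D.card_inter_eq_one hl, hxs]
    push_cast
    linarith
  · have hpF : par (D.forest j) U = 0 := by
      have := D.par_join hJ U
      rw [hU] at this
      rcases hsep with ⟨h1, h2⟩ | ⟨h1, h2⟩ <;> simpa [h1, h2] using this
    -- A single tree edge would have to be deleted, hence lonely for some cut; that cut equals δ(U),
    -- as both meet the tree in the same edge.
    have hcard2 : 2 ≤ (cut U ∩ D.S j).card := by
      by_contra! hlt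
      obtain ⟨e, he⟩ := Finset.card_eq_one.1 (le_antisymm (by omega) hcard)
      rw [par_of_inter_eq (P := D.forest j) (S := D.S j) Finset.sdiff_subset he] at hpF
      have heF : e ∉ D.forest j := by
        intro h; simp [h] at hpF
      have heS : e ∈ cut U ∩ D.S j := by rw [he]; simp
      have hel : e ∈ D.lonelyEdges j := by
        rw [← sdiff_forest]; exact Finset.mem_sdiff.2 ⟨(Finset.mem_inter.1 heS).2, heF⟩
      obtain ⟨C, hC, hCe⟩ := D.mem_lonelyEdges.1 hel
      have := narrowCuts_eq_of_inter_eq (D.connected_S j) hN (D.lonelyCuts_subset hC) he hCe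
      exact hl (this ▸ hC)
    have hcard2' : (2 : ℝ) ≤ ((cut U ∩ D.S j).card : ℝ) := by exact_mod_cast hcard2
    have e1 := Finset.single_le_sum hK0 (Finset.mem_sdiff.2 ⟨hN, hl⟩)
    have e2 : ∑ i, q (cut U) i * ((cut U ∩ (cut U ∩ D.S i)).card : ℝ) = 1 := by
      rw [← (hq _ hN).sum_eq]
      refine Finset.sum_congr rfl fun i _ => ?_
      by_cases hi : q (cut U) i = 0
      · rw [hi, zero_mul]
      · rw [← Finset.inter_assoc, Finset.inter_self,
          D.card_inter_eq_one ((hq _ hN).lonely i hi).2, Nat.cast_one, mul_one]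
    rw [e2, mul_one] at e1
    have e3 := le_max_right 0 ((slack x (cut U) - α * (slack x (cut U) + 2)) / 2)
    have e4 : α * 2 ≤ α * ((cut U ∩ D.S j).card : ℝ) := mul_le_mul_of_nonneg_left hcard2' h0
    rw [hxs]
    linarith

section

variable [MetricSpace V]

/-- Summing over all lonely cuts through an edge charges 2 x(C) c(C ∩ S_j) per cut; the subtracted
maxima give back at least 2 c(C ∩ S_j), by the covering property of narrow cuts. What remains has
the factor x(C) - 1 = 1 - τ. -/
lemma sum_modCost_mul_le (hx : LPFeasible s t x) (hst : s ≠ t) :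
    ∑ e, D.modCost j e * x e ≤
      lpCost x + ∑ C ∈ D.lonelyCuts j, 2 * (1 - slack x C) * cost (C ∩ D.S j) := by
  have h1 := sum_le_sum_mul_fold_max hx.nonneg _ (D.lonelyCuts j)
    (fun C => 2 * cost (C ∩ D.S j)) rfl
    (fun L' hL' => hx.card_le_sum_biUnion hst (hL'.trans D.lonelyCuts_subset))
    (fun C _ => mul_nonneg zero_le_two (cost_nonneg _))
  have h2 : ∑ e, (∑ C ∈ (D.lonelyCuts j).filter (e ∈ ·), 2 * cost (C ∩ D.S j)) * x e =
      ∑ C ∈ D.lonelyCuts j, 2 * (2 - slack x C) * cost (C ∩ D.S j) := by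
    have h3 : ∀ C, 2 - slack x C = ∑ e, if e ∈ C then x e else 0 := by
      intro C; simp [slack]
    simp only [h3, Finset.sum_filter, Finset.sum_mul, Finset.mul_sum]
    rw [Finset.sum_comm]
    refine Finset.sum_congr rfl fun C _ => Finset.sum_congr rfl fun e _ => ?_
    split_ifs <;> ring
  have h4 : ∑ e, D.modCost j e * x e = lpCost x +
      ∑ e, (∑ C ∈ (D.lonelyCuts j).filter (e ∈ ·), 2 * cost (C ∩ D.S j)) * x e -
      ∑ e, x e * ((D.lonelyCuts j).filter (e ∈ ·)).fold max 0 (fun C => 2 * cost (C ∩ D.S j)) := by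
    rw [lpCost, ← Finset.sum_add_distrib, ← Finset.sum_sub_distrib]
    exact Finset.sum_congr rfl fun e _ => by rw [modCost]; ring
  have h5 : ∑ C ∈ D.lonelyCuts j, 2 * (2 - slack x C) * cost (C ∩ D.S j) =
      ∑ C ∈ D.lonelyCuts j, 2 * cost (C ∩ D.S j) +
      ∑ C ∈ D.lonelyCuts j, 2 * (1 - slack x C) * cost (C ∩ D.S j) := by
    rw [← Finset.sum_add_distrib]
    exact Finset.sum_congr rfl fun C _ => by ring
  rw [h4, h2, h5]
  linarith

lemma sum_modCost_S : ∀ B ⊆ D.S j, ∑ e ∈ B, D.modCost j e = cost B := fun _ hB =>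
  Finset.sum_congr rfl fun _ he => D.modCost_eq fun _ hC _ hC' h h' =>
    D.eq_of_mem_lonelyCuts hC hC' h h' (hB he)

/-- The modified costs agree with the original ones on the lonely edges of earlier trees. -/
lemma sum_modCost_inter (hj : 0 < D.p j) {i : Fin D.k} (hi : 0 < D.p i) {C : Finset (Edge V)}
    (hC : C ∈ D.lonelyCuts i) (hCj : C ∉ D.lonelyCuts j) :
    ∑ e ∈ C ∩ D.S i, D.modCost j e = cost (C ∩ D.S i) := by
  refine Finset.sum_congr rfl fun e he => D.modCost_eq fun C' hC' _ _ heC' _ => ?_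
  exfalso
  obtain ⟨hCN, -, hCi⟩ := D.mem_lonelyCuts.1 hC
  obtain ⟨hCN', -, hCj'⟩ := D.mem_lonelyCuts.1 hC'
  have hlt : 2 - ∑ f ∈ C, x f < ∑ i ∈ Finset.Iic j, D.p i := by
    by_contra! h
    exact hCj (lonely_of_le hj hCN h)
  -- C' is lonely in S_j and C is not, so C' has the larger slack and is lonely in S_i too. Then e
  -- is lonely for both cuts in S_i, which forces C = C'.
  have hC'i : C' ∈ D.lonelyCuts i := by
    refine lonely_of_le hi hCN' (le_trans ?_ hCj')
    linarith
  obtain ⟨h1, h2⟩ := Finset.mem_inter.1 he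
  exact hCj (D.eq_of_mem_lonelyCuts hC hC'i h1 heC' h2 ▸ hC')

/-- The bound on the cost of a forest and its cheapest join. -/
lemma exists_join_sum_modCost_le (hx : LPFeasible s t x) (hst : s ≠ t) (hj : 0 < D.p j)
    {α : ℝ} (h0 : 0 ≤ α) (h1 : α ≤ 1) {q : Finset (Edge V) → Fin D.k → ℝ}
    (hq : ∀ C ∈ narrowCuts s t x, D.IsLonelyWeight C (q C)) :
    ∃ J, IsTJoin (D.wrongParity j) J ∧ cost (D.forest j) + ∑ e ∈ J, D.modCost j e ≤
      (1 + α) * cost (D.S j) + (1 - α) / 2 * lpCost x -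
      ∑ C ∈ D.lonelyCuts j, (α + (1 - α) * slack x C / 2) * cost (C ∩ D.S j) +
      ∑ C ∈ narrowCuts s t x \ D.lonelyCuts j, max 0 ((slack x C - α * (slack x C + 2)) / 2) *
        ∑ i, q C i * cost (C ∩ D.S i) := by
  obtain ⟨J₀, hJ₀⟩ := D.exists_isTJoin (j := j) hst
  rw [D.isTJoin_wrongParity_iff hst] at hJ₀
  obtain ⟨J, hJ, hJc⟩ := exists_join_cost_le (y := D.joinVector j α q) (c := D.modCost j)
    (D.joinVector_nonneg hx h0 h1 hq) (fun e => D.modCost_nonneg e) J₀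
    (fun U hU => D.one_le_sum_joinVector hx h0 h1 hq hJ₀ hU)
  refine ⟨J, (D.isTJoin_wrongParity_iff hst).2 (hJ.trans hJ₀), ?_⟩
  rw [sum_mul_joinVector, D.sum_modCost_S _ subset_rfl] at hJc
  have e1 : ∑ C ∈ D.lonelyCuts j, (1 - α) * slack x C / 2 * ∑ e ∈ C ∩ D.S j, D.modCost j e =
      ∑ C ∈ D.lonelyCuts j, (1 - α) * slack x C / 2 * cost (C ∩ D.S j) :=
    Finset.sum_congr rfl fun C _ => by rw [D.sum_modCost_S _ Finset.inter_subset_right]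
  have e2 : ∑ C ∈ narrowCuts s t x \ D.lonelyCuts j,
      max 0 ((slack x C - α * (slack x C + 2)) / 2) *
        ∑ i, q C i * ∑ e ∈ C ∩ D.S i, D.modCost j e =
      ∑ C ∈ narrowCuts s t x \ D.lonelyCuts j,
        max 0 ((slack x C - α * (slack x C + 2)) / 2) * ∑ i, q C i * cost (C ∩ D.S i) := by
    refine Finset.sum_congr rfl fun C hC => ?_
    rw [Finset.mem_sdiff] at hC
    congr 1
    refine Finset.sum_congr rfl fun i _ => ?_
    by_cases hi : q C i = 0
    · rw [hi, zero_mul, zero_mul]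
    · obtain ⟨h2, h3⟩ := (hq C hC.1).lonely i hi
      rw [D.sum_modCost_inter hj h2 h3 hC.2]
  rw [e1, e2] at hJc
  have e3 := mul_le_mul_of_nonneg_left (D.sum_modCost_mul_le (j := j) hx hst)
    (show 0 ≤ (1 - α) / 2 by linarith)
  -- Each lonely cut has coefficient -1 from deletion, (1-α)(1-τ) from the c^j-cost of x and
  -- (1-α)τ/2 from the correction, in total -(α + (1-α)τ/2).
  have e4 : ∑ C ∈ D.lonelyCuts j, (α + (1 - α) * slack x C / 2) * cost (C ∩ D.S j) =
      ∑ C ∈ D.lonelyCuts j, cost (C ∩ D.S j) -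
      (1 - α) / 2 * ∑ C ∈ D.lonelyCuts j, 2 * (1 - slack x C) * cost (C ∩ D.S j) -
      ∑ C ∈ D.lonelyCuts j, (1 - α) * slack x C / 2 * cost (C ∩ D.S j) := by
    rw [Finset.mul_sum, ← Finset.sum_sub_distrib, ← Finset.sum_sub_distrib]
    exact Finset.sum_congr rfl fun C _ => by ring
  rw [e4, cost_forest]
  linarith

/-- All tours computed from a tree are bounded by the cost of the forest and any join. -/
lemma IsTourOfTree.walkCost_le {P : (⊤ : SimpleGraph V).Walk s t} (hP : D.IsTourOfTree j P)
    (hst : s ≠ t) {J' : Finset (Edge V)} (hJ' : IsTJoin (D.wrongParity j) J') :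
    walkCost P ≤ cost (D.forest j) + ∑ e ∈ J', D.modCost j e := by
  obtain ⟨J, R, hJ, hR, W, hW, -, hsub⟩ := hP
  obtain ⟨R', hR', hR'c⟩ := D.exists_reconnects ((D.isTJoin_wrongParity_iff hst).1 hJ.1)
  have h1 := hR.2 R' hR'
  have h2 := hJ.2 J' hJ'
  have h3 := walkCost_le_of_sublist hsub
  have h4 : walkCost W = cost (D.forest j) + cost J + 2 * cost R := by
    rw [walkCost_eq_sum hW, tourEdges]
    simp only [Multiset.map_add, Multiset.sum_add, cost, Finset.sum]
    ring
  rw [Finset.sum_sub_distrib] at hR'c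
  simp only [cost] at *
  linarith

lemma exists_isTourOfTree (hst : s ≠ t) (j : Fin D.k) : ∃ P, D.IsTourOfTree j P := by
  classical
  obtain ⟨J, hJ, hJmin⟩ := (Finset.univ.filter fun J => IsTJoin (D.wrongParity j) J).exists_min_image
    (fun J => ∑ e ∈ J, D.modCost j e)
    (by obtain ⟨J, hJ⟩ := D.exists_isTJoin (j := j) hst; exact ⟨J, by simpa using hJ⟩)
  replace hJ : IsTJoin (D.wrongParity j) J := by simpa using hJ
  have hbd := (D.isTJoin_wrongParity_iff hst).1 hJ
  obtain ⟨R, hR, hRmin⟩ := (Finset.univ.filter fun R => D.Reconnects j J R).exists_min_image cost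
    (by obtain ⟨R, hR, -⟩ := D.exists_reconnects hbd; exact ⟨R, by simpa using hR⟩)
  replace hR : D.Reconnects j J R := by simpa using hR
  have hfin : (D.tourEdges j J R).toFinset = D.forest j ∪ J ∪ R := by
    ext e; simp [tourEdges]
  obtain ⟨W, hW⟩ := exists_eulerian_walk (s := s) (t := t) (D.tourEdges j J R)
    -- R enters twice and F_j cancels against the boundary of the join, leaving odd degrees at s and
    -- t only.
    (by rw [hfin]; exact hR.2) (by
      rw [tourEdges, mbd_add, mbd_add, mbd_add, mbd_val, mbd_val, mbd_val, hbd]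
      funext v
      simp only [Pi.add_apply]
      have h1 := zmod_two_add_self (bd (D.forest j) v)
      have h2 := zmod_two_add_self (bd R v)
      linear_combination h1 + h2)
  obtain ⟨P, hP, hsub⟩ := exists_tour_of_walk hst W
    (forall_mem_support_of_connected hR.2 fun e he => by
      rw [← Multiset.mem_coe, hW, ← Multiset.mem_toFinset, hfin]; exact he)
  refine ⟨P, J, R, ⟨hJ, fun J' hJ' => hJmin J' (by simpa using hJ')⟩,
    ⟨hR, fun R' hR' => hRmin R' (by simpa using hR')⟩, W, ?_, hP, hsub⟩
  rw [← hW, Multiset.map_coe, map_val_walkEdges]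

end

end GVDecomposition

end STPathTSP

end

noncomputable section

namespace STPathTSP

/-! ### The integrals that balance gains and losses of narrow cuts -/

/-- The function `1 / (4 + |σ|)`. -/
def kern (σ : ℝ) : ℝ := (4 + |σ|)⁻¹

lemma continuous_kern : Continuous kern :=
  (continuous_const.add continuous_abs).inv₀ fun σ => (by positivity : (0 : ℝ) < 4 + |σ|).ne'

lemma kern_pos (σ : ℝ) : 0 < kern σ := by unfold kern; positivity

lemma kern_eq {σ : ℝ} (h : 0 ≤ σ) : kern σ = (4 + σ)⁻¹ := by rw [kern, abs_of_nonneg h]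

/-- The gain at `σ` of a narrow cut with slack `τ` while it is lonely. -/
def gain (τ σ : ℝ) : ℝ := (4 * τ + σ) / 2 * kern σ

/-- The loss at `σ` of a narrow cut with slack `τ` when it is no longer lonely. -/
def loss (τ σ : ℝ) : ℝ := max 0 ((4 * τ - σ) / 2 * kern σ)

lemma continuous_gain (τ : ℝ) : Continuous (gain τ) :=
  ((continuous_const.add continuous_id).div_const 2).mul continuous_kern

lemma continuous_loss (τ : ℝ) : Continuous (loss τ) :=
  continuous_const.max (((continuous_const.sub continuous_id).div_const 2).mul continuous_kern)

lemma integral_linear_mul_kern (A B : ℝ) {a b : ℝ} (ha : 0 ≤ a) (hb : 0 ≤ b) :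
    ∫ σ in a..b, (A + B * σ) * kern σ =
      (B * b + (A - 4 * B) * Real.log (4 + b)) - (B * a + (A - 4 * B) * Real.log (4 + a)) := by
  refine intervalIntegral.integral_eq_sub_of_hasDerivAt
    (f := fun σ => B * σ + (A - 4 * B) * Real.log (4 + σ)) (fun σ hσ => ?_) ?_
  · have h0 : 0 ≤ σ := by
      rcases Set.mem_uIcc.1 hσ with h | h
      · exact ha.trans h.1
      · exact hb.trans h.1
    have h4 : 4 + σ ≠ 0 := by positivity
    have h1 : HasDerivAt (fun σ : ℝ => Real.log (4 + σ)) (1 / (4 + σ)) σ :=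
      ((hasDerivAt_id σ).const_add 4).log h4
    have h2 := ((hasDerivAt_id σ).const_mul B).add (h1.const_mul (A - 4 * B))
    refine h2.congr_deriv ?_
    rw [kern_eq h0]
    field_simp
    ring
  · exact (((continuous_const.add (continuous_const.mul continuous_id)).mul
      continuous_kern)).intervalIntegrable _ _

lemma hasDerivAt_log_one_add_div (m : ℝ) (hm : 0 < m) {τ : ℝ} (h : 0 ≤ τ) :
    HasDerivAt (fun τ : ℝ => Real.log (1 + τ / m)) (1 / (m + τ)) τ := by
  have h1 : 1 + τ / m ≠ 0 := by positivity
  refine ((((hasDerivAt_id τ).div_const m).const_add 1).log h1).congr_deriv ?_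
  simp only [id]
  field_simp

/-- The difference φ and its derivative ψ both vanish at 0, and the second derivative is (10τ +
τ²)/((4+τ)²(1+τ)) ≥ 0. -/
lemma one_add_mul_log_le {τ : ℝ} (hτ : 0 ≤ τ) :
    (1 + τ) * Real.log (1 + τ) ≤ τ + 2 * τ * Real.log (1 + τ / 4) := by
  let φ : ℝ → ℝ := fun τ => τ + 2 * τ * Real.log (1 + τ / 4) - (1 + τ) * Real.log (1 + τ / 1)
  let ψ : ℝ → ℝ := fun τ => 2 * Real.log (1 + τ / 4) + 2 - 8 / (4 + τ) - Real.log (1 + τ / 1)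
  have hφ : ∀ τ, 0 ≤ τ → HasDerivAt φ (ψ τ) τ := by
    intro τ h
    have h1 := hasDerivAt_log_one_add_div 4 (by norm_num) h
    have h2 := hasDerivAt_log_one_add_div 1 (by norm_num) h
    have h3 := ((hasDerivAt_id τ).add (((hasDerivAt_id τ).const_mul 2).mul h1)).sub
      (((hasDerivAt_id τ).const_add 1).mul h2)
    refine h3.congr_deriv ?_
    have : 4 + τ ≠ 0 := by positivity
    have : 1 + τ ≠ 0 := by positivity
    simp only [ψ, id]
    field_simp
    ring
  have hψ : ∀ τ, 0 ≤ τ → HasDerivAt ψ (2 / (4 + τ) + 8 / (4 + τ) ^ 2 - 1 / (1 + τ)) τ := by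
    intro τ h
    have h1 := hasDerivAt_log_one_add_div 4 (by norm_num) h
    have h2 := hasDerivAt_log_one_add_div 1 (by norm_num) h
    have h4 : 4 + τ ≠ 0 := by positivity
    have h3 := (((h1.const_mul 2).add_const 2).sub
      ((((hasDerivAt_id τ).const_add 4).inv h4).const_mul 8)).sub h2
    refine (h3.congr_of_eventuallyEq (Filter.Eventually.of_forall fun y => ?_)).congr_deriv ?_
    · simp [ψ, div_eq_mul_inv]
    · have : 1 + τ ≠ 0 := by positivity
      simp only [id]
      field_simp
      ring
  have hmono : ∀ f f' : ℝ → ℝ, (∀ τ, 0 ≤ τ → HasDerivAt f (f' τ) τ) → (∀ τ, 0 ≤ τ → 0 ≤ f' τ) →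
      f 0 = 0 → ∀ τ, 0 ≤ τ → 0 ≤ f τ := by
    intro f f' hf hf' h0 τ hτ
    have h1 : MonotoneOn f (Set.Ici 0) := by
      refine monotoneOn_of_deriv_nonneg (convex_Ici 0)
        (fun y hy => (hf y hy).continuousAt.continuousWithinAt)
        (fun y hy => ?_) (fun y hy => ?_)
      · rw [interior_Ici] at hy
        exact (hf y hy.le).differentiableAt.differentiableWithinAt
      · rw [interior_Ici] at hy
        rw [(hf y hy.le).deriv]
        exact hf' y hy.le
    rw [← h0]
    exact h1 Set.self_mem_Ici hτ hτ
  have h1 : ∀ τ, 0 ≤ τ → 0 ≤ ψ τ := by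
    refine hmono ψ _ hψ (fun τ h => ?_) (by norm_num [ψ])
    have h4 : 0 < 4 + τ := by positivity
    have h5 : 0 < 1 + τ := by positivity
    rw [show 2 / (4 + τ) + 8 / (4 + τ) ^ 2 - 1 / (1 + τ) =
      (10 * τ + τ ^ 2) / ((4 + τ) ^ 2 * (1 + τ)) by field_simp; ring]
    positivity
  have h2 := hmono φ ψ hφ h1 (by norm_num [φ]) τ hτ
  simp only [φ, div_one] at h2
  linarith

lemma loss_nonneg (τ σ : ℝ) : 0 ≤ loss τ σ := le_max_left _ _

/-- The loss is positive only for σ < 4τ, so the upper limit 1 may be replaced by 4τ. Both integrals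
then have closed forms, and the comparison is twice the logarithmic inequality above. -/
lemma integral_loss_le_integral_gain {τ : ℝ} (hτ : 0 ≤ τ) :
    ∫ σ in τ..1, loss τ σ ≤ ∫ σ in (0 : ℝ)..τ, gain τ σ := by
  have hi : ∀ a b, IntervalIntegrable (loss τ) MeasureTheory.volume a b := fun a b =>
    (continuous_loss τ).intervalIntegrable a b
  have h1 : 0 ≤ ∫ σ in (1 : ℝ)..4 * τ, loss τ σ := by
    rcases le_total 1 (4 * τ) with h | h
    · exact intervalIntegral.integral_nonneg h fun σ _ => loss_nonneg τ σ
    · rw [intervalIntegral.integral_symm, intervalIntegral.integral_congr (g := fun _ => 0)]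
      · simp
      · intro σ hσ
        rw [Set.uIcc_of_le h] at hσ
        refine max_eq_left (mul_nonpos_of_nonpos_of_nonneg ?_ (kern_pos σ).le)
        linarith [hσ.1]
  have h2 := intervalIntegral.integral_add_adjacent_intervals (hi τ 1) (hi 1 (4 * τ))
  have h3 : ∫ σ in τ..4 * τ, loss τ σ = ∫ σ in τ..4 * τ, (2 * τ + (-1 / 2) * σ) * kern σ := by
    refine intervalIntegral.integral_congr fun σ hσ => ?_
    rw [Set.uIcc_of_le (by linarith)] at hσ
    simp only [loss]
    rw [max_eq_right (mul_nonneg (by linarith [hσ.2]) (kern_pos σ).le)]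
    ring
  have h4 : ∫ σ in (0 : ℝ)..τ, gain τ σ = ∫ σ in (0 : ℝ)..τ, (2 * τ + (1 / 2) * σ) * kern σ := by
    refine intervalIntegral.integral_congr fun σ _ => ?_
    simp only [gain]
    ring
  rw [integral_linear_mul_kern _ _ hτ (by positivity)] at h3
  rw [integral_linear_mul_kern _ _ le_rfl hτ] at h4
  have h5 := one_add_mul_log_le hτ
  have e1 : Real.log (4 + τ) = Real.log 4 + Real.log (1 + τ / 4) := by
    rw [← Real.log_mul (by norm_num) (by positivity)]; congr 1; ring
  have e2 : Real.log (4 + 4 * τ) = Real.log 4 + Real.log (1 + τ) := by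
    rw [← Real.log_mul (by norm_num) (by positivity)]; congr 1; ring
  rw [e1, e2] at h3
  rw [e1, add_zero] at h4
  rw [h4]
  have : ∫ σ in τ..1, loss τ σ ≤ ∫ σ in τ..4 * τ, loss τ σ := by linarith
  refine this.trans ?_
  rw [h3]
  nlinarith [h5]

lemma integral_gain_pos {τ : ℝ} (hτ : 0 < τ) : 0 < ∫ σ in (0 : ℝ)..τ, gain τ σ :=
  intervalIntegral.intervalIntegral_pos_of_pos_on ((continuous_gain τ).intervalIntegrable _ _)
    (fun σ hσ => mul_pos (by linarith [hσ.1]) (kern_pos σ)) hτ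

lemma integral_kern : ∫ σ in (0 : ℝ)..1, kern σ = Real.log (5 / 4) := by
  have h := integral_linear_mul_kern 1 0 (le_refl (0 : ℝ)) zero_le_one
  simp only [zero_mul, add_zero, one_mul, mul_zero, sub_zero, zero_add] at h
  rw [h, ← Real.log_div (by norm_num) (by norm_num)]
  norm_num

/-! ### Telescoping sums over prefixes -/

lemma sum_Iic_telescope {k : ℕ} (p : Fin k → ℝ) (Φ : ℝ → ℝ) (r : Fin k) :
    ∑ j ∈ Finset.Iic r, (Φ (∑ i ∈ Finset.Iic j, p i) - Φ (∑ i ∈ Finset.Iic j, p i - p j)) =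
      Φ (∑ i ∈ Finset.Iic r, p i) - Φ 0 := by
  let P : ℕ → ℝ := fun n => ∑ i : Fin k with i.val < n, p i
  have h1 : ∀ j : Fin k, ∑ i ∈ Finset.Iic j, p i = P (j.val + 1) := fun j => by
    refine Finset.sum_congr ?_ fun _ _ => rfl
    ext i
    rw [Finset.mem_Iic, Finset.mem_filter, Fin.le_def, Nat.lt_succ_iff]
    exact (and_iff_right (Finset.mem_univ i)).symm
  have h2 : ∀ j : Fin k, ∑ i ∈ Finset.Iic j, p i - p j = P j.val := fun j => by
    rw [← Finset.Iio_insert, Finset.sum_insert (by simp), add_sub_cancel_left]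
    refine Finset.sum_congr ?_ fun _ _ => rfl
    ext i
    rw [Finset.mem_Iio, Finset.mem_filter, Fin.lt_def]
    exact (and_iff_right (Finset.mem_univ i)).symm
  simp only [h2]
  simp only [h1]
  have h3 : ∑ j ∈ Finset.Iic r, (Φ (P (j.val + 1)) - Φ (P j.val)) =
      ∑ n ∈ Finset.range (r.val + 1), (Φ (P (n + 1)) - Φ (P n)) := by
    refine Finset.sum_nbij (fun j => j.val) (fun j hj => ?_) (fun a _ b _ h => Fin.ext h)
      (fun n hn => ?_) fun _ _ => rfl
    · rw [Finset.mem_Iic, Fin.le_def] at hj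
      exact Finset.mem_range.2 (Nat.lt_succ_of_le hj)
    · rw [Finset.coe_range, Set.mem_Iio] at hn
      exact ⟨⟨n, by omega⟩, Finset.mem_coe.2 (Finset.mem_Iic.2 (Nat.lt_succ_iff.1 hn)), rfl⟩
  rw [h3, Finset.sum_range_sub (fun n => Φ (P n))]
  simp [P]

end STPathTSP

end

noncomputable section

namespace STPathTSP

variable {V : Type u} [Fintype V] {s t : V} {x : Edge V → ℝ}

/-! ### Averaging over all trees -/

lemma integral_le_of_le_sub_add {a b : ℝ} (hab : a ≤ b) {m f g h : ℝ → ℝ} (hm : Continuous m)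
    (hf : Continuous f) (hg : Continuous g) (hh : Continuous h)
    (hle : ∀ σ ∈ Set.Icc a b, m σ ≤ f σ - g σ + h σ) :
    ∫ σ in a..b, m σ ≤ (∫ σ in a..b, f σ) - (∫ σ in a..b, g σ) + ∫ σ in a..b, h σ := by
  rw [← intervalIntegral.integral_sub (hf.intervalIntegrable _ _) (hg.intervalIntegrable _ _),
    ← intervalIntegral.integral_add (f := fun σ => f σ - g σ) ((hf.sub hg).intervalIntegrable _ _)
      (hh.intervalIntegrable _ _)]
  exact intervalIntegral.integral_mono_on hab (hm.intervalIntegrable _ _)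
    (((hf.sub hg).add hh).intervalIntegrable _ _) hle

namespace GVDecomposition

variable (D : GVDecomposition s t x)

/-- The total weight of the trees up to `S j`. -/
def prefixSum (j : Fin D.k) : ℝ := ∑ i ∈ Finset.Iic j, D.p i

lemma prefixSum_sub_nonneg (j : Fin D.k) : 0 ≤ D.prefixSum j - D.p j := by
  rw [sub_nonneg]
  exact Finset.single_le_sum (f := D.p) (fun i _ => D.p_nonneg i) (Finset.mem_Iic.2 le_rfl)

lemma prefixSum_le_one (j : Fin D.k) : D.prefixSum j ≤ 1 := by
  rw [← D.p_sum]
  exact Finset.sum_le_sum_of_subset_of_nonneg (Finset.subset_univ _) fun i _ _ => D.p_nonneg i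

lemma sum_telescope (Φ : ℝ → ℝ) :
    ∑ j, (Φ (D.prefixSum j) - Φ (D.prefixSum j - D.p j)) = Φ 1 - Φ 0 := by
  have hk : D.k ≠ 0 := by
    intro h
    have := D.p_sum
    have he : IsEmpty (Fin D.k) := by rw [h]; infer_instance
    simp at this
  obtain ⟨n, hn⟩ := Nat.exists_eq_succ_of_ne_zero hk
  let r : Fin D.k := ⟨n, by omega⟩
  have hr : Finset.Iic r = Finset.univ := by
    ext i
    rw [Finset.mem_Iic, Fin.le_def]
    have := i.2
    simp only [Finset.mem_univ, iff_true]
    change i.val ≤ n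
    omega
  have h := sum_Iic_telescope D.p Φ r
  rw [hr, D.p_sum] at h
  exact h

/-- The trees whose prefix sum is at most the slack are those up to the index r of C, apart from
trees of weight zero, whose terms vanish. So the slack is a breakpoint of the subdivision of [0,1].
-/
lemma sum_telescope_le (Φ : ℝ → ℝ) {C : Finset (Edge V)} (hC : C ∈ narrowCuts s t x) :
    ∑ j with D.prefixSum j ≤ slack x C,
      (Φ (D.prefixSum j) - Φ (D.prefixSum j - D.p j)) = Φ (slack x C) - Φ 0 := by
  obtain ⟨r, hr, -⟩ := D.narrow C hC
  have h := sum_Iic_telescope D.p Φ r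
  rw [hr] at h
  refine Eq.trans (Eq.symm (Finset.sum_subset ?_ ?_)) h
  · intro j hj
    rw [Finset.mem_Iic] at hj
    refine Finset.mem_filter.2 ⟨Finset.mem_univ _, ?_⟩
    rw [slack, ← hr]
    exact Finset.sum_le_sum_of_subset_of_nonneg (Finset.Iic_subset_Iic.2 hj)
      fun i _ _ => D.p_nonneg i
  · intro j hj hjr
    rw [Finset.mem_Iic] at hjr
    have hp : D.p j = 0 := by
      by_contra hp
      have hpos : 0 < D.p j := lt_of_le_of_ne (D.p_nonneg j) (Ne.symm hp)
      have h1 : ∑ i ∈ Finset.Iic r, D.p i + D.p j ≤ ∑ i ∈ Finset.Iic j, D.p i := by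
        rw [add_comm, ← Finset.sum_insert (by simpa using hjr)]
        refine Finset.sum_le_sum_of_subset_of_nonneg ?_ fun i _ _ => D.p_nonneg i
        intro i hi
        rw [Finset.mem_insert, Finset.mem_Iic] at hi
        rw [Finset.mem_Iic]
        rcases hi with rfl | hi
        · exact le_rfl
        · exact hi.trans (not_le.1 hjr).le
      have h2 := (Finset.mem_filter.1 hj).2
      rw [slack, ← hr, prefixSum] at h2
      linarith
    simp [hp]

lemma sum_telescope_not_le (Φ : ℝ → ℝ) {C : Finset (Edge V)} (hC : C ∈ narrowCuts s t x) :
    ∑ j with ¬ D.prefixSum j ≤ slack x C,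
      (Φ (D.prefixSum j) - Φ (D.prefixSum j - D.p j)) = Φ 1 - Φ (slack x C) := by
  have h1 := D.sum_telescope Φ
  have h2 := D.sum_telescope_le Φ hC
  rw [← Finset.sum_filter_add_sum_filter_not _ (fun j => D.prefixSum j ≤ slack x C)] at h1
  linarith

/-- The integral of `f` over the interval that belongs to the tree `S j`. -/
def treeIntegral (j : Fin D.k) (f : ℝ → ℝ) : ℝ :=
  ∫ σ in (D.prefixSum j - D.p j)..(D.prefixSum j), f σ

lemma treeIntegral_eq (j : Fin D.k) {f : ℝ → ℝ} (hf : Continuous f) :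
    D.treeIntegral j f = (∫ σ in (0 : ℝ)..(D.prefixSum j), f σ) -
      ∫ σ in (0 : ℝ)..(D.prefixSum j - D.p j), f σ :=
  (intervalIntegral.integral_interval_sub_left (hf.intervalIntegrable _ _)
    (hf.intervalIntegrable _ _)).symm

lemma sum_treeIntegral {f : ℝ → ℝ} (hf : Continuous f) :
    ∑ j, D.treeIntegral j f = ∫ σ in (0 : ℝ)..1, f σ := by
  simp only [D.treeIntegral_eq _ hf]
  rw [D.sum_telescope fun y => ∫ σ in (0 : ℝ)..y, f σ]
  simp

lemma sum_treeIntegral_le {f : ℝ → ℝ} (hf : Continuous f) {C : Finset (Edge V)}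
    (hC : C ∈ narrowCuts s t x) :
    ∑ j with D.prefixSum j ≤ slack x C, D.treeIntegral j f =
      ∫ σ in (0 : ℝ)..(slack x C), f σ := by
  simp only [D.treeIntegral_eq _ hf]
  rw [D.sum_telescope_le (fun y => ∫ σ in (0 : ℝ)..y, f σ) hC]
  simp

lemma sum_treeIntegral_not_le {f : ℝ → ℝ} (hf : Continuous f) {C : Finset (Edge V)}
    (hC : C ∈ narrowCuts s t x) :
    ∑ j with ¬ D.prefixSum j ≤ slack x C, D.treeIntegral j f =
      ∫ σ in (slack x C)..1, f σ := by
  simp only [D.treeIntegral_eq _ hf]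
  rw [D.sum_telescope_not_le (fun y => ∫ σ in (0 : ℝ)..y, f σ) hC]
  exact intervalIntegral.integral_interval_sub_left (hf.intervalIntegrable _ _)
    (hf.intervalIntegrable _ _)

lemma treeIntegral_of_p_eq_zero {j : Fin D.k} (hj : D.p j = 0) (f : ℝ → ℝ) :
    D.treeIntegral j f = 0 := by
  simp [treeIntegral, hj]

lemma treeIntegral_gain_nonneg (j : Fin D.k) {τ : ℝ} (hτ : 0 ≤ τ) :
    0 ≤ D.treeIntegral j (gain τ) := by
  refine intervalIntegral.integral_nonneg (by linarith [D.p_nonneg j]) fun σ hσ => ?_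
  have := D.prefixSum_sub_nonneg j
  exact mul_nonneg (by linarith [hσ.1]) (kern_pos σ).le

/-- The distribution over the trees in which `C` is lonely, proportional to the gains. -/
def lonelyWeight (C : Finset (Edge V)) (j : Fin D.k) : ℝ :=
  if D.prefixSum j ≤ slack x C then
    D.treeIntegral j (gain (slack x C)) / ∫ σ in (0 : ℝ)..(slack x C), gain (slack x C) σ
  else 0

lemma isLonelyWeight {C : Finset (Edge V)} (hC : C ∈ narrowCuts s t x) :
    D.IsLonelyWeight C (D.lonelyWeight C) where
  nonneg j := by
    have h1 := slack_pos hC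
    rw [lonelyWeight]
    split_ifs
    · exact div_nonneg (D.treeIntegral_gain_nonneg j h1.le) (integral_gain_pos h1).le
    · exact le_rfl
  sum_eq := by
    have h1 := slack_pos hC
    simp only [lonelyWeight]
    rw [← Finset.sum_filter, ← Finset.sum_div, D.sum_treeIntegral_le (continuous_gain _) hC,
      div_self (integral_gain_pos h1).ne']
  lonely j hj := by
    rw [lonelyWeight] at hj
    split_ifs at hj with h
    · have hp : 0 < D.p j := by
        refine lt_of_le_of_ne (D.p_nonneg j) fun hp => hj ?_
        rw [D.treeIntegral_of_p_eq_zero hp.symm, zero_div]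
      exact ⟨hp, lonely_of_le hp hC h⟩
    · exact absurd rfl hj

section

variable [MetricSpace V]

lemma sum_p_mul_cost : ∑ j, D.p j * cost (D.S j) = lpCost x := by
  have h : ∀ j, cost (D.S j) = ∑ e : Edge V, pairCost e.1 * incidence (D.S j) e := fun j =>
    (sum_mul_incidence (fun e : Edge V => pairCost e.1) _).symm
  simp only [lpCost, D.eq_sum, h, Finset.mul_sum]
  rw [Finset.sum_comm]
  exact Finset.sum_congr rfl fun e _ => Finset.sum_congr rfl fun j _ => by ring

/-- The average cost of the lonely edges of `C`. -/
def lonelyCost (C : Finset (Edge V)) : ℝ := ∑ i, D.lonelyWeight C i * cost (C ∩ D.S i)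

lemma lonelyCost_nonneg {C : Finset (Edge V)} (hC : C ∈ narrowCuts s t x) :
    0 ≤ D.lonelyCost C :=
  Finset.sum_nonneg fun i _ => mul_nonneg ((D.isLonelyWeight hC).nonneg i) (cost_nonneg _)

lemma lonelyCuts_eq_filter {j : Fin D.k} (hj : 0 < D.p j) : D.lonelyCuts j =
    (narrowCuts s t x).filter fun C => D.prefixSum j ≤ slack x C := by
  ext C
  rw [Finset.mem_filter]
  exact ⟨fun h => ⟨D.lonelyCuts_subset h, (D.mem_lonelyCuts.1 h).2.2⟩,
    fun h => lonely_of_le hj h.1 h.2⟩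

/-- The bound for S_j holds for every α; here α varies with σ over the interval of S_j, and the
inequality is weighted and integrated. All weights are uniform over the trees, so that the results
can be added up. -/
lemma treeIntegral_bound (hx : LPFeasible s t x) (hst : s ≠ t) (j : Fin D.k) {M : ℝ}
    (hM : ∀ J, IsTJoin (D.wrongParity j) J →
      M ≤ cost (D.forest j) + ∑ e ∈ J, D.modCost j e) :
    M * D.treeIntegral j (fun σ => 1 / 2 + 2 * kern σ) ≤
      D.p j * cost (D.S j) + lpCost x * D.treeIntegral j (fun σ => 2 * kern σ) -
      ∑ C ∈ narrowCuts s t x with D.prefixSum j ≤ slack x C,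
        D.treeIntegral j (gain (slack x C)) * cost (C ∩ D.S j) +
      ∑ C ∈ narrowCuts s t x with ¬ D.prefixSum j ≤ slack x C,
        D.treeIntegral j (loss (slack x C)) * D.lonelyCost C := by
  rcases (D.p_nonneg j).eq_or_lt' with hj | hj
  · simp [D.treeIntegral_of_p_eq_zero hj, hj]
  have hb := D.prefixSum_sub_nonneg j
  have ha := D.prefixSum_le_one j
  have hpt : ∀ σ ∈ Set.Icc (D.prefixSum j - D.p j) (D.prefixSum j),
      M * (1 / 2 + 2 * kern σ) ≤ cost (D.S j) + lpCost x * (2 * kern σ) -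
      ∑ C ∈ narrowCuts s t x with D.prefixSum j ≤ slack x C,
        gain (slack x C) σ * cost (C ∩ D.S j) +
      ∑ C ∈ narrowCuts s t x with ¬ D.prefixSum j ≤ slack x C,
        loss (slack x C) σ * D.lonelyCost C := by
    intro σ hσ
    have h0 : 0 ≤ σ := hb.trans hσ.1
    have h8 : 0 < 8 + σ := by positivity
    have h4 : 0 < 4 + σ := by positivity
    -- With this α, multiplication by 1/2 + 2/(4+σ) turns 1+α into 1, (1-α)/2 into 2/(4+σ), and the
    -- coefficients of the narrow cuts into `gain` and `loss`.
    obtain ⟨J, hJ, hJc⟩ := D.exists_join_sum_modCost_le hx hst hj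
      (α := σ / (8 + σ)) (by positivity) (by rw [div_le_one h8]; linarith)
      (fun C hC => D.isLonelyWeight hC)
    have hMJ := (hM J hJ).trans hJc
    have hw : 0 < 1 / 2 + 2 * kern σ := by
      have := kern_pos σ
      positivity
    have h1 := mul_le_mul_of_nonneg_left hMJ hw.le
    rw [mul_comm M]
    refine h1.trans (le_of_eq ?_)
    rw [D.lonelyCuts_eq_filter hj, ← Finset.filter_not]
    simp only [mul_add, mul_sub, Finset.mul_sum]
    have hk := kern_eq h0
    congr 1
    · congr 1
      · rw [hk]
        field_simp
        ring
      · refine Finset.sum_congr rfl fun C _ => ?_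
        rw [gain, hk]
        field_simp
        ring
    · refine Finset.sum_congr rfl fun C _ => ?_
      have : (1 / 2 + 2 * kern σ) * max 0 ((slack x C - σ / (8 + σ) * (slack x C + 2)) / 2) =
          loss (slack x C) σ := by
        rw [mul_max_of_nonneg _ _ hw.le, mul_zero, loss, hk]
        congr 1
        field_simp
        ring
      rw [lonelyCost, ← this, Finset.mul_sum]
      refine Finset.sum_congr rfl fun i _ => ?_
      ring_nf
  have hkc := continuous_kern
  have hcl : Continuous fun σ => M * (1 / 2 + 2 * kern σ) := by fun_prop
  have hc1 : Continuous fun σ => cost (D.S j) + lpCost x * (2 * kern σ) := by fun_prop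
  have hc2 : ∀ C, Continuous fun σ => gain (slack x C) σ * cost (C ∩ D.S j) := fun C =>
    (continuous_gain _).mul continuous_const
  have hc3 : ∀ C, Continuous fun σ => loss (slack x C) σ * D.lonelyCost C := fun C =>
    (continuous_loss _).mul continuous_const
  have hs2 := continuous_finsetSum ((narrowCuts s t x).filter fun C => D.prefixSum j ≤ slack x C)
    fun C _ => hc2 C
  have hs3 := continuous_finsetSum ((narrowCuts s t x).filter fun C => ¬ D.prefixSum j ≤ slack x C)
    fun C _ => hc3 C
  have hint := integral_le_of_le_sub_add (by linarith) hcl hc1 hs2 hs3 hpt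
  rw [intervalIntegral.integral_add (continuous_const.intervalIntegrable _ _)
      (Continuous.intervalIntegrable (by fun_prop) _ _),
    intervalIntegral.integral_finsetSum fun C _ => (hc2 C).intervalIntegrable _ _,
    intervalIntegral.integral_finsetSum fun C _ => (hc3 C).intervalIntegrable _ _] at hint
  simp only [intervalIntegral.integral_const_mul, intervalIntegral.integral_mul_const,
    intervalIntegral.integral_const, sub_sub_cancel, smul_eq_mul] at hint
  simpa only [treeIntegral, intervalIntegral.integral_const_mul] using hint

/-- The bound on the cheapest tour. -/
theorem le_rhoStar_mul_lpCost (hx : LPFeasible s t x) (hst : s ≠ t) {M : ℝ}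
    (hM : ∀ j, ∀ J, IsTJoin (D.wrongParity j) J →
      M ≤ cost (D.forest j) + ∑ e ∈ J, D.modCost j e) : M ≤ rhoStar * lpCost x := by
  have h1 := Finset.sum_le_sum fun j (_ : j ∈ Finset.univ) =>
    D.treeIntegral_bound hx hst j (hM j)
  have hkc := continuous_kern
  rw [← Finset.mul_sum, Finset.sum_add_distrib, Finset.sum_sub_distrib, Finset.sum_add_distrib,
    ← Finset.mul_sum, D.sum_treeIntegral (by fun_prop), D.sum_treeIntegral (by fun_prop),
    D.sum_p_mul_cost] at h1
  -- As `lonelyWeight` is proportional to the gains, the gains of C add up to their integral times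
  -- the same average cost by which its losses are measured.
  have h2 : ∑ j, ∑ C ∈ narrowCuts s t x with D.prefixSum j ≤ slack x C,
        D.treeIntegral j (gain (slack x C)) * cost (C ∩ D.S j) =
      ∑ C ∈ narrowCuts s t x, (∫ σ in (0 : ℝ)..(slack x C), gain (slack x C) σ) *
        D.lonelyCost C := by
    simp only [Finset.sum_filter]
    rw [Finset.sum_comm]
    refine Finset.sum_congr rfl fun C hC => ?_
    have hpos := integral_gain_pos (slack_pos hC)
    rw [lonelyCost, Finset.mul_sum]
    refine Finset.sum_congr rfl fun j _ => ?_
    rw [lonelyWeight]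
    split_ifs
    · field_simp
    · ring
  have h3 : ∑ j, ∑ C ∈ narrowCuts s t x with ¬ D.prefixSum j ≤ slack x C,
        D.treeIntegral j (loss (slack x C)) * D.lonelyCost C =
      ∑ C ∈ narrowCuts s t x, (∫ σ in (slack x C)..1, loss (slack x C) σ) *
        D.lonelyCost C := by
    simp only [Finset.sum_filter]
    rw [Finset.sum_comm]
    refine Finset.sum_congr rfl fun C hC => ?_
    rw [← Finset.sum_filter, ← Finset.sum_mul,
      D.sum_treeIntegral_not_le (continuous_loss _) hC]
  have h4 : ∑ C ∈ narrowCuts s t x, (∫ σ in (slack x C)..1, loss (slack x C) σ) *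
        D.lonelyCost C ≤ ∑ C ∈ narrowCuts s t x,
      (∫ σ in (0 : ℝ)..(slack x C), gain (slack x C) σ) * D.lonelyCost C :=
    Finset.sum_le_sum fun C hC => mul_le_mul_of_nonneg_right
      (integral_loss_le_integral_gain (slack_pos hC).le) (D.lonelyCost_nonneg hC)
  have h5 : ∫ σ in (0 : ℝ)..1, 2 * kern σ = 2 * Real.log (5 / 4) := by
    rw [intervalIntegral.integral_const_mul, integral_kern]
  have h6 : ∫ σ in (0 : ℝ)..1, (1 / 2 + 2 * kern σ) = 1 / 2 + 2 * Real.log (5 / 4) := by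
    rw [intervalIntegral.integral_add (continuous_const.intervalIntegrable _ _)
      (Continuous.intervalIntegrable (by fun_prop) _ _), h5]
    simp
  rw [h2, h3, h5, h6] at h1
  have hlog : 0 < Real.log (5 / 4) := Real.log_pos (by norm_num)
  have h7 : M * (1 + 4 * Real.log (5 / 4)) ≤ lpCost x * (2 + 4 * Real.log (5 / 4)) := by linarith
  have hpos : 0 < 1 + 4 * Real.log (5 / 4) := by positivity
  rw [rhoStar, ← mul_le_mul_iff_of_pos_right hpos]
  refine h7.trans (le_of_eq ?_)
  field_simp
  ring

end

end GVDecomposition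

end STPathTSP

end

/-! ### The numerical bound, the output and the integrality ratio -/

noncomputable section

namespace STPathTSP

lemma rhoStar_lt : rhoStar < 1.5284 := by
  -- Seven terms of the series of -ln(1 - 1/5) = ln(5/4) suffice for ln(5/4) > 0.22313, and 0.5284
  -- (1 + 4 · 0.22313) > 1.
  have h := Real.abs_log_sub_add_sum_range_le (x := 1 / 5) (by rw [abs_of_pos] <;> norm_num) 7
  have h1 := (abs_le.1 h).2
  rw [abs_of_pos (by norm_num : (0 : ℝ) < 1 / 5)] at h1
  norm_num [Finset.sum_range_succ] at h1
  have h2 : Real.log (5 / 4) = - Real.log (4 / 5) := by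
    rw [← Real.log_inv]; norm_num
  have hlog : 0.22313 < Real.log (5 / 4) := by
    rw [h2]
    norm_num
    linarith
  rw [rhoStar]
  have h3 : 1 / (1 + 4 * Real.log (5 / 4)) < 0.5284 := by
    rw [div_lt_iff₀ (by linarith)]
    norm_num at hlog ⊢
    linarith
  norm_num at h3 ⊢
  linarith

variable {V : Type u} [Fintype V] [MetricSpace V] {s t : V} {x : Edge V → ℝ}

namespace GVDecomposition

variable (D : GVDecomposition s t x)

lemma exists_isOutput (hst : s ≠ t) : ∃ P, D.IsOutput P := by
  choose Q hQ using D.exists_isTourOfTree hst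
  have hne : Nonempty (Fin D.k) := by
    by_contra h
    rw [not_nonempty_iff] at h
    have := D.p_sum
    simp at this
  obtain ⟨i, -, hi⟩ := Finset.univ.exists_min_image (fun j => walkCost (Q j)) Finset.univ_nonempty
  exact ⟨Q i, Q, hQ, i, rfl, fun j => hi j (Finset.mem_univ j)⟩

variable {D} in
lemma IsOutput.isTour {P : (⊤ : SimpleGraph V).Walk s t} (hP : D.IsOutput P) : IsTour P := by
  obtain ⟨Q, hQ, i, rfl, -⟩ := hP
  obtain ⟨_, _, _, _, _, _, h, _⟩ := hQ i
  exact h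

variable {D} in
lemma IsOutput.walkCost_le {P : (⊤ : SimpleGraph V).Walk s t} (hP : D.IsOutput P)
    (hx : LPFeasible s t x) (hst : s ≠ t) : walkCost P ≤ rhoStar * lpCost x := by
  obtain ⟨Q, hQ, i, rfl, hmin⟩ := hP
  exact D.le_rhoStar_mul_lpCost hx hst fun j J hJ =>
    (hmin j).trans ((hQ j).walkCost_le D hst hJ)

end GVDecomposition

lemma rhoStar_nonneg : 0 ≤ rhoStar := by
  have : 0 < Real.log (5 / 4) := Real.log_pos (by norm_num)
  rw [rhoStar]
  positivity

lemma optValue_div_lpValue_le (hst : s ≠ t) :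
    optValue s t / lpValue s t ≤ ENNReal.ofReal rhoStar := by
  obtain ⟨x, hx, hmin⟩ := exists_isLPOptimum hst
  obtain ⟨D⟩ := hx.nonempty_gvDecomposition hst
  obtain ⟨P, hP⟩ := D.exists_isOutput hst
  refine ENNReal.div_le_of_le_mul ?_
  have h1 : ENNReal.ofReal (lpCost x) ≤ lpValue s t :=
    le_iInf₂ fun y hy => ENNReal.ofReal_le_ofReal (hmin y hy)
  calc optValue s t ≤ ENNReal.ofReal (walkCost P) := iInf₂_le P hP.isTour
    _ ≤ ENNReal.ofReal (rhoStar * lpCost x) := ENNReal.ofReal_le_ofReal (hP.walkCost_le hx hst)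
    _ = ENNReal.ofReal rhoStar * ENNReal.ofReal (lpCost x) := ENNReal.ofReal_mul rhoStar_nonneg
    _ ≤ ENNReal.ofReal rhoStar * lpValue s t := mul_le_mul_right h1 _

end STPathTSP

end

theorem mainTheorem1 :
    STPathTSP.rhoStar < 1.5284 ∧
    (∀ (V : Type u) [Fintype V] [MetricSpace V] (s t : V), s ≠ t →
      (∃ x, STPathTSP.IsLPOptimum s t x) ∧
      ∀ x, STPathTSP.IsLPOptimum s t x →
        Nonempty (STPathTSP.GVDecomposition s t x) ∧
        ∀ D : STPathTSP.GVDecomposition s t x,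
          (∃ P, D.IsOutput P) ∧
          ∀ P, D.IsOutput P →
            STPathTSP.IsTour P ∧
            STPathTSP.walkCost P ≤ STPathTSP.rhoStar * STPathTSP.lpCost x) ∧
    STPathTSP.integralityRatio.{u} ≤ ENNReal.ofReal STPathTSP.rhoStar := by
  refine ⟨STPathTSP.rhoStar_lt, fun V _ _ s t hst => ⟨STPathTSP.exists_isLPOptimum hst,
    fun x hx => ⟨hx.1.nonempty_gvDecomposition hst, fun D => ⟨D.exists_isOutput hst,
      fun P hP => ⟨hP.isTour, hP.walkCost_le hx.1 hst⟩⟩⟩⟩, ?_⟩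
  exact iSup_le fun V => iSup_le fun _ => iSup_le fun _ => iSup_le fun s => iSup_le fun t =>
    iSup_le fun hst => STPathTSP.optValue_div_lpValue_le hst
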